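/- **Problem.** An instance of the $(L,\{U_u\},\emptyset,p)$-Center problem consists of a finite set $V$ of $n$ vertices with a symmetric distance function $\mathrm d:V\times V\to\mathbb R_{\ge 0}$ that satisfies the triangle inequality and $\mathrm d(v,v)=0$ for all $v\in V$, integers $L,p\ge 0$, and an integer $U_u\ge L$ for every $u\in V$. A feasible solution is a triple $(C,F,\varphi)$, where $C\subseteq V$ is a set of at least $p$ served vertices (so up to $n-p$ outliers are left out), $F\subseteq V$ is a set of open centers of arbitrary size (at most one center is opened at each vertex, i.e. capacities are hard), and $\varphi:C\to F$ is a function with $L\le|\varphi^{-1}(u)|\le U_u$ for every $u\in F$. Its value is the maximum cluster radius $\max_{v\in C}\mathrm d(v,\varphi(v))$, which is to be minimized (the value is $0$ if $C=\emptyset$). **Theorem.** There is a polynomial-time $11$-approximation algorithm for the $(L,\{U_u\},\emptyset,p)$-Center problem. That is, there is a single deterministic algorithm that halts on every instance within a number of steps bounded by a polynomial in $n$ and that, on every instance that has a feasible solution, outputs a feasible solution $(C,F,\varphi)$ with $$\max_{v\in C}\mathrm d(v,\varphi(v))\;\le\; 11\cdot\max_{v\in C'}\mathrm d(v,\varphi'(v))\qquad\text{for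 every feasible solution }(C',F',\varphi').$$ Here an algorithm is a program of a random access machine over the natural numbers with unit-cost addition, truncated subtraction, comparison and indirect addressing (no multiplication), which is given $n$, $L$, $p$ and the numbers $U_u$ in its memory and has access to the distances only through unit-cost tests whether $\mathrm d(i,j)\le\mathrm d(k,l)$. -/

import Mathlib

open scoped NNReal

namespace CapCenter

/-! ### The capacitated center problem -/

/-- An instance of the `(L, {U_u}, ∅, p)`-Center problem on the vertex set `V`, every vertex being
both a client and a possible center: a uniform capacity lower bound `L`, capacity upper bounds
`U u ≥ L`, the number `p` of vertices that have to be served, and a (pseudo)metric `d`. -/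
structure Instance (V : Type*) where
  L : ℕ
  U : V → ℕ
  p : ℕ
  d : V → V → ℝ≥0
  L_le_U : ∀ u, L ≤ U u
  d_self : ∀ u, d u u = 0
  d_comm : ∀ u v, d u v = d v u
  d_triangle : ∀ u v w, d u w ≤ d u v + d v w

/-- A candidate solution `(C, F, φ)`: the set `C` of served vertices, the set `F` of open centers
(a set: at most one center is opened at a vertex) and the assignment `φ`. Only the values of `φ`
on `C` matter. -/
structure Solution (V : Type*) where
  C : Finset V
  F : Finset V
  φ : V → V

variable {V : Type*} [DecidableEq V]

/-- `(C, F, φ)` is feasible: at least `p` vertices are served, `φ` maps `C` into `F`, and every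
open center serves between `L` and `U u` vertices. The number of open centers is arbitrary. -/
structure Instance.IsFeasible (I : Instance V) (S : Solution V) : Prop where
  p_le_card : I.p ≤ S.C.card
  mapsTo : ∀ v ∈ S.C, S.φ v ∈ S.F
  lower : ∀ u ∈ S.F, I.L ≤ (S.C.filter fun v => S.φ v = u).card
  upper : ∀ u ∈ S.F, (S.C.filter fun v => S.φ v = u).card ≤ I.U u

/-- The maximum cluster radius `max_{v ∈ C} d (v, φ v)` (zero if nobody is served). -/
noncomputable def Instance.radius {V : Type*} (I : Instance V) (S : Solution V) : ℝ≥0 :=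
  S.C.sup fun v => I.d v (S.φ v)

/-- `S` is feasible and its radius is at most `ρ` times that of every feasible solution, that is,
at most `ρ` times the optimum. -/
def Instance.IsApprox (I : Instance V) (ρ : ℝ≥0) (S : Solution V) : Prop :=
  I.IsFeasible S ∧ ∀ S', I.IsFeasible S' → I.radius S ≤ ρ * I.radius S'

/-! ### The machine model

A random access machine with structured control. It has scalar registers and two-dimensional
arrays of unbounded natural numbers, and its arithmetic consists of addition and truncated
subtraction only (no multiplication), so that a polynomial number of unit-cost steps can only
create numbers of polynomial bit length. The real distances of the input cannot be read or
computed with: a program can only test whether `d i j ≤ d k l`. -/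

/-- The memory: `reg x` is the register `x`, and `arr a i j` is the entry `(i, j)` of the
array `a`. A program names only finitely many registers and arrays. -/
structure Store where
  reg : ℕ → ℕ
  arr : ℕ → ℕ → ℕ → ℕ

/-- Arithmetic expressions. -/
inductive Expr where
  | const (k : ℕ)
  | reg (x : ℕ)
  | read (a : ℕ) (i j : Expr)
  | plus (e f : Expr)
  | minus (e f : Expr)

/-- The value of an expression (`minus` is truncated subtraction). -/
def Expr.eval (s : Store) : Expr → ℕ
  | const k => k
  | reg x => s.reg x
  | read a i j => s.arr a (i.eval s) (j.eval s)
  | plus e f => e.eval s + f.eval s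
  | minus e f => e.eval s - f.eval s

/-- The time for evaluating an expression: the number of its operations. -/
def Expr.cost : Expr → ℕ
  | const _ => 1
  | reg _ => 1
  | read _ i j => i.cost + j.cost + 1
  | plus e f => e.cost + f.cost + 1
  | minus e f => e.cost + f.cost + 1

/-- Tests: `distLe i j k l` asks whether `d i j ≤ d k l`. -/
inductive Test where
  | le (e f : Expr)
  | distLe (i j k l : Expr)
  | not (b : Test)
  | and (b c : Test)

/-- The truth of a test, for a given comparison oracle `D` for distances. -/
def Test.Holds (D : ℕ → ℕ → ℕ → ℕ → Prop) (s : Store) : Test → Prop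
  | le e f => e.eval s ≤ f.eval s
  | distLe i j k l => D (i.eval s) (j.eval s) (k.eval s) (l.eval s)
  | not b => ¬ b.Holds D s
  | and b c => b.Holds D s ∧ c.Holds D s

/-- The time for evaluating a test. -/
def Test.cost : Test → ℕ
  | le e f => e.cost + f.cost + 1
  | distLe i j k l => i.cost + j.cost + k.cost + l.cost + 1
  | not b => b.cost + 1
  | and b c => b.cost + c.cost + 1

/-- Programs: `assign x e` stores `e` in register `x`, `write a i j e` stores `e` in the entry
`(i, j)` of the array `a`, and `loop b P` repeats `P` while the test `b` holds. -/
inductive Program where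
  | skip
  | assign (x : ℕ) (e : Expr)
  | write (a : ℕ) (i j e : Expr)
  | seq (P Q : Program)
  | ite (b : Test) (P Q : Program)
  | loop (b : Test) (P : Program)

/-- The memory after storing `k` in register `x`. -/
def Store.setReg (s : Store) (x k : ℕ) : Store :=
  { s with reg := fun y => if y = x then k else s.reg y }

/-- The memory after storing `k` in the entry `(i, j)` of the array `a`. -/
def Store.setArr (s : Store) (a i j k : ℕ) : Store :=
  { s with arr := fun a' i' j' => if a' = a ∧ i' = i ∧ j' = j then k else s.arr a' i' j' }

/-- `Exec D P s s' t`: started in the memory `s`, the program `P` halts after `t` steps with the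
memory `s'`. -/
inductive Exec (D : ℕ → ℕ → ℕ → ℕ → Prop) : Program → Store → Store → ℕ → Prop where
  | skip (s : Store) : Exec D .skip s s 1
  | assign (x : ℕ) (e : Expr) (s : Store) :
      Exec D (.assign x e) s (s.setReg x (e.eval s)) (e.cost + 1)
  | write (a : ℕ) (i j e : Expr) (s : Store) :
      Exec D (.write a i j e) s (s.setArr a (i.eval s) (j.eval s) (e.eval s))
        (i.cost + j.cost + e.cost + 1)
  | seq {P Q : Program} {s s' s'' : Store} {t t' : ℕ} :
      Exec D P s s' t → Exec D Q s' s'' t' → Exec D (.seq P Q) s s'' (t + t')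
  | ite_true {b : Test} {P Q : Program} {s s' : Store} {t : ℕ} :
      b.Holds D s → Exec D P s s' t → Exec D (.ite b P Q) s s' (b.cost + t)
  | ite_false {b : Test} {P Q : Program} {s s' : Store} {t : ℕ} :
      ¬ b.Holds D s → Exec D Q s s' t → Exec D (.ite b P Q) s s' (b.cost + t)
  | loop_done {b : Test} {P : Program} {s : Store} :
      ¬ b.Holds D s → Exec D (.loop b P) s s b.cost
  | loop_step {b : Test} {P : Program} {s s' s'' : Store} {t t' : ℕ} :
      b.Holds D s → Exec D P s s' t → Exec D (.loop b P) s' s'' t' →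
      Exec D (.loop b P) s s'' (b.cost + t + t')

/-! ### Input, output and polynomial-time approximation -/

/-- The comparison oracle of an instance on the vertices `0, …, n - 1` (false if some index is
not a vertex). -/
def Instance.distLe {n : ℕ} (I : Instance (Fin n)) (i j k l : ℕ) : Prop :=
  ∃ (hi : i < n) (hj : j < n) (hk : k < n) (hl : l < n),
    I.d ⟨i, hi⟩ ⟨j, hj⟩ ≤ I.d ⟨k, hk⟩ ⟨l, hl⟩

/-- The initial memory: `n`, `L`, `p` are in the registers `0`, `1`, `2`, the upper bound `U u` is
in the entry `(u, 0)` of the array `0`, and everything else is zero. -/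
def Instance.input {n : ℕ} (I : Instance (Fin n)) : Store where
  reg x := if x = 0 then n else if x = 1 then I.L else if x = 2 then I.p else 0
  arr a i j := if h : i < n then (if a = 0 ∧ j = 0 then I.U ⟨i, h⟩ else 0) else 0

/-- The memory `s` contains the output `(C, F, φ)`: the entries `(v, 0)` of the arrays `1`, `2`, `3`
say whether `v` is in `C` (nonzero if so), whether `v` is in `F`, and, for `v` in `C`,
what `φ v` is. -/
def Store.Outputs {n : ℕ} (s : Store) (S : Solution (Fin n)) : Prop :=
  (∀ v : Fin n, v ∈ S.C ↔ s.arr 1 v 0 ≠ 0) ∧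
  (∀ v : Fin n, v ∈ S.F ↔ s.arr 2 v 0 ≠ 0) ∧
  (∀ v ∈ S.C, s.arr 3 v 0 = (S.φ v : ℕ))

/-- `P` is a polynomial-time `ρ`-approximation algorithm for the `(L, {U_u}, ∅, p)`-Center problem:
on every instance it halts within a number of steps that is polynomial in the number `n` of
vertices, and if the instance has a feasible solution, then `P` outputs a feasible solution whose
radius is at most `ρ` times the optimum. -/
def Program.IsPolyTimeApprox (P : Program) (ρ : ℝ≥0) : Prop :=
  ∃ q : Polynomial ℕ, ∀ (n : ℕ) (I : Instance (Fin n)),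
    ∃ (s : Store) (t : ℕ), Exec I.distLe P I.input s t ∧ t ≤ q.eval n ∧
      ((∃ S, I.IsFeasible S) → ∃ S, s.Outputs S ∧ I.IsApprox ρ S)

end CapCenter

/-! Fix a pair `k`, `l` and join two vertices when their distance is at most `d k l`. If a feasible
solution has radius at most `d k l`, its nonempty clusters are stars of this threshold graph,
centred at allowed vertices: at least `max L 1` neighbours and at least that capacity. It suffices
to open centers for each pair and assign clients to them along walks of `11` edges, with correct
loads, so that at least as many clients are served as by any such solution. By the triangle
inequality `11` hops cost at most `11 * d k l`, and the radius of every solution is the distance of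
some pair; so the best pair for which `p` clients are served is good enough.

Core centers are allowed vertices, no two within two hops, chosen one by one so that in the end
every allowed vertex is within two hops of one. An uncovered vertex four hops from an earlier core
center is preferred and becomes the child of that center; only if there is none is a new root
chosen. This splits the core centers into components, and all clients of an allowed vertex belong to
one component (`CoreSystem.era_own`). Clients are attached to core centers and sent up the trees so
that a multiple `L * cap c` of `L` stays at each core center `c`, the surplus of fewer than `L`
going to the parent (`CoreSystem.exists_blocks`). Each kept client is within five hops of its core
center; fewer than `L` clients per component, the surplus of its root, stay nowhere.

The opened vertices are found by a greedy assignment, in the order of decreasing `U`, of allowed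
vertices to core centers within six hops, with capacities `cap`. By a Hall argument, in every
component and at every capacity level at least as many vertices are opened as any solution uses
(`card_level_le`).

Clients are then assigned to opened vertices within `6 + 5 = 11` hops, first with capacity `L` and
then, by augmentation that never lowers a load, with capacity `U u`. Maximum assignments equal cuts
(`exists_cut`), so cuts need lower bounds: `mul_card_le_cut` shows that every opened vertex receives
`L` clients, and `card_le_cut`, the sum of `component_cut` over the components, that at least as
many clients are served as in any solution. The delicate point there is to pay for the fewer than
`L` clients that stay nowhere.

For the machine, the algorithm is written in a language whose only loops are sums over, updates on
and iterations along the range below `n`. Compilation is correct and polynomial by induction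
(`Tm.comp_correct`, `Cmd.comp_correct`), so only the values computed have to be discussed
afterwards. -/

namespace CapCenter

/-! ### A small language with bounded sums and simultaneous array updates -/

/-- Terms of the source language. `sum x e` is the sum of `e` over all values of the variable `x`
below the content of register `0`, and `dle i j k l` is `1` or `0` according to the oracle. -/
inductive Tm where
  | const (k : ℕ)
  | var (x : ℕ)
  | reg (x : ℕ)
  | read (a : ℕ) (i j : Tm)
  | plus (e f : Tm)
  | minus (e f : Tm)
  | dle (i j k l : Tm)
  | cond (t e f : Tm)
  | sum (x : ℕ) (e : Tm)

open Classical in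
/-- The value of a term in a memory and an environment for the variables. -/
noncomputable def Tm.eval (D : ℕ → ℕ → ℕ → ℕ → Prop) (s : Store) : Tm → (ℕ → ℕ) → ℕ
  | const k, _ => k
  | var x, ρ => ρ x
  | reg x, _ => s.reg x
  | read a i j, ρ => s.arr a (i.eval D s ρ) (j.eval D s ρ)
  | plus e f, ρ => e.eval D s ρ + f.eval D s ρ
  | minus e f, ρ => e.eval D s ρ - f.eval D s ρ
  | dle i j k l, ρ =>
      if D (i.eval D s ρ) (j.eval D s ρ) (k.eval D s ρ) (l.eval D s ρ) then 1 else 0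
  | cond t e f, ρ => if t.eval D s ρ ≠ 0 then e.eval D s ρ else f.eval D s ρ
  | sum x e, ρ => ∑ i ∈ Finset.range (s.reg 0), e.eval D s (Function.update ρ x i)

/-- Registers from this one on are reserved for compiled code. -/
abbrev tempReg : ℕ := 32

/-- The array reserved for compiled code. -/
abbrev tempArr : ℕ := 100

/-- A term is well-formed if it mentions neither the reserved registers nor the reserved array. -/
def Tm.wf : Tm → Bool
  | const _ => true
  | var _ => true
  | reg x => decide (x < tempReg)
  | read a i j => decide (a ≠ tempArr) && i.wf && j.wf
  | plus e f => e.wf && f.wf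
  | minus e f => e.wf && f.wf
  | dle i j k l => i.wf && j.wf && k.wf && l.wf
  | cond t e f => t.wf && e.wf && f.wf
  | sum _ e => e.wf

/-- Two memories agree on everything that is not reserved for compiled code. -/
def Agree (s s' : Store) : Prop :=
  (∀ x < tempReg, s'.reg x = s.reg x) ∧ ∀ a, a ≠ tempArr → s'.arr a = s.arr a

theorem Agree.refl (s : Store) : Agree s s := ⟨fun _ _ => rfl, fun _ _ => rfl⟩

/-- Compiled code spoils only what is reserved, so subterms can be evaluated one after another as if
the memory had not changed. -/
theorem Tm.eval_congr {D : ℕ → ℕ → ℕ → ℕ → Prop} {s s' : Store} (h : Agree s s') :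
    ∀ (e : Tm), e.wf = true → ∀ ρ, e.eval D s' ρ = e.eval D s ρ := by
  intro e
  induction e with
  | const k => intros; rfl
  | var x => intros; rfl
  | reg x => intro hw ρ; exact h.1 x (by simpa [Tm.wf] using hw)
  | read a i j hi hj =>
    intro hw ρ
    simp only [Tm.wf, Bool.and_eq_true, decide_eq_true_eq] at hw
    simp only [Tm.eval, hi hw.1.2, hj hw.2, h.2 a hw.1.1]
  | plus e f he hf =>
    intro hw ρ
    simp only [Tm.wf, Bool.and_eq_true] at hw
    simp only [Tm.eval, he hw.1, hf hw.2]
  | minus e f he hf =>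
    intro hw ρ
    simp only [Tm.wf, Bool.and_eq_true] at hw
    simp only [Tm.eval, he hw.1, hf hw.2]
  | dle i j k l hi hj hk hl =>
    intro hw ρ
    simp only [Tm.wf, Bool.and_eq_true] at hw
    simp only [Tm.eval]
    rw [hi hw.1.1.1, hj hw.1.1.2, hk hw.1.2, hl hw.2]
  | cond t e f ht he hf =>
    intro hw ρ
    simp only [Tm.wf, Bool.and_eq_true] at hw
    simp only [Tm.eval, ht hw.1.1, he hw.1.2, hf hw.2]
  | sum x e he =>
    intro hw ρ
    simp only [Tm.wf] at hw
    simp only [Tm.eval, he hw, h.1 0 (by decide)]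

/-- The loop `for r < n`. -/
def forLoop (r : ℕ) (P : Program) : Program :=
  .seq (.assign r (.const 0))
    (.loop (.not (.le (.reg 0) (.reg r))) (.seq P (.assign r (.plus (.reg r) (.const 1)))))

@[simp] theorem Store.setReg_reg (s : Store) (x k y : ℕ) :
    (s.setReg x k).reg y = if y = x then k else s.reg y := rfl

@[simp] theorem Store.setReg_arr (s : Store) (x k : ℕ) : (s.setReg x k).arr = s.arr := rfl

theorem Store.setArr_arr (s : Store) (a i j k a' i' j' : ℕ) :
    (s.setArr a i j k).arr a' i' j' = if a' = a ∧ i' = i ∧ j' = j then k else s.arr a' i' j' := rfl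

/-- Invariant rule for counting loops; the invariant must tolerate any write to the counter `r`. The
overhead of `8` per round is `4` for the test and `4` for the increment; the final `6` is the
initialisation and the failing test. -/
theorem exec_forLoop {D : ℕ → ℕ → ℕ → ℕ → Prop} {P : Program} {r n B : ℕ}
    (J : ℕ → Store → Prop) (hn : ∀ i s, J i s → s.reg 0 = n)
    (hset : ∀ i s v, J i s → J i (s.setReg r v))
    (hstep : ∀ i s, i < n → J i s → s.reg r = i →
      ∃ s' t, Exec D P s s' t ∧ t ≤ B ∧ J (i + 1) s' ∧ s'.reg r = i) (s : Store) (h0 : J 0 s) :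
    ∃ s' t, Exec D (forLoop r P) s s' t ∧ t ≤ n * (B + 8) + 6 ∧ J n s' := by
  have key : ∀ m i s, i + m = n → J i s → s.reg r = i →
      ∃ s' t, Exec D (.loop (.not (.le (.reg 0) (.reg r)))
        (.seq P (.assign r (.plus (.reg r) (.const 1))))) s s' t ∧ t ≤ m * (B + 8) + 4 ∧ J n s' := by
    intro m
    induction m with
    | zero =>
      intro i s hi hJ hri
      refine ⟨s, _, .loop_done ?_, ?_, ?_⟩
      · simp [Test.Holds, Expr.eval, hri, hn i s hJ]; omega
      · simp [Test.cost, Expr.cost]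
      · have : i = n := by omega
        exact this ▸ hJ
    | succ m ih =>
      intro i s hi hJ hri
      obtain ⟨s', t, hE, ht, hJ', hr'⟩ := hstep i s (by omega) hJ hri
      obtain ⟨s'', t', hE', ht', hJ''⟩ := ih (i + 1) (s'.setReg r (i + 1)) (by omega)
        (hset _ _ _ hJ') (by simp)
      have hA := Exec.assign (D := D) r (.plus (.reg r) (.const 1)) s'
      simp only [Expr.eval, hr'] at hA
      refine ⟨s'', _, .loop_step ?_ (.seq hE hA) hE', ?_, hJ''⟩
      · simp [Test.Holds, Expr.eval, hri, hn i s hJ]; omega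
      · simp only [Test.cost, Expr.cost]
        rw [Nat.add_mul]; omega
  obtain ⟨s', t, hE, ht, hJ⟩ := key n 0 (s.setReg r 0) (by omega) (hset _ _ _ h0) (by simp)
  exact ⟨s', _, .seq (.assign r (.const 0) s) hE, by simp only [Expr.cost]; omega, hJ⟩

/-- Code that stores the value of a term in register `k`, using only registers from `k` on. The
variables of the term are in the registers given by `κ`. -/
def Tm.comp : Tm → (ℕ → ℕ) → ℕ → Program
  | const c, _, k => .assign k (.const c)
  | var x, κ, k => .assign k (.reg (κ x))
  | reg x, _, k => .assign k (.reg x)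
  | read a i j, κ, k =>
      .seq (i.comp κ k) (.seq (j.comp κ (k + 1)) (.assign k (.read a (.reg k) (.reg (k + 1)))))
  | plus e f, κ, k =>
      .seq (e.comp κ k) (.seq (f.comp κ (k + 1)) (.assign k (.plus (.reg k) (.reg (k + 1)))))
  | minus e f, κ, k =>
      .seq (e.comp κ k) (.seq (f.comp κ (k + 1)) (.assign k (.minus (.reg k) (.reg (k + 1)))))
  | dle e f g h, κ, k =>
      .seq (e.comp κ k) (.seq (f.comp κ (k + 1)) (.seq (g.comp κ (k + 2)) (.seq (h.comp κ (k + 3))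
        (.ite (.distLe (.reg k) (.reg (k + 1)) (.reg (k + 2)) (.reg (k + 3)))
          (.assign k (.const 1)) (.assign k (.const 0))))))
  | cond t e f, κ, k =>
      .seq (t.comp κ k) (.ite (.le (.const 1) (.reg k)) (e.comp κ k) (f.comp κ k))
  | sum x e, κ, k =>
      .seq (.assign k (.const 0)) (forLoop (k + 1)
        (.seq (e.comp (Function.update κ x (k + 1)) (k + 2))
          (.assign k (.plus (.reg k) (.reg (k + 2))))))

/-- Running `P` from `s` takes at most `B` steps and ends with `v` in register `k`, all registers
below `k` and all arrays being unchanged. -/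
def Computes (D : ℕ → ℕ → ℕ → ℕ → Prop) (P : Program) (s : Store) (k v B : ℕ) : Prop :=
  ∃ s' t, Exec D P s s' t ∧ t ≤ B ∧ s'.arr = s.arr ∧ (∀ y < k, s'.reg y = s.reg y) ∧ s'.reg k = v

theorem agree_of_eq {s s' : Store} {k : ℕ} (hk : tempReg ≤ k) (ha : s'.arr = s.arr)
    (hr : ∀ y < k, s'.reg y = s.reg y) : Agree s s' :=
  ⟨fun x hx => hr x (lt_of_lt_of_le hx hk), fun a _ => by rw [ha]⟩

/-- Registers are used as a stack: a subterm computed from register `k` on leaves everything below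
`k` alone. The polynomial is chosen before the oracle, the memory and the registers, so that one
bound serves all instances. -/
theorem Tm.comp_correct (e : Tm) :
    e.wf = true → ∃ q : Polynomial ℕ, ∀ D k κ ρ s, tempReg ≤ k → (∀ x, κ x < k) →
      (∀ x, s.reg (κ x) = ρ x) →
      Computes D (e.comp κ k) s k (e.eval D s ρ) (q.eval (s.reg 0)) := by
  -- Two operands in succession: the second one is computed from `k + 1` on and thus preserves the
  -- first value in `k` and the variables below `k`.
  have two : ∀ (D : ℕ → ℕ → ℕ → ℕ → Prop) (e f : Tm) (qe qf : Polynomial ℕ) (k : ℕ) (κ ρ : ℕ → ℕ) (s : Store),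
      f.wf = true → tempReg ≤ k → (∀ x, κ x < k) → (∀ x, s.reg (κ x) = ρ x) →
      (∀ D k κ ρ s, tempReg ≤ k → (∀ x, κ x < k) → (∀ x, s.reg (κ x) = ρ x) →
        Computes D (e.comp κ k) s k (e.eval D s ρ) (qe.eval (s.reg 0))) →
      (∀ D k κ ρ s, tempReg ≤ k → (∀ x, κ x < k) → (∀ x, s.reg (κ x) = ρ x) →
        Computes D (f.comp κ k) s k (f.eval D s ρ) (qf.eval (s.reg 0))) →
      ∃ s' s'' t t', Exec D (e.comp κ k) s s' t ∧ Exec D (f.comp κ (k + 1)) s' s'' t' ∧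
        t ≤ qe.eval (s.reg 0) ∧ t' ≤ qf.eval (s.reg 0) ∧ s''.arr = s.arr ∧
        (∀ y < k, s''.reg y = s.reg y) ∧ s''.reg k = e.eval D s ρ ∧
        s''.reg (k + 1) = f.eval D s ρ := by
    intro D e f qe qf k κ ρ s hfw hk hκ hρ he hf
    obtain ⟨s', t, hE, ht, ha, hr, hv⟩ := he D k κ ρ s hk hκ hρ
    obtain ⟨s'', t', hE', ht', ha', hr', hv'⟩ := hf D (k + 1) κ ρ s' (by omega)
      (fun x => (hκ x).trans (by omega)) (fun x => by rw [hr _ (hκ x), hρ])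
    refine ⟨s', s'', t, t', hE, hE', ht, ?_, ha'.trans ha,
      fun y hy => (hr' y (by omega)).trans (hr y hy), (hr' k (by omega)).trans hv, ?_⟩
    · rwa [hr 0 (lt_of_lt_of_le (by decide) hk)] at ht'
    · rw [hv', Tm.eval_congr (agree_of_eq hk ha hr) f hfw]
  induction e with
  | const c =>
    intro _
    refine ⟨Polynomial.C 2, fun D k κ ρ s hk hκ hρ => ⟨_, _, .assign _ _ _, ?_, rfl, ?_, ?_⟩⟩
    · simp [Expr.cost]
    · intro y hy; simp; omega
    · simp [Expr.eval, Tm.eval]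
  | var x =>
    intro _
    refine ⟨Polynomial.C 2, fun D k κ ρ s hk hκ hρ => ⟨_, _, .assign _ _ _, ?_, rfl, ?_, ?_⟩⟩
    · simp [Expr.cost]
    · intro y hy; simp; omega
    · simp [Expr.eval, Tm.eval, hρ]
  | reg x =>
    intro _
    refine ⟨Polynomial.C 2, fun D k κ ρ s hk hκ hρ => ⟨_, _, .assign _ _ _, ?_, rfl, ?_, ?_⟩⟩
    · simp [Expr.cost]
    · intro y hy; simp; omega
    · simp [Expr.eval, Tm.eval]
  | read a i j hi hj =>
    intro hw
    simp only [Tm.wf, Bool.and_eq_true, decide_eq_true_eq] at hw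
    obtain ⟨qi, hqi⟩ := hi hw.1.2
    obtain ⟨qj, hqj⟩ := hj hw.2
    refine ⟨qi + (qj + Polynomial.C 4), fun D k κ ρ s hk hκ hρ => ?_⟩
    obtain ⟨s', s'', t, t', hE, hE', ht, ht', ha, hr, hv, hv'⟩ :=
      two D i j qi qj k κ ρ s hw.2 hk hκ hρ hqi hqj
    refine ⟨_, _, .seq hE (.seq hE' (.assign _ _ _)), ?_, ha, ?_, ?_⟩
    · simp only [Expr.cost, Polynomial.eval_add, Polynomial.eval_C]; omega
    · intro y hy; rw [Store.setReg_reg, if_neg (by omega)]; exact hr y hy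
    · simp [Expr.eval, Tm.eval, hv, hv', ha]
  | plus i j hi hj =>
    intro hw
    simp only [Tm.wf, Bool.and_eq_true] at hw
    obtain ⟨qi, hqi⟩ := hi hw.1
    obtain ⟨qj, hqj⟩ := hj hw.2
    refine ⟨qi + (qj + Polynomial.C 4), fun D k κ ρ s hk hκ hρ => ?_⟩
    obtain ⟨s', s'', t, t', hE, hE', ht, ht', ha, hr, hv, hv'⟩ :=
      two D i j qi qj k κ ρ s hw.2 hk hκ hρ hqi hqj
    refine ⟨_, _, .seq hE (.seq hE' (.assign _ _ _)), ?_, ha, ?_, ?_⟩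
    · simp only [Expr.cost, Polynomial.eval_add, Polynomial.eval_C]; omega
    · intro y hy; rw [Store.setReg_reg, if_neg (by omega)]; exact hr y hy
    · simp [Expr.eval, Tm.eval, hv, hv']
  | minus i j hi hj =>
    intro hw
    simp only [Tm.wf, Bool.and_eq_true] at hw
    obtain ⟨qi, hqi⟩ := hi hw.1
    obtain ⟨qj, hqj⟩ := hj hw.2
    refine ⟨qi + (qj + Polynomial.C 4), fun D k κ ρ s hk hκ hρ => ?_⟩
    obtain ⟨s', s'', t, t', hE, hE', ht, ht', ha, hr, hv, hv'⟩ :=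
      two D i j qi qj k κ ρ s hw.2 hk hκ hρ hqi hqj
    refine ⟨_, _, .seq hE (.seq hE' (.assign _ _ _)), ?_, ha, ?_, ?_⟩
    · simp only [Expr.cost, Polynomial.eval_add, Polynomial.eval_C]; omega
    · intro y hy; rw [Store.setReg_reg, if_neg (by omega)]; exact hr y hy
    · simp [Expr.eval, Tm.eval, hv, hv']
  | dle i j g h hi hj hg hh =>
    intro hw
    simp only [Tm.wf, Bool.and_eq_true] at hw
    obtain ⟨qi, hqi⟩ := hi hw.1.1.1
    obtain ⟨qj, hqj⟩ := hj hw.1.1.2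
    obtain ⟨qg, hqg⟩ := hg hw.1.2
    obtain ⟨qh, hqh⟩ := hh hw.2
    refine ⟨qi + (qj + (qg + (qh + Polynomial.C 7))), fun D k κ ρ s hk hκ hρ => ?_⟩
    obtain ⟨s', s'', t, t', hE, hE', ht, ht', ha, hr, hv, hv'⟩ :=
      two D i j qi qj k κ ρ s hw.1.1.2 hk hκ hρ hqi hqj
    obtain ⟨s₁, s₂, t₁, t₂, hE₁, hE₂, ht₁, ht₂, ha₂, hr₂, hv₁, hv₂⟩ :=
      two D g h qg qh (k + 2) κ ρ s'' hw.2 (by omega) (fun x => (hκ x).trans (by omega))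
        (fun x => by rw [hr _ (hκ x), hρ]) hqg hqh
    have hag := agree_of_eq hk ha hr
    have h0 : s''.reg 0 = s.reg 0 := hr 0 (lt_of_lt_of_le (by decide) hk)
    rw [h0] at ht₁ ht₂
    rw [Tm.eval_congr hag g hw.1.2] at hv₁
    rw [Tm.eval_congr hag h hw.2] at hv₂
    have e0 : s₂.reg k = i.eval D s ρ := (hr₂ k (by omega)).trans hv
    have e1 : s₂.reg (k + 1) = j.eval D s ρ := (hr₂ (k + 1) (by omega)).trans hv'
    have hrr : ∀ y < k, s₂.reg y = s.reg y := fun y hy => (hr₂ y (by omega)).trans (hr y hy)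
    by_cases hD : D (i.eval D s ρ) (j.eval D s ρ) (g.eval D s ρ) (h.eval D s ρ)
    · refine ⟨_, _, .seq hE (.seq hE' (.seq hE₁ (.seq hE₂ (.ite_true ?_ (.assign _ _ _))))),
        ?_, ha₂.trans ha, ?_, ?_⟩
      · simpa [Test.Holds, Expr.eval, e0, e1, hv₁, hv₂] using hD
      · simp only [Test.cost, Expr.cost, Polynomial.eval_add, Polynomial.eval_C]; omega
      · intro y hy; rw [Store.setReg_reg, if_neg (by omega)]; exact hrr y hy
      · simp [Expr.eval, Tm.eval, hD]
    · refine ⟨_, _, .seq hE (.seq hE' (.seq hE₁ (.seq hE₂ (.ite_false ?_ (.assign _ _ _))))),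
        ?_, ha₂.trans ha, ?_, ?_⟩
      · simpa [Test.Holds, Expr.eval, e0, e1, hv₁, hv₂] using hD
      · simp only [Test.cost, Expr.cost, Polynomial.eval_add, Polynomial.eval_C]; omega
      · intro y hy; rw [Store.setReg_reg, if_neg (by omega)]; exact hrr y hy
      · simp [Expr.eval, Tm.eval, hD]
  | cond b e f hb he hf =>
    intro hw
    simp only [Tm.wf, Bool.and_eq_true] at hw
    obtain ⟨qb, hqb⟩ := hb hw.1.1
    obtain ⟨qe, hqe⟩ := he hw.1.2
    obtain ⟨qf, hqf⟩ := hf hw.2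
    refine ⟨qb + (qe + qf + Polynomial.C 3), fun D k κ ρ s hk hκ hρ => ?_⟩
    obtain ⟨s', t, hE, ht, ha, hr, hv⟩ := hqb D k κ ρ s hk hκ hρ
    have hag := agree_of_eq hk ha hr
    have h0 : s'.reg 0 = s.reg 0 := hr 0 (lt_of_lt_of_le (by decide) hk)
    by_cases hb : b.eval D s ρ = 0
    · obtain ⟨s'', t', hE', ht', ha', hr', hv'⟩ := hqf D k κ ρ s' hk hκ
        (fun x => by rw [hr _ (hκ x), hρ])
      refine ⟨_, _, .seq hE (.ite_false ?_ hE'), ?_, ha'.trans ha,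
        fun y hy => (hr' y hy).trans (hr y hy), ?_⟩
      · simp [Test.Holds, Expr.eval, hv, hb]
      · rw [h0] at ht'
        simp only [Test.cost, Expr.cost, Polynomial.eval_add, Polynomial.eval_C]; omega
      · rw [hv', Tm.eval_congr hag f hw.2]; simp [Tm.eval, hb]
    · obtain ⟨s'', t', hE', ht', ha', hr', hv'⟩ := hqe D k κ ρ s' hk hκ
        (fun x => by rw [hr _ (hκ x), hρ])
      refine ⟨_, _, .seq hE (.ite_true ?_ hE'), ?_, ha'.trans ha,
        fun y hy => (hr' y hy).trans (hr y hy), ?_⟩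
      · simp [Test.Holds, Expr.eval, hv]; omega
      · rw [h0] at ht'
        simp only [Test.cost, Expr.cost, Polynomial.eval_add, Polynomial.eval_C]; omega
      · rw [hv', Tm.eval_congr hag e hw.1.2]; simp [Tm.eval, hb]
  | sum x e he =>
    intro hw
    simp only [Tm.wf] at hw
    obtain ⟨q, hq⟩ := he hw
    refine ⟨Polynomial.X * (q + Polynomial.C 12) + Polynomial.C 8, fun D k κ ρ s hk hκ hρ => ?_⟩
    have hk0 : 0 < k := lt_of_lt_of_le (by decide) hk
    -- Register `k` accumulates the sum, `k + 1` holds the summation variable, and the summand is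
    -- computed from `k + 2` on.
    obtain ⟨s', t, hE, ht, hJ⟩ := exec_forLoop (D := D)
      (P := .seq (e.comp (Function.update κ x (k + 1)) (k + 2))
          (.assign k (.plus (.reg k) (.reg (k + 2))))) (r := k + 1) (n := s.reg 0)
      (B := q.eval (s.reg 0) + 4)
      (fun i s' => s'.arr = s.arr ∧ (∀ y < k, s'.reg y = s.reg y) ∧
        s'.reg k = ∑ m ∈ Finset.range i, e.eval D s (Function.update ρ x m))
      (fun i s' h => h.2.1 0 hk0)
      (fun i s' v h => ⟨h.1, fun y hy => by
        rw [Store.setReg_reg, if_neg (by omega)]; exact h.2.1 y hy, by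
        rw [Store.setReg_reg, if_neg (by omega)]; exact h.2.2⟩)
      (by
        intro i s' hi hJ hri
        obtain ⟨s'', t', hE', ht', ha', hr', hv'⟩ := hq D (k + 2) (Function.update κ x (k + 1))
          (Function.update ρ x i) s' (by omega)
          (fun y => by
            by_cases h : y = x
            · subst h; simp
            · simp only [Function.update_of_ne h]; exact (hκ y).trans (by omega))
          (fun y => by
            by_cases h : y = x
            · subst h; simp [hri]
            · simp only [Function.update_of_ne h]; rw [hJ.2.1 _ (hκ y), hρ])
        rw [hJ.2.1 0 hk0] at ht'
        refine ⟨_, _, .seq hE' (.assign _ _ _), ?_, ⟨ha'.trans hJ.1, ?_, ?_⟩, ?_⟩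
        · simp only [Expr.cost]; omega
        · intro y hy
          rw [Store.setReg_reg, if_neg (by omega), hr' y (by omega), hJ.2.1 y hy]
        · rw [Store.setReg_reg, if_pos rfl, Finset.sum_range_succ]
          simp only [Expr.eval]
          rw [hr' k (by omega), hJ.2.2, hv', Tm.eval_congr (agree_of_eq hk hJ.1 hJ.2.1) e hw]
        · rw [Store.setReg_reg, if_neg (by omega), hr' _ (by omega), hri])
      (s.setReg k 0) ⟨rfl, fun y hy => by rw [Store.setReg_reg, if_neg (by omega)], by simp⟩
    refine ⟨s', _, .seq (.assign _ _ _) hE, ?_, hJ.1, hJ.2.1, hJ.2.2⟩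
    simp only [Expr.cost, Polynomial.eval_add, Polynomial.eval_mul, Polynomial.eval_X,
      Polynomial.eval_C]
    rw [show Polynomial.eval (s.reg 0) q + 12 = Polynomial.eval (s.reg 0) q + 4 + 8 from rfl]
    omega

/-- Commands of the source language: `upd a e` replaces the entries `(i, j)` of the array `a` with
`i` and `j` below the content of register `0`, simultaneously, by the values of `e`, in which the
variables `0` and `1` stand for `i` and `j`, and `iter P` repeats `P` as often as register `0`
says. -/
inductive Cmd where
  | setR (x : ℕ) (e : Tm)
  | upd (a : ℕ) (e : Tm)
  | seq (P Q : Cmd)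
  | ite (e : Tm) (P Q : Cmd)
  | iter (P : Cmd)

/-- The environment of the term of an update. -/
def env2 (n i j : ℕ) : ℕ → ℕ := fun x => if x = 0 then i else if x = 1 then j else n

/-- The effect of a command. -/
noncomputable def Cmd.eval (D : ℕ → ℕ → ℕ → ℕ → Prop) : Cmd → Store → Store
  | setR x e, s => s.setReg x (e.eval D s fun _ => s.reg 0)
  | upd a e, s =>
      { s with arr := fun b i j =>
          if b = a ∧ i < s.reg 0 ∧ j < s.reg 0 then e.eval D s (env2 (s.reg 0) i j)
          else s.arr b i j }
  | seq P Q, s => Q.eval D (P.eval D s)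
  | ite e P Q, s => if e.eval D s (fun _ => s.reg 0) ≠ 0 then P.eval D s else Q.eval D s
  | iter P, s => (P.eval D)^[s.reg 0] s

/-- A command is well-formed if its terms are and if it does not overwrite register `0`, the
reserved registers and the reserved array. -/
def Cmd.wf : Cmd → Bool
  | setR x e => decide (0 < x) && decide (x < tempReg) && e.wf
  | upd a e => decide (a ≠ tempArr) && e.wf
  | seq P Q => P.wf && Q.wf
  | ite e P Q => e.wf && P.wf && Q.wf
  | iter P => P.wf

/-- The program of a command, using only temporary registers from `k` on. -/
def Cmd.comp : Cmd → ℕ → Program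
  | setR x e, k => .seq (e.comp (fun _ => 0) k) (.assign x (.reg k))
  | upd a e, k =>
      .seq (forLoop k (forLoop (k + 1) (.seq (e.comp (env2 0 k (k + 1)) (k + 2))
          (.write tempArr (.reg k) (.reg (k + 1)) (.reg (k + 2))))))
        (forLoop k (forLoop (k + 1) (.write a (.reg k) (.reg (k + 1))
          (.read tempArr (.reg k) (.reg (k + 1))))))
  | seq P Q, k => .seq (P.comp k) (Q.comp k)
  | ite e P Q, k =>
      .seq (e.comp (fun _ => 0) k) (.ite (.le (.const 1) (.reg k)) (P.comp k) (Q.comp k))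
  | iter P, k => forLoop k (P.comp (k + 1))

theorem Cmd.eval_reg_zero (D : ℕ → ℕ → ℕ → ℕ → Prop) (P : Cmd) :
    P.wf = true → ∀ s, (P.eval D s).reg 0 = s.reg 0 := by
  induction P with
  | setR x e =>
    intro hw s
    simp only [Cmd.wf, Bool.and_eq_true, decide_eq_true_eq] at hw
    simp only [Cmd.eval, Store.setReg_reg, if_neg hw.1.1.ne]
  | upd a e => intros; rfl
  | seq P Q hP hQ =>
    intro hw s
    simp only [Cmd.wf, Bool.and_eq_true] at hw
    rw [Cmd.eval, hQ hw.2, hP hw.1]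
  | ite e P Q hP hQ =>
    intro hw s
    simp only [Cmd.wf, Bool.and_eq_true] at hw
    rw [Cmd.eval]
    split
    · exact hP hw.1.2 s
    · exact hQ hw.2 s
  | iter P hP =>
    intro hw s
    simp only [Cmd.wf] at hw
    rw [Cmd.eval]
    have : ∀ m, ((P.eval D)^[m] s).reg 0 = s.reg 0 := by
      intro m
      induction m with
      | zero => rfl
      | succ m ih => rw [Function.iterate_succ_apply', hP hw, ih]
    exact this _

/-- The body may rely on registers below `k` and on all arrays but `b` being as at the start. The
inner invariant is lexicographic: the rows before `i` and the first `m` entries of row `i` are done.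
-/
theorem exec_double_loop {D : ℕ → ℕ → ℕ → ℕ → Prop} {P : Program} {k n B : ℕ} (hk : 0 < k)
    {s₀ : Store} (hn : s₀.reg 0 = n) {b : ℕ} {f : ℕ → ℕ → ℕ}
    (hstep : ∀ i j s, i < n → j < n → (∀ y < k, s.reg y = s₀.reg y) →
      (∀ c, c ≠ b → s.arr c = s₀.arr c) → s.reg k = i → s.reg (k + 1) = j →
      ∃ s' t, Exec D P s s' t ∧ t ≤ B ∧ (∀ y < k + 2, s'.reg y = s.reg y) ∧
        s'.arr = (s.setArr b i j (f i j)).arr) :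
    ∃ s' t, Exec D (forLoop k (forLoop (k + 1) P)) s₀ s' t ∧
      t ≤ n * (n * (B + 8) + 6 + 8) + 6 ∧ (∀ y < k, s'.reg y = s₀.reg y) ∧
      ∀ c i j, s'.arr c i j = if c = b ∧ i < n ∧ j < n then f i j else s₀.arr c i j := by
  refine (exec_forLoop (D := D) (r := k) (n := n) (B := n * (B + 8) + 6)
    (fun m s => (∀ y < k, s.reg y = s₀.reg y) ∧ ∀ c i j, s.arr c i j =
      if c = b ∧ i < m ∧ j < n then f i j else s₀.arr c i j)
    (fun i s h => (h.1 0 hk).trans hn)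
    (fun i s v h => ⟨fun y hy => by
      rw [Store.setReg_reg, if_neg (by omega)]; exact h.1 y hy, h.2⟩) ?_ s₀
      ⟨fun _ _ => rfl, by simp⟩).imp fun s' ⟨t, h1, h2, h3⟩ => ⟨t, h1, h2, h3⟩
  intro i s hi hJ hri
  refine (exec_forLoop (D := D) (r := k + 1) (n := n) (B := B)
    (fun m s => (∀ y < k, s.reg y = s₀.reg y) ∧ s.reg k = i ∧ ∀ c i' j, s.arr c i' j =
      if c = b ∧ (i' < i ∧ j < n ∨ i' = i ∧ j < m) then f i' j else s₀.arr c i' j)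
    (fun i s h => (h.1 0 hk).trans hn)
    (fun i s v h => ⟨fun y hy => by
      rw [Store.setReg_reg, if_neg (by omega)]; exact h.1 y hy, by
      rw [Store.setReg_reg, if_neg (by omega)]; exact h.2.1, h.2.2⟩) ?_ s
      ⟨hJ.1, hri, by simpa using hJ.2⟩).imp fun s' ⟨t, h1, h2, h3⟩ =>
        ⟨t, h1, h2, ⟨h3.1, ?_⟩, h3.2.1⟩
  · intro j s hj hJ hrj
    obtain ⟨s', t, hE, ht, hr, ha⟩ := hstep i j s hi hj hJ.1 (fun c hc => by
      funext i' j'; rw [hJ.2.2, if_neg (fun h => hc h.1)]) hJ.2.1 hrj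
    refine ⟨s', t, hE, ht, ⟨fun y hy => (hr y (by omega)).trans (hJ.1 y hy),
      (hr k (by omega)).trans hJ.2.1, ?_⟩, (hr _ (by omega)).trans hrj⟩
    intro c i' j'
    rw [ha, Store.setArr_arr, hJ.2.2]
    by_cases h : c = b ∧ i' = i ∧ j' = j
    · obtain ⟨rfl, rfl, rfl⟩ := h
      simp
    · rw [if_neg h]
      congr 1
      apply propext
      constructor
      · rintro ⟨h1, h2⟩; exact ⟨h1, by omega⟩
      · rintro ⟨h1, h2⟩; refine ⟨h1, ?_⟩; by_contra h3; exact h ⟨h1, by omega, by omega⟩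
  · intro c i' j'
    rw [h3.2.2]
    congr 1
    apply propext
    constructor
    · rintro ⟨h1, h2⟩; exact ⟨h1, by omega⟩
    · rintro ⟨h1, h2⟩; exact ⟨h1, by omega⟩

/-- A simulation up to the reserved part of the memory. The last clause protects the counters of
enclosing loops. Polynomial bounds compose because register `0` is never written, so that every loop
runs the same number of times. -/
theorem Cmd.comp_correct (P : Cmd) :
    P.wf = true → ∃ q : Polynomial ℕ, ∀ D k s s', tempReg ≤ k → Agree s s' →
      ∃ s'' t, Exec D (P.comp k) s' s'' t ∧ t ≤ q.eval (s.reg 0) ∧ Agree (P.eval D s) s'' ∧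
        ∀ y, tempReg ≤ y → y < k → s''.reg y = s'.reg y := by
  induction P with
  | setR x e =>
    intro hw
    simp only [Cmd.wf, Bool.and_eq_true, decide_eq_true_eq] at hw
    obtain ⟨q, hq⟩ := e.comp_correct hw.2
    refine ⟨q + Polynomial.C 2, fun D k s s' hk hag => ?_⟩
    have h0 : s'.reg 0 = s.reg 0 := hag.1 0 (by decide)
    obtain ⟨s'', t, hE, ht, ha, hr, hv⟩ := hq D k (fun _ => 0) (fun _ => s.reg 0) s' hk
      (fun _ => lt_of_lt_of_le (by decide) hk) (fun _ => h0)
    rw [h0] at ht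
    refine ⟨_, _, .seq hE (.assign _ _ _), ?_, ⟨?_, ?_⟩, ?_⟩
    · simp only [Expr.cost, Polynomial.eval_add, Polynomial.eval_C]; omega
    · intro y hy
      simp only [Cmd.eval, Store.setReg_reg, Expr.eval, hv, Tm.eval_congr hag e hw.2]
      rw [hr y (by omega), hag.1 y hy]
    · intro a h
      simp only [Cmd.eval, Store.setReg_arr, ha, hag.2 a h]
    · intro y hy hy'
      rw [Store.setReg_reg, if_neg (by omega), hr y hy']
  | upd a e =>
    intro hw
    simp only [Cmd.wf, Bool.and_eq_true, decide_eq_true_eq] at hw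
    obtain ⟨q, hq⟩ := e.comp_correct hw.2
    refine ⟨(Polynomial.X * (Polynomial.X * (q + Polynomial.C 4 + Polynomial.C 8) + Polynomial.C 14)
        + Polynomial.C 6) + (Polynomial.X * (Polynomial.X * Polynomial.C 14 + Polynomial.C 14)
        + Polynomial.C 6), fun D k s s' hk hag => ?_⟩
    have hk0 : 0 < k := lt_of_lt_of_le (by decide) hk
    have h0 : s'.reg 0 = s.reg 0 := hag.1 0 (by decide)
    -- Simultaneity: the new values are collected in the reserved array and copied only afterwards,
    -- so that each of them is computed from the old contents of `a`.
    obtain ⟨s₁, t₁, hE₁, ht₁, hr₁, ha₁⟩ := exec_double_loop (D := D)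
      (P := .seq (e.comp (env2 0 k (k + 1)) (k + 2))
          (.write tempArr (.reg k) (.reg (k + 1)) (.reg (k + 2)))) (k := k) (n := s.reg 0)
      (B := q.eval (s.reg 0) + 4) hk0 h0 (b := tempArr)
      (f := fun i j => e.eval D s (env2 (s.reg 0) i j)) (by
        intro i j s₂ hi hj hr ha hri hrj
        -- `env2` plays two roles: with `0`, `k`, `k + 1` it tells in which registers the variables
        -- are, with `s.reg 0`, `i`, `j` what they are.
        obtain ⟨s₃, t, hE, ht, ha', hr', hv⟩ := hq D (k + 2) (env2 0 k (k + 1)) (env2 (s.reg 0) i j)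
          s₂ (by omega) (fun x => by unfold env2; split_ifs <;> omega)
          (fun x => by
            unfold env2
            split_ifs
            · exact hri
            · exact hrj
            · exact (hr 0 hk0).trans h0)
        have hag' : Agree s s₂ := ⟨fun x hx => (hr x (by omega)).trans (hag.1 x hx),
          fun a h => (ha a h).trans (hag.2 a h)⟩
        rw [Tm.eval_congr hag' e hw.2] at hv
        rw [hag'.1 0 (by decide)] at ht
        refine ⟨_, _, .seq hE (.write _ _ _ _ _), ?_, ?_, ?_⟩
        · simp only [Expr.cost]; omega
        · intro y hy; exact hr' y hy
        · funext c i' j'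
          simp only [Store.setArr_arr, Expr.eval, hv, hr' k (by omega), hr' (k + 1) (by omega),
            hri, hrj, ha'])
    obtain ⟨s₂, t₂, hE₂, ht₂, hr₂, ha₂⟩ := exec_double_loop (D := D)
      (P := .write a (.reg k) (.reg (k + 1)) (.read tempArr (.reg k) (.reg (k + 1))))
      (k := k) (n := s.reg 0) (B := 6) hk0 (s₀ := s₁) ((hr₁ 0 hk0).trans h0) (b := a)
      (f := fun i j => e.eval D s (env2 (s.reg 0) i j)) (by
        intro i j s₃ hi hj hr ha hri hrj
        refine ⟨_, _, .write _ _ _ _ _, by simp [Expr.cost], fun _ _ => rfl, ?_⟩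
        funext c i' j'
        simp only [Store.setArr_arr, Expr.eval, hri, hrj, ha _ (Ne.symm hw.1), ha₁, hi, hj,
          and_self, if_true])
    refine ⟨s₂, _, .seq hE₁ hE₂, ?_, ⟨?_, ?_⟩, ?_⟩
    · simp only [Polynomial.eval_add, Polynomial.eval_mul, Polynomial.eval_X, Polynomial.eval_C]
      have e1 : s.reg 0 * (s.reg 0 * (6 + 8) + 6 + 8) + 6 =
        s.reg 0 * (s.reg 0 * 14 + 14) + 6 := rfl
      have e2 : s.reg 0 * (s.reg 0 * (Polynomial.eval (s.reg 0) q + 4 + 8) + 6 + 8) + 6 =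
        s.reg 0 * (s.reg 0 * (Polynomial.eval (s.reg 0) q + 4 + 8) + 14) + 6 := rfl
      omega
    · intro x hx
      rw [hr₂ x (by omega), hr₁ x (by omega), hag.1 x hx]; rfl
    · intro c hc
      funext i j
      rw [ha₂, ha₁]
      simp only [Cmd.eval, hc, false_and, if_false, hag.2 c hc]
    · intro y _ hy
      rw [hr₂ y hy, hr₁ y hy]
  | seq P Q hP hQ =>
    intro hw
    simp only [Cmd.wf, Bool.and_eq_true] at hw
    obtain ⟨qP, hqP⟩ := hP hw.1
    obtain ⟨qQ, hqQ⟩ := hQ hw.2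
    refine ⟨qP + qQ, fun D k s s' hk hag => ?_⟩
    obtain ⟨s₁, t₁, hE₁, ht₁, hag₁, hr₁⟩ := hqP D k s s' hk hag
    obtain ⟨s₂, t₂, hE₂, ht₂, hag₂, hr₂⟩ := hqQ D k _ s₁ hk hag₁
    rw [Cmd.eval_reg_zero D P hw.1] at ht₂
    refine ⟨s₂, _, .seq hE₁ hE₂, ?_, hag₂, fun y h h' => (hr₂ y h h').trans (hr₁ y h h')⟩
    simp only [Polynomial.eval_add]; omega
  | ite e P Q hP hQ =>
    intro hw
    simp only [Cmd.wf, Bool.and_eq_true] at hw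
    obtain ⟨q, hq⟩ := e.comp_correct hw.1.1
    obtain ⟨qP, hqP⟩ := hP hw.1.2
    obtain ⟨qQ, hqQ⟩ := hQ hw.2
    refine ⟨q + (qP + qQ + Polynomial.C 3), fun D k s s' hk hag => ?_⟩
    have h0 : s'.reg 0 = s.reg 0 := hag.1 0 (by decide)
    obtain ⟨s₁, t, hE, ht, ha, hr, hv⟩ := hq D k (fun _ => 0) (fun _ => s.reg 0) s' hk
      (fun _ => lt_of_lt_of_le (by decide) hk) (fun _ => h0)
    rw [h0] at ht
    rw [Tm.eval_congr hag e hw.1.1] at hv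
    have hag' : Agree s s₁ := ⟨fun x hx => (hr x (by omega)).trans (hag.1 x hx),
      fun a h => by rw [ha]; exact hag.2 a h⟩
    by_cases hb : e.eval D s (fun _ => s.reg 0) = 0
    · obtain ⟨s₂, t₂, hE₂, ht₂, hag₂, hr₂⟩ := hqQ D k s s₁ hk hag'
      refine ⟨s₂, _, .seq hE (.ite_false ?_ hE₂), ?_, ?_,
        fun y h h' => (hr₂ y h h').trans (hr y h')⟩
      · simp [Test.Holds, Expr.eval, hv, hb]
      · simp only [Test.cost, Expr.cost, Polynomial.eval_add, Polynomial.eval_C]; omega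
      · simpa only [Cmd.eval, hb, ne_eq, not_true_eq_false, if_false] using hag₂
    · obtain ⟨s₂, t₂, hE₂, ht₂, hag₂, hr₂⟩ := hqP D k s s₁ hk hag'
      refine ⟨s₂, _, .seq hE (.ite_true ?_ hE₂), ?_, ?_,
        fun y h h' => (hr₂ y h h').trans (hr y h')⟩
      · simp [Test.Holds, Expr.eval, hv]; omega
      · simp only [Test.cost, Expr.cost, Polynomial.eval_add, Polynomial.eval_C]; omega
      · simpa only [Cmd.eval, hb, ne_eq, not_false_eq_true, if_true] using hag₂
  | iter P hP =>
    intro hw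
    simp only [Cmd.wf] at hw
    obtain ⟨q, hq⟩ := hP hw
    refine ⟨Polynomial.X * (q + Polynomial.C 8) + Polynomial.C 6, fun D k s s' hk hag => ?_⟩
    have h0 : ∀ m, ((P.eval D)^[m] s).reg 0 = s.reg 0 := by
      intro m
      induction m with
      | zero => rfl
      | succ m ih => rw [Function.iterate_succ_apply', Cmd.eval_reg_zero D P hw, ih]
    obtain ⟨s₁, t, hE, ht, hJ⟩ := exec_forLoop (D := D) (P := P.comp (k + 1)) (r := k)
      (n := s.reg 0) (B := q.eval (s.reg 0))
      (fun i s₁ => Agree ((P.eval D)^[i] s) s₁ ∧ ∀ y, tempReg ≤ y → y < k → s₁.reg y = s'.reg y)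
      (fun i s₁ h => (h.1.1 0 (by decide)).trans (h0 i))
      (fun i s₁ v h => ⟨⟨fun x hx => by
        rw [Store.setReg_reg, if_neg (by omega)]; exact h.1.1 x hx, h.1.2⟩,
        fun y hy hy' => by rw [Store.setReg_reg, if_neg (by omega)]; exact h.2 y hy hy'⟩)
      (by
        intro i s₁ hi hJ hri
        obtain ⟨s₂, t₂, hE₂, ht₂, hag₂, hr₂⟩ := hq D (k + 1) _ s₁ (by omega) hJ.1
        rw [h0] at ht₂
        refine ⟨s₂, t₂, hE₂, ht₂, ⟨?_, fun y hy hy' => ?_⟩, (hr₂ k hk (by omega)).trans hri⟩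
        · rw [Function.iterate_succ_apply']; exact hag₂
        · rw [hr₂ y hy (by omega), hJ.2 y hy hy'])
      s' ⟨hag, fun _ _ _ => rfl⟩
    refine ⟨s₁, t, hE, ?_, hJ.1, hJ.2⟩
    simpa only [Polynomial.eval_add, Polynomial.eval_mul, Polynomial.eval_X,
      Polynomial.eval_C] using ht

end CapCenter

namespace CapCenter

/-! ### Capacitated bipartite assignments, tight sets and cuts. -/

section Matching

open scoped Classical

/-- The number of vertices `i < n` that `M` assigns to `j`; the assignment to `j` is encoded by
`M i = j + 1`, and `M i = 0` says that `i` is unassigned. -/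
noncomputable def load (n : ℕ) (M : ℕ → ℕ) (j : ℕ) : ℕ :=
  ((Finset.range n).filter fun i => M i = j + 1).card

/-- `M` assigns vertices along the edges of the bipartite graph `G`. -/
def IsAssignment (n : ℕ) (G : ℕ → ℕ → Prop) (M : ℕ → ℕ) : Prop :=
  ∀ i < n, ∀ j, M i = j + 1 → G i j

/-- The right vertices in `T` are saturated, and the vertices assigned to them have all their
neighbours in `T`. -/
def IsTight (n : ℕ) (G : ℕ → ℕ → Prop) (cap M : ℕ → ℕ) (T : Finset ℕ) : Prop :=
  (∀ j ∈ T, load n M j = cap j) ∧ ∀ i < n, ∀ j ∈ T, M i = j + 1 → ∀ j', G i j' → j' ∈ T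

theorem sum_load (n : ℕ) (M : ℕ → ℕ) (T : Finset ℕ) :
    ∑ j ∈ T, load n M j = ((Finset.range n).filter fun i => ∃ j ∈ T, M i = j + 1).card := by
  unfold load
  rw [← Finset.card_biUnion]
  · congr 1
    ext i
    simp only [Finset.mem_biUnion, Finset.mem_filter]
    tauto
  · intro j _ j' _ h
    simp only [Finset.disjoint_left, Finset.mem_filter]
    rintro i ⟨_, h1⟩ ⟨_, h2⟩
    omega

/-- The vertices assigned into `T` have no neighbours outside `T`, so while they stay assigned they
stay assigned into `T`. As they already saturate `T`, nobody else can enter: the set of occupants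
never changes. -/
theorem IsTight.mono {n : ℕ} {G : ℕ → ℕ → Prop} {cap M M' : ℕ → ℕ} {T : Finset ℕ}
    (hT : IsTight n G cap M T) (hM' : IsAssignment n G M') (hcap : ∀ j, load n M' j ≤ cap j)
    (h : ∀ i < n, M i ≠ 0 → M' i ≠ 0) :
    IsTight n G cap M' T ∧
      ∀ i < n, ∀ j ∈ T, M' i = j + 1 → ∃ j' ∈ T, M i = j' + 1 := by
  have hsub : ((Finset.range n).filter fun i => ∃ j ∈ T, M i = j + 1) ⊆
      (Finset.range n).filter fun i => ∃ j ∈ T, M' i = j + 1 := by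
    intro i hi
    simp only [Finset.mem_filter, Finset.mem_range] at hi ⊢
    obtain ⟨hi, j, hj, hij⟩ := hi
    obtain ⟨j', hj'⟩ := Nat.exists_eq_succ_of_ne_zero (h i hi (by omega))
    exact ⟨hi, j', hT.2 i hi j hj hij j' (hM' i hi j' hj'), hj'⟩
  have hle : ∑ j ∈ T, load n M' j ≤ ∑ j ∈ T, load n M j :=
    Finset.sum_le_sum fun j hj => (hT.1 j hj).symm ▸ hcap j
  have heq := Finset.eq_of_subset_of_card_le hsub (by rw [← sum_load, ← sum_load]; exact hle)
  have hback : ∀ i < n, ∀ j ∈ T, M' i = j + 1 → ∃ j' ∈ T, M i = j' + 1 := by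
    intro i hi j hj hij
    have : i ∈ (Finset.range n).filter fun i => ∃ j ∈ T, M' i = j + 1 := by
      simp only [Finset.mem_filter, Finset.mem_range]
      exact ⟨hi, j, hj, hij⟩
    rw [← heq] at this
    simpa only [Finset.mem_filter, Finset.mem_range, hi, true_and] using this
  refine ⟨⟨?_, ?_⟩, hback⟩
  · have hs : ∑ j ∈ T, load n M' j = ∑ j ∈ T, cap j := by
      rw [sum_load, ← heq, ← sum_load]
      exact Finset.sum_congr rfl hT.1
    exact (Finset.sum_eq_sum_iff_of_le fun j _ => hcap j).1 hs
  · intro i hi j hj hij j' hG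
    obtain ⟨j₀, hj₀, hij₀⟩ := hback i hi j hj hij
    exact hT.2 i hi j₀ hj₀ hij₀ j' hG

/-- The cut of a maximum assignment: `Z` contains all unassigned vertices and, with a vertex, all
vertices assigned to its neighbours, which are saturated. -/
theorem exists_cut {n : ℕ} {G : ℕ → ℕ → Prop} {cap M : ℕ → ℕ} (hM : IsAssignment n G M)
    (hG : ∀ i j, G i j → j < n)
    (hmax : ∀ i < n, M i = 0 → ∃ T, IsTight n G cap M T ∧ ∀ j, G i j → j ∈ T) :
    ∃ Z ⊆ Finset.range n, ((Finset.range n).filter fun i => M i ≠ 0).card =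
      (Finset.range n \ Z).card +
        ∑ j ∈ (Finset.range n).filter fun j => ∃ z ∈ Z, G z j, cap j := by
  choose! T hT hGT using hmax
  -- König's argument: `TT` contains all neighbours of `Z`, so these are saturated. An assigned
  -- vertex lies either outside `Z` or is assigned to a neighbour of `Z`, and the two cases exclude
  -- each other.
  let TT : Finset ℕ := ((Finset.range n).filter fun i => M i = 0).biUnion T
  have hTT : ∀ j, j ∈ TT ↔ ∃ i < n, M i = 0 ∧ j ∈ T i := by
    intro j
    simp only [TT, Finset.mem_biUnion, Finset.mem_filter, Finset.mem_range]
    constructor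
    · rintro ⟨i, ⟨h1, h2⟩, h3⟩; exact ⟨i, h1, h2, h3⟩
    · rintro ⟨i, h1, h2, h3⟩; exact ⟨i, ⟨h1, h2⟩, h3⟩
  let Z : Finset ℕ := (Finset.range n).filter fun i => M i = 0 ∨ ∃ j ∈ TT, M i = j + 1
  have hZ : ∀ i, i ∈ Z ↔ i < n ∧ (M i = 0 ∨ ∃ j ∈ TT, M i = j + 1) := by
    intro i; simp only [Z, Finset.mem_filter, Finset.mem_range]
  have hZT : ∀ z ∈ Z, ∀ j, G z j → j ∈ TT := by
    intro z hz j hj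
    rw [hZ] at hz
    obtain ⟨hzn, h | ⟨j', hj', h⟩⟩ := hz
    · exact (hTT j).2 ⟨z, hzn, h, hGT z hzn h j hj⟩
    · obtain ⟨i, hi, hi0, hji⟩ := (hTT j').1 hj'
      exact (hTT j).2 ⟨i, hi, hi0, (hT i hi hi0).2 z hzn j' hji h j hj⟩
  refine ⟨Z, Finset.filter_subset _ _, ?_⟩
  have h1 : (Finset.range n).filter (fun i => M i ≠ 0) = (Finset.range n \ Z) ∪
      (Finset.range n).filter fun i => ∃ j ∈ (Finset.range n).filter fun j => ∃ z ∈ Z, G z j,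
        M i = j + 1 := by
    ext i
    simp only [Finset.mem_filter, Finset.mem_union, Finset.mem_sdiff, Finset.mem_range]
    constructor
    · rintro ⟨hi, h0⟩
      by_cases hz : i ∈ Z
      · right
        obtain ⟨j, hj⟩ := Nat.exists_eq_succ_of_ne_zero h0
        exact ⟨hi, j, ⟨hG i j (hM i hi j hj), i, hz, hM i hi j hj⟩, hj⟩
      · exact Or.inl ⟨hi, hz⟩
    · rintro (⟨hi, hz⟩ | ⟨hi, j, -, hj⟩)
      · exact ⟨hi, fun h => hz ((hZ i).2 ⟨hi, Or.inl h⟩)⟩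
      · exact ⟨hi, by omega⟩
  rw [h1, Finset.card_union_of_disjoint, ← sum_load]
  · congr 1
    refine Finset.sum_congr rfl fun j hj => ?_
    simp only [Finset.mem_filter] at hj
    obtain ⟨_, z, hz, hzj⟩ := hj
    obtain ⟨i, hi, hi0, hji⟩ := (hTT j).1 (hZT z hz j hzj)
    exact (hT i hi hi0).1 j hji
  · rw [Finset.disjoint_left]
    intro i hi
    simp only [Finset.mem_filter, Finset.mem_sdiff, Finset.mem_range] at hi ⊢
    rintro ⟨_, j, ⟨_, z, hz, hzj⟩, hij⟩
    exact hi.2 ((hZ i).2 ⟨hi.1, Or.inr ⟨j, hZT z hz j hzj, hij⟩⟩)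

end Matching

/-! ### Core centers, their components, and the distribution of clients among them. -/

section Graph

open scoped Classical

/-- `Hops adj k i j` says that there is a walk with `k` edges from `i` to `j`. -/
def Hops (adj : ℕ → ℕ → Prop) : ℕ → ℕ → ℕ → Prop
  | 0, i, j => i = j
  | k + 1, i, j => ∃ w, adj i w ∧ Hops adj k w j

/-- `adj` is a graph on the vertices below `n` with a loop at every vertex. -/
structure IsReflGraph (n : ℕ) (adj : ℕ → ℕ → Prop) : Prop where
  lt : ∀ i j, adj i j → i < n
  refl : ∀ i < n, adj i i
  symm : ∀ i j, adj i j → adj j i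

theorem hops_one {adj : ℕ → ℕ → Prop} {i j : ℕ} : Hops adj 1 i j ↔ adj i j := by
  simp [Hops]

theorem hops_add {adj : ℕ → ℕ → Prop} (a b : ℕ) :
    ∀ i j, Hops adj (a + b) i j ↔ ∃ w, Hops adj a i w ∧ Hops adj b w j := by
  induction a with
  | zero => intro i j; simp [Hops]
  | succ a ih =>
    intro i j
    rw [show a + 1 + b = (a + b) + 1 by omega]
    simp only [Hops, ih]
    constructor
    · rintro ⟨w, h1, x, h2, h3⟩; exact ⟨x, ⟨w, h1, h2⟩, h3⟩
    · rintro ⟨x, ⟨w, h1, h2⟩, h3⟩; exact ⟨w, h1, x, h2, h3⟩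

theorem Hops.trans {adj : ℕ → ℕ → Prop} {a b i w j : ℕ} (h : Hops adj a i w)
    (h' : Hops adj b w j) : Hops adj (a + b) i j := (hops_add a b i j).2 ⟨w, h, h'⟩

theorem Hops.symm {n : ℕ} {adj : ℕ → ℕ → Prop} (hadj : IsReflGraph n adj) {a i j : ℕ} :
    Hops adj a i j → Hops adj a j i := by
  induction a generalizing i j with
  | zero => exact Eq.symm
  | succ a ih =>
    rintro ⟨w, h1, h2⟩
    exact (ih h2).trans (hops_one.2 (hadj.symm _ _ h1))

/-- A walk is prolonged by waiting at its first vertex, which carries a loop. -/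
theorem Hops.mono {n : ℕ} {adj : ℕ → ℕ → Prop} (hadj : IsReflGraph n adj) {a b i j : ℕ}
    (h : Hops adj a i j) (hi : i < n) (hab : a ≤ b) : Hops adj b i j := by
  induction hab with
  | refl => exact h
  | step _ ih => exact ⟨i, hadj.refl i hi, ih⟩

/-- A vertex that has enough neighbours and enough capacity to be opened. -/
def Allowed (n L : ℕ) (adj : ℕ → ℕ → Prop) (U : ℕ → ℕ) (u : ℕ) : Prop :=
  u < n ∧ L ≤ ((Finset.range n).filter fun w => adj u w).card ∧ L ≤ U u

/-- Core centers: `core c` is the position of the core center `c` (zero if `c` is no core center)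
and `par c` encodes its parent, `own v` encodes the core center to which the client `v` is
attached, and of the clients available at `c`, which are those attached to `c` and those handed
over by its children, `L * cap c` stay at `c` and `rem c` are handed over to its parent. -/
structure CoreSystem (n L : ℕ) (adj : ℕ → ℕ → Prop) (A : ℕ → Prop)
    (core par own rem cap : ℕ → ℕ) : Prop where
  allowed : ∀ c, core c ≠ 0 → A c
  inj : ∀ c c', core c ≠ 0 → core c = core c' → c = c'
  sep : ∀ c c' v, core c ≠ 0 → core c' ≠ 0 → adj c v → adj c' v → c = c'
  cover : ∀ u, A u → ∃ c, core c ≠ 0 ∧ Hops adj 2 u c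
  par_spec : ∀ c q, core c ≠ 0 → par c = q + 1 → core q ≠ 0 ∧ core q < core c ∧ Hops adj 4 c q
  root_sep : ∀ c x, core c ≠ 0 → par c = 0 → A x →
    (∀ c', core c' ≠ 0 → core c' < core c → ¬ Hops adj 2 x c') →
    ∀ c', core c' ≠ 0 → core c' < core c → ¬ Hops adj 4 x c'
  own_spec : ∀ v c, own v = c + 1 → core c ≠ 0 ∧ ∃ u, A u ∧ adj v u ∧ Hops adj 2 u c
  own_adj : ∀ v c, core c ≠ 0 → adj v c → own v = c + 1
  own_ne : ∀ v u, A u → adj v u → own v ≠ 0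
  rem_lt : ∀ c, core c ≠ 0 → rem c < L
  flow : ∀ c, core c ≠ 0 → load n own c +
    ∑ c' ∈ (Finset.range n).filter (fun c' => core c' ≠ 0 ∧ par c' = c + 1), rem c' =
      L * cap c + rem c

/-- The vertex `u` may use the clients at the core center `c`. -/
def Reach (adj : ℕ → ℕ → Prop) (A : ℕ → Prop) (core par own : ℕ → ℕ) (u c : ℕ) : Prop :=
  A u ∧ core c ≠ 0 ∧ ∃ v, adj u v ∧
    (own v = c + 1 ∨ ∃ c', core c' ≠ 0 ∧ adj v c' ∧ par c' = c + 1)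

/-- The position of the last root that is not later than the core center `c`; it identifies the
component of `c`. -/
noncomputable def era (n : ℕ) (core par : ℕ → ℕ) (c : ℕ) : ℕ :=
  ((Finset.range n).filter fun q => core q ≠ 0 ∧ par q = 0 ∧ core q ≤ core c).sup core

theorem le_era_iff {n : ℕ} {core par : ℕ → ℕ} {c m : ℕ} (hm : 0 < m) :
    m ≤ era n core par c ↔
      ∃ q < n, core q ≠ 0 ∧ par q = 0 ∧ core q ≤ core c ∧ m ≤ core q := by
  unfold era
  rw [Finset.le_sup_iff hm]
  simp only [Finset.mem_filter, Finset.mem_range]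
  constructor
  · rintro ⟨q, ⟨h1, h2, h3, h4⟩, h5⟩; exact ⟨q, h1, h2, h3, h4, h5⟩
  · rintro ⟨q, h1, h2, h3, h4, h5⟩; exact ⟨q, ⟨h1, h2, h3, h4⟩, h5⟩

variable {n L : ℕ} {adj : ℕ → ℕ → Prop} {U core par own rem cap : ℕ → ℕ}

namespace CoreSystem

theorem lt (H : CoreSystem n L adj (Allowed n L adj U) core par own rem cap) {c : ℕ}
    (hc : core c ≠ 0) : c < n := (H.allowed c hc).1

theorem eq_of_hops (H : CoreSystem n L adj (Allowed n L adj U) core par own rem cap)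
    (hadj : IsReflGraph n adj) {c c' : ℕ} (hc : core c ≠ 0) (hc' : core c' ≠ 0)
    (h : Hops adj 2 c c') : c = c' := by
  obtain ⟨w, h1, h2⟩ := h
  exact H.sep c c' w hc hc' h1 (hadj.symm _ _ (hops_one.1 h2))

theorem era_root (H : CoreSystem n L adj (Allowed n L adj U) core par own rem cap) {c : ℕ}
    (hc : core c ≠ 0) (h0 : par c = 0) : era n core par c = core c := by
  apply le_antisymm
  · exact Finset.sup_le fun q hq => (Finset.mem_filter.1 hq).2.2.2
  · exact (le_era_iff (Nat.pos_of_ne_zero hc)).2 ⟨c, H.lt hc, hc, h0, le_rfl, le_rfl⟩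

/-- Two core centers lie in the same component if every root precedes both or neither. -/
theorem era_eq {c c' : ℕ} (h : ∀ q, core q ≠ 0 → par q = 0 → (core q ≤ core c ↔ core q ≤ core c')) :
    era n core par c = era n core par c' := by
  unfold era
  congr 1
  ext q
  simp only [Finset.mem_filter]
  constructor
  · rintro ⟨h1, h2, h3, h4⟩; exact ⟨h1, h2, h3, (h q h2 h3).1 h4⟩
  · rintro ⟨h1, h2, h3, h4⟩; exact ⟨h1, h2, h3, (h q h2 h3).2 h4⟩

/-- Suppose a root was chosen after the parent `q` and not after `c`. At that time `c` was
uncovered, because core centers are never within two hops of each other, and it was four hops from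
`q`; so `root_sep` forbids a new root. -/
theorem era_par (H : CoreSystem n L adj (Allowed n L adj U) core par own rem cap)
    (hadj : IsReflGraph n adj) {c q : ℕ} (hc : core c ≠ 0) (hq : par c = q + 1) :
    era n core par c = era n core par q := by
  obtain ⟨hq0, hlt, h4⟩ := H.par_spec c q hc hq
  refine era_eq fun r hr hr0 => ⟨fun h => ?_, fun h => by omega⟩
  by_contra hcon
  have hne : core r ≠ core c := by
    intro h'
    have := H.inj r c hr h'
    subst this; omega
  refine H.root_sep r c hr hr0 (H.allowed c hc) (fun c' hc' hlt' h2 => ?_) q hq0 (by omega) h4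
  have := H.eq_of_hops hadj hc hc' h2
  subst this; omega

/-- Suppose a root `r` separates `c` from the later `c'`. The vertex `u'` is four hops from `c`. If
`u'` was uncovered when `r` was chosen, it contradicts the choice of a root. If it was covered by
`c''`, then `c'`, uncovered at that time, is four hops from `c''`, which is the same contradiction.
-/
theorem era_link (H : CoreSystem n L adj (Allowed n L adj U) core par own rem cap)
    (hadj : IsReflGraph n adj) {u u' v c c' : ℕ} (hu : Allowed n L adj U u)
    (hu' : Allowed n L adj U u') (huv : adj u v) (huv' : adj u' v) (hc : core c ≠ 0)
    (hc' : core c' ≠ 0) (h : Hops adj 2 u c) (h' : Hops adj 2 u' c') :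
    era n core par c = era n core par c' := by
  have main : ∀ u u' c c', Allowed n L adj U u' → adj u v → adj u' v →
      core c ≠ 0 → core c' ≠ 0 → Hops adj 2 u c → Hops adj 2 u' c' →
      ∀ r, core r ≠ 0 → par r = 0 → core r ≤ core c' → core r ≤ core c := by
    intro u u' c c' hu' huv huv' hc hc' h h' r hr hr0 hle
    by_contra hcon
    have hu'u : Hops adj 2 u' u := ⟨v, huv', hops_one.2 (hadj.symm _ _ huv)⟩
    by_cases hcov : ∃ c'', core c'' ≠ 0 ∧ core c'' < core r ∧ Hops adj 2 u' c''
    · obtain ⟨c'', hc'', hlt, h''⟩ := hcov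
      refine H.root_sep r c' hr hr0 (H.allowed c' hc') (fun d hd hlt' h2 => ?_) c'' hc'' hlt
        ((h'.symm hadj).trans h'')
      have := H.eq_of_hops hadj hc' hd h2
      subst this; omega
    · push Not at hcov
      exact H.root_sep r u' hr hr0 hu' (fun d hd hlt' => hcov d hd hlt') c hc (by omega)
        (hu'u.trans h)
  exact era_eq fun r hr hr0 => ⟨main u' u c' c hu huv' huv hc' hc h' h r hr hr0,
    main u u' c c' hu' huv huv' hc hc' h h' r hr hr0⟩

/-- Components do not interact. By `era_link` at the shared neighbour `v`, the core center of `v` is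
in the component of any core center covering `u`; by `era_link` at `u` itself, so is the core center
of `u`. -/
theorem era_own (H : CoreSystem n L adj (Allowed n L adj U) core par own rem cap)
    (hadj : IsReflGraph n adj) {u v : ℕ} (hu : Allowed n L adj U u) (huv : adj u v) :
    era n core par (own v - 1) = era n core par (own u - 1) := by
  obtain ⟨c, hc⟩ := Nat.exists_eq_succ_of_ne_zero (H.own_ne v u hu (hadj.symm _ _ huv))
  obtain ⟨c', hc'⟩ := Nat.exists_eq_succ_of_ne_zero (H.own_ne u u hu (hadj.refl u hu.1))
  obtain ⟨hcc, a, ha, hva, hac⟩ := H.own_spec v c hc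
  obtain ⟨hcc', a', ha', hua', hac'⟩ := H.own_spec u c' hc'
  obtain ⟨d, hd, hud⟩ := H.cover u hu
  rw [hc, hc']
  simp only [Nat.succ_eq_add_one, Nat.add_sub_cancel]
  exact (H.era_link hadj ha hu (hadj.symm _ _ hva) huv hcc hd hac hud).trans
    (H.era_link hadj hu ha' (hadj.refl u hu.1) (hadj.symm _ _ hua') hd hcc' hud hac')

theorem own_hops (H : CoreSystem n L adj (Allowed n L adj U) core par own rem cap) {v c : ℕ}
    (h : own v = c + 1) : Hops adj 3 v c := by
  obtain ⟨_, u, _, hvu, huc⟩ := H.own_spec v c h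
  exact (hops_one.2 hvu).trans huc

/-- A client attached to `c` costs one hop and three more; one next to a child `c'` costs one hop to
the client, one to `c'` and four to the parent `c`. -/
theorem reach_hops (H : CoreSystem n L adj (Allowed n L adj U) core par own rem cap)
    (hadj : IsReflGraph n adj) {u c : ℕ}
    (h : Reach adj (Allowed n L adj U) core par own u c) : Hops adj 6 u c := by
  obtain ⟨hu, hc, v, huv, h | ⟨c', hc', hvc', hp⟩⟩ := h
  · exact ((hops_one.2 huv).trans (H.own_hops h)).mono hadj hu.1 (by norm_num)
  · exact ((hops_one.2 huv).trans (hops_one.2 hvc')).trans (H.par_spec c' c hc' hp).2.2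

theorem reach_era (H : CoreSystem n L adj (Allowed n L adj U) core par own rem cap)
    (hadj : IsReflGraph n adj) {u c : ℕ}
    (h : Reach adj (Allowed n L adj U) core par own u c) :
    era n core par c = era n core par (own u - 1) := by
  obtain ⟨hu, hc, v, huv, h | ⟨c', hc', hvc', hp⟩⟩ := h
  · rw [← H.era_own hadj hu huv, h]; rfl
  · rw [← H.era_own hadj hu huv, H.own_adj v c' hc' hvc', ← H.era_par hadj hc' hp]; rfl

end CoreSystem

/-- The distribution of the clients: `blk v` encodes the core center at which `v` stays. -/
structure IsBlocks (n L : ℕ) (adj : ℕ → ℕ → Prop) (core par own rem cap blk : ℕ → ℕ) : Prop where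
  spec : ∀ v c, own v = c + 1 → blk v = c + 1 ∨ (adj c v ∧ blk v = par c)
  none : ∀ v, own v = 0 → blk v = 0
  load : ∀ c, core c ≠ 0 → load n blk c = L * cap c
  left : ∀ c, core c ≠ 0 →
    ((Finset.range n).filter fun v => own v = c + 1 ∧ blk v = 0).card ≤ rem c

/-- The flow is realised by actual clients: `c` hands over `rem c` of its own neighbours. There are
enough of them since `rem c < L`, and all are attached to `c`. Hence no client moves more than once,
and only from a core center adjacent to it to the parent of that center. -/
theorem CoreSystem.exists_blocks
    (H : CoreSystem n L adj (Allowed n L adj U) core par own rem cap)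
    (hadj : IsReflGraph n adj) : ∃ blk, IsBlocks n L adj core par own rem cap blk := by
  have hex : ∀ c, ∃ R ⊆ (Finset.range n).filter fun v => adj c v,
      R.card = if core c ≠ 0 then rem c else 0 := by
    intro c
    split_ifs with hc
    · exact Finset.exists_subset_card_eq ((H.rem_lt c hc).le.trans (H.allowed c hc).2.1)
    · exact ⟨∅, Finset.empty_subset _, rfl⟩
  choose R hR hRc using hex
  have hRadj : ∀ c v, v ∈ R c → v < n ∧ adj c v := by
    intro c v hv
    simpa only [Finset.mem_filter, Finset.mem_range] using hR c hv
  have hRcore : ∀ c v, v ∈ R c → core c ≠ 0 := by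
    intro c v hv hc
    have := hRc c
    rw [if_neg (not_not.2 hc), Finset.card_eq_zero] at this
    rw [this] at hv
    exact absurd hv (Finset.notMem_empty v)
  have hRown : ∀ c v, v ∈ R c → own v = c + 1 := fun c v hv =>
    H.own_adj v c (hRcore c v hv) (hadj.symm _ _ (hRadj c v hv).2)
  let blk : ℕ → ℕ := fun v =>
    if own v = 0 then 0 else if v ∈ R (own v - 1) then par (own v - 1) else own v
  have hblk : ∀ v c, own v = c + 1 → blk v = if v ∈ R c then par c else c + 1 := by
    intro v c h
    simp only [blk, h, Nat.add_sub_cancel, Nat.succ_ne_zero, if_false]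
  have hblk0 : ∀ v, own v = 0 → blk v = 0 := fun v h => by simp only [blk, h, if_true]
  have hparlt : ∀ c c', core c ≠ 0 → par c = c' + 1 → c ≠ c' := by
    rintro c c' hc hp rfl
    exact absurd (H.par_spec c c hc hp).2.1 (lt_irrefl _)
  refine ⟨blk, ⟨?_, hblk0, ?_, ?_⟩⟩
  · intro v c h
    rw [hblk v c h]
    split_ifs with hv
    · exact Or.inr ⟨(hRadj c v hv).2, rfl⟩
    · exact Or.inl rfl
  · intro c hc
    -- The clients available at `c`, on the left by where they come from, on the right by where they
    -- go; both unions are disjoint.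
    have hset : ((Finset.range n).filter fun v => own v = c + 1) ∪
        ((Finset.range n).filter fun c' => core c' ≠ 0 ∧ par c' = c + 1).biUnion R =
        ((Finset.range n).filter fun v => blk v = c + 1) ∪ R c := by
      ext v
      simp only [Finset.mem_union, Finset.mem_filter, Finset.mem_range, Finset.mem_biUnion]
      constructor
      · rintro (⟨hv, ho⟩ | ⟨c', ⟨_, _, hp⟩, hv⟩)
        · by_cases h : v ∈ R c
          · exact Or.inr h
          · left; exact ⟨hv, by rw [hblk v c ho, if_neg h]⟩
        · left; exact ⟨(hRadj c' v hv).1, by rw [hblk v c' (hRown c' v hv), if_pos hv, hp]⟩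
      · rintro (⟨hv, hb⟩ | hv)
        · rcases hov : own v with _ | d
          · rw [hblk0 v hov] at hb; omega
          · rw [hblk v d hov] at hb
            split_ifs at hb with h
            · right; exact ⟨d, ⟨H.lt (hRcore d v h), hRcore d v h, hb⟩, h⟩
            · left; exact ⟨hv, by omega⟩
        · left; exact ⟨(hRadj c v hv).1, hRown c v hv⟩
    have hd1 : Disjoint ((Finset.range n).filter fun v => own v = c + 1)
        (((Finset.range n).filter fun c' => core c' ≠ 0 ∧ par c' = c + 1).biUnion R) := by
      rw [Finset.disjoint_left]
      intro v hv hv'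
      simp only [Finset.mem_filter, Finset.mem_biUnion] at hv hv'
      obtain ⟨c', ⟨_, hc', hp⟩, hR'⟩ := hv'
      have := hRown c' v hR'
      exact hparlt c' c hc' hp (by omega)
    have hd2 : Disjoint ((Finset.range n).filter fun v => blk v = c + 1) (R c) := by
      rw [Finset.disjoint_left]
      intro v hv hv'
      simp only [Finset.mem_filter] at hv
      rw [hblk v c (hRown c v hv'), if_pos hv'] at hv
      exact hparlt c c hc hv.2 rfl
    have hcard := congrArg Finset.card hset
    rw [Finset.card_union_of_disjoint hd1, Finset.card_union_of_disjoint hd2,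
      Finset.card_biUnion (by
        intro a _ b _ hab
        rw [Function.onFun, Finset.disjoint_left]
        intro v hv hv'
        have h1 := hRown a v hv
        have h2 := hRown b v hv'
        exact hab (by omega)), hRc c, if_pos hc] at hcard
    have hs : ∑ c' ∈ (Finset.range n).filter (fun c' => core c' ≠ 0 ∧ par c' = c + 1),
        (R c').card = ∑ c' ∈ (Finset.range n).filter (fun c' => core c' ≠ 0 ∧ par c' = c + 1),
        rem c' := by
      refine Finset.sum_congr rfl fun c' hc' => ?_
      rw [hRc, if_pos (Finset.mem_filter.1 hc').2.1]
    have hf := H.flow c hc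
    rw [hs] at hcard
    unfold CapCenter.load at hf ⊢
    omega
  · intro c hc
    have := hRc c
    rw [if_pos hc] at this
    rw [← this]
    refine Finset.card_le_card fun v hv => ?_
    simp only [Finset.mem_filter] at hv
    rw [hblk v c hv.2.1] at hv
    by_contra h
    rw [if_neg h] at hv
    exact absurd hv.2.2 (Nat.succ_ne_zero c)

end Graph

end CapCenter

namespace CapCenter

/-! ### Lower bounds for cuts between clients and opened vertices. -/

section Cut

open scoped Classical

/-- A greedy assignment of vertices to core centers: if `u` is rejected, then its neighbours lie in
a tight set that is occupied by vertices of at least the same capacity. -/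
structure IsGreedy (n : ℕ) (G : ℕ → ℕ → Prop) (U cap M : ℕ → ℕ) : Prop where
  assign : IsAssignment n G M
  rejected : ∀ u < n, M u = 0 → ∃ T, IsTight n G cap M T ∧ (∀ c, G u c → c ∈ T) ∧
    ∀ x < n, ∀ c ∈ T, M x = c + 1 → U u ≤ U x
  load_le : ∀ c, load n M c ≤ cap c

/-- The assignment `φ` of the vertices in `C` to centers, every center serving between `L` and
`U u` neighbours. -/
structure IsService (n L : ℕ) (adj : ℕ → ℕ → Prop) (U : ℕ → ℕ) (C : Finset ℕ) (φ : ℕ → ℕ) :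
    Prop where
  lt : ∀ v ∈ C, v < n
  allowed : ∀ v ∈ C, Allowed n L adj U (φ v)
  edge : ∀ v ∈ C, adj v (φ v)
  lower : ∀ v ∈ C, L ≤ (C.filter fun w => φ w = φ v).card
  upper : ∀ v ∈ C, (C.filter fun w => φ w = φ v).card ≤ U (φ v)

/-- Summation by layers: `U u` is the number of `τ` with `τ + 1 ≤ U u`, so a sum of capacities is
the sum over `τ` of the sizes of the level sets. -/
theorem sum_le_sum_of_level {S S' : Finset ℕ} {U : ℕ → ℕ}
    (h : ∀ τ, (S.filter fun u => τ ≤ U u).card ≤ (S'.filter fun u => τ ≤ U u).card) :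
    ∑ u ∈ S, U u ≤ ∑ u ∈ S', U u := by
  have key : ∀ N (R : Finset ℕ), (∀ u ∈ R, U u ≤ N) →
      ∑ u ∈ R, U u = ∑ τ ∈ Finset.range N, (R.filter fun u => τ + 1 ≤ U u).card := by
    intro N R hN
    have h1 : ∀ u ∈ R, U u = ∑ τ ∈ Finset.range N, if τ + 1 ≤ U u then 1 else 0 := by
      intro u hu
      rw [← Finset.card_filter]
      have : (Finset.range N).filter (fun τ => τ + 1 ≤ U u) = Finset.range (U u) := by
        ext τ
        have := hN u hu
        simp only [Finset.mem_filter, Finset.mem_range]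
        omega
      rw [this, Finset.card_range]
    rw [Finset.sum_congr rfl h1, Finset.sum_comm]
    exact Finset.sum_congr rfl fun τ _ => (Finset.card_filter _ _).symm
  have hN : ∀ u ∈ S ∪ S', U u ≤ (S ∪ S').sup U := fun u hu => Finset.le_sup hu
  rw [key _ S fun u hu => hN u (Finset.mem_union_left _ hu),
    key _ S' fun u hu => hN u (Finset.mem_union_right _ hu)]
  exact Finset.sum_le_sum fun τ _ => h (τ + 1)

variable {n L : ℕ} {adj : ℕ → ℕ → Prop} {U core par own rem cap M blk φ : ℕ → ℕ}
  {C : Finset ℕ}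

/-- Unions of tight sets are tight, so one set accounts for all rejected vertices in `R` at once. -/
theorem IsGreedy.exists_tight {G : ℕ → ℕ → Prop} (hM : IsGreedy n G U cap M) (τ : ℕ)
    (R : Finset ℕ) (hR : ∀ u ∈ R, u < n ∧ M u = 0 ∧ τ ≤ U u) :
    ∃ T, IsTight n G cap M T ∧ (∀ u ∈ R, ∀ c, G u c → c ∈ T) ∧
      ∀ x < n, ∀ c ∈ T, M x = c + 1 → τ ≤ U x := by
  choose! T hT hGT hU using hM.rejected
  refine ⟨R.biUnion T, ⟨?_, ?_⟩, ?_, ?_⟩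
  · intro j hj
    obtain ⟨u, hu, hj⟩ := Finset.mem_biUnion.1 hj
    exact (hT u (hR u hu).1 (hR u hu).2.1).1 j hj
  · intro i hi j hj hij j' hG
    obtain ⟨u, hu, hj⟩ := Finset.mem_biUnion.1 hj
    exact Finset.mem_biUnion.2 ⟨u, hu, (hT u (hR u hu).1 (hR u hu).2.1).2 i hi j hj hij j' hG⟩
  · intro u hu c hc
    exact Finset.mem_biUnion.2 ⟨u, hu, hGT u (hR u hu).1 (hR u hu).2.1 c hc⟩
  · intro x hx c hc hxc
    obtain ⟨u, hu, hc⟩ := Finset.mem_biUnion.1 hc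
    exact (hR u hu).2.2.trans (hU u (hR u hu).1 (hR u hu).2.1 x hx c hc hxc)

/-- The two alternatives in `Reach` are made for this: a client stays where it is attached, or at
the parent of a core center adjacent to it. -/
theorem IsBlocks.reach (hB : IsBlocks n L adj core par own rem cap blk)
    (H : CoreSystem n L adj (Allowed n L adj U) core par own rem cap)
    (hadj : IsReflGraph n adj) {u v c : ℕ} (hu : Allowed n L adj U u) (huv : adj u v)
    (h : blk v = c + 1) : Reach adj (Allowed n L adj U) core par own u c := by
  rcases hov : own v with _ | d
  · rw [hB.none v hov] at h; omega
  · have hd := (H.own_spec v d hov).1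
    rcases hB.spec v d hov with h' | ⟨h1, h2⟩
    · have : d = c := by omega
      subst this
      exact ⟨hu, hd, v, huv, Or.inl hov⟩
    · have hp : par d = c + 1 := by omega
      exact ⟨hu, (H.par_spec d c hd hp).1, v, huv, Or.inr ⟨d, hd, hadj.symm _ _ h1, hp⟩⟩

/-- Three hops to the core center of attachment, or one hop to it and four to its parent. -/
theorem IsBlocks.hops (hB : IsBlocks n L adj core par own rem cap blk)
    (H : CoreSystem n L adj (Allowed n L adj U) core par own rem cap)
    (hadj : IsReflGraph n adj) {v c : ℕ} (hv : v < n) (h : blk v = c + 1) :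
    core c ≠ 0 ∧ Hops adj 5 v c := by
  rcases hov : own v with _ | d
  · rw [hB.none v hov] at h; omega
  · have hd := (H.own_spec v d hov).1
    rcases hB.spec v d hov with h' | ⟨h1, h2⟩
    · have : d = c := by omega
      subst this
      exact ⟨hd, (H.own_hops hov).mono hadj hv (by norm_num)⟩
    · have hp : par d = c + 1 := by omega
      have := H.par_spec d c hd hp
      exact ⟨this.1, (hops_one.2 (hadj.symm _ _ h1)).trans this.2.2⟩

theorem IsBlocks.era_own (hB : IsBlocks n L adj core par own rem cap blk)
    (H : CoreSystem n L adj (Allowed n L adj U) core par own rem cap)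
    (hadj : IsReflGraph n adj) {v c : ℕ} (h : blk v = c + 1) :
    own v ≠ 0 ∧ era n core par (own v - 1) = era n core par c := by
  rcases hov : own v with _ | d
  · rw [hB.none v hov] at h; omega
  · refine ⟨by omega, ?_⟩
    rw [Nat.add_sub_cancel]
    rcases hB.spec v d hov with h' | ⟨h1, h2⟩
    · have : d = c := by omega
      subst this; rfl
    · exact H.era_par hadj (H.own_spec v d hov).1 (by omega)

/-- Fewer than `L` clients of a component stay at no core center. -/
theorem IsBlocks.card_left_lt (hB : IsBlocks n L adj core par own rem cap blk)
    (H : CoreSystem n L adj (Allowed n L adj U) core par own rem cap) (hL : 1 ≤ L) (e : ℕ) :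
    ((Finset.range n).filter fun v =>
      own v ≠ 0 ∧ era n core par (own v - 1) = e ∧ blk v = 0).card < L := by
  have hroot : ∀ v, own v ≠ 0 → blk v = 0 → ∃ c, own v = c + 1 ∧ core c ≠ 0 ∧ par c = 0 := by
    intro v hv hb
    obtain ⟨c, hc⟩ := Nat.exists_eq_succ_of_ne_zero hv
    refine ⟨c, hc, (H.own_spec v c hc).1, ?_⟩
    rcases hB.spec v c hc with h | h <;> omega
  rcases Finset.eq_empty_or_nonempty ((Finset.range n).filter fun v =>
      own v ≠ 0 ∧ era n core par (own v - 1) = e ∧ blk v = 0) with h | ⟨v₀, hv₀⟩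
  · rw [h, Finset.card_empty]; omega
  · simp only [Finset.mem_filter] at hv₀
    obtain ⟨-, h1, h2, h3⟩ := hv₀
    -- A client that stays nowhere was handed over by a root, and the number `e` determines the
    -- root. So all such clients belong to the remainder of one root.
    obtain ⟨c, hc, hcc, hp⟩ := hroot v₀ h1 h3
    rw [hc, Nat.add_sub_cancel, H.era_root hcc hp] at h2
    refine lt_of_le_of_lt (Finset.card_le_card fun v hv => ?_)
      ((hB.left c hcc).trans_lt (H.rem_lt c hcc))
    simp only [Finset.mem_filter] at hv ⊢
    obtain ⟨hv, h4, h5, h6⟩ := hv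
    obtain ⟨c', hc', hcc', hp'⟩ := hroot v h4 h6
    rw [hc', Nat.add_sub_cancel, H.era_root hcc' hp'] at h5
    have := H.inj c' c hcc' (h5.trans h2.symm)
    subst this
    exact ⟨hv, hc', h6⟩

theorem IsService.own_era (hC : IsService n L adj U C φ)
    (H : CoreSystem n L adj (Allowed n L adj U) core par own rem cap)
    (hadj : IsReflGraph n adj) {v : ℕ} (hv : v ∈ C) :
    own v ≠ 0 ∧ era n core par (own v - 1) = era n core par (own (φ v) - 1) :=
  ⟨H.own_ne v _ (hC.allowed v hv) (hC.edge v hv),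
    H.era_own hadj (hC.allowed v hv) (hadj.symm _ _ (hC.edge v hv))⟩

/-- A Hall argument with multiplicity `L`. Let `P` be the centers of the service in component `e`
with capacity at least `τ`. The rejected ones have all their core centers in a tight set `T` whose
occupants have capacity at least `τ`. Let `S` consist of the members of `P` that are rejected or
assigned into `T`; their clients can stay only at core centers in `T`, or nowhere. Counting clients
bounds `S.card` by the capacity of `T` inside the component, which is the number of its occupants
there. The other members of `P` are opened and assigned outside `T`, hence are counted separately.
-/
theorem card_level_le (hC : IsService n L adj U C φ)
    (H : CoreSystem n L adj (Allowed n L adj U) core par own rem cap)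
    (hadj : IsReflGraph n adj) (hL : 1 ≤ L)
    (hB : IsBlocks n L adj core par own rem cap blk)
    (hM : IsGreedy n (Reach adj (Allowed n L adj U) core par own) U cap M) (e τ : ℕ) :
    (((C.image φ).filter fun u => era n core par (own u - 1) = e).filter fun u => τ ≤ U u).card ≤
    (((Finset.range n).filter fun u => M u ≠ 0 ∧ era n core par (own u - 1) = e).filter
      fun u => τ ≤ U u).card := by
  set P := ((C.image φ).filter fun u => era n core par (own u - 1) = e).filter fun u => τ ≤ U u
    with hPdef
  have hP : ∀ u, u ∈ P ↔ (∃ v ∈ C, φ v = u) ∧ era n core par (own u - 1) = e ∧ τ ≤ U u := by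
    intro u; simp only [P, Finset.mem_filter, Finset.mem_image, and_assoc]
  have hPA : ∀ u ∈ P, Allowed n L adj U u := by
    intro u hu
    obtain ⟨⟨v, hv, rfl⟩, -⟩ := (hP u).1 hu
    exact hC.allowed v hv
  obtain ⟨T, hT, hRT, hUT⟩ := hM.exists_tight τ (P.filter fun u => M u = 0) (fun u hu => by
    rw [Finset.mem_filter] at hu
    exact ⟨(hPA u hu.1).1, hu.2, ((hP u).1 hu.1).2.2⟩)
  set Te := T.filter fun c => core c ≠ 0 ∧ era n core par c = e with hTe
  set S := P.filter fun u => M u = 0 ∨ ∃ c ∈ T, M u = c + 1 with hS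
  set Q := P.filter fun u => ¬ (M u = 0 ∨ ∃ c ∈ T, M u = c + 1) with hQ
  have hPSQ : S.card + Q.card = P.card := Finset.card_filter_add_card_filter_not _
  have hload : ∑ c ∈ Te, load n M c = ∑ c ∈ Te, cap c :=
    Finset.sum_congr rfl fun c hc => hT.1 c (Finset.mem_filter.1 hc).1
  -- the clients of the centers in `S` stay at core centers in `Te`
  have hsub : C.filter (fun v => φ v ∈ S) ⊆
      ((Finset.range n).filter fun v => ∃ c ∈ Te, blk v = c + 1) ∪
      (Finset.range n).filter fun v =>
        own v ≠ 0 ∧ era n core par (own v - 1) = e ∧ blk v = 0 := by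
    intro v hv
    rw [Finset.mem_filter] at hv
    obtain ⟨hv, hvS⟩ := hv
    obtain ⟨hown, hera⟩ := hC.own_era H hadj hv
    have hvP := (Finset.mem_filter.1 hvS).1
    have hee := ((hP _).1 hvP).2.1
    rw [hee] at hera
    rw [Finset.mem_union]
    rcases hb : blk v with _ | c
    · right
      simp only [Finset.mem_filter, Finset.mem_range]
      exact ⟨hC.lt v hv, hown, hera, hb⟩
    · left
      have hr := hB.reach H hadj (hC.allowed v hv) (hadj.symm _ _ (hC.edge v hv)) hb
      simp only [Finset.mem_filter, Finset.mem_range, hTe]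
      refine ⟨hC.lt v hv, c, ⟨?_, hr.2.1, (hB.era_own H hadj hb).2.symm.trans hera⟩, hb⟩
      rcases (Finset.mem_filter.1 hvS).2 with h0 | ⟨c', hc', h⟩
      · exact hRT _ (Finset.mem_filter.2 ⟨hvP, h0⟩) c hr
      · exact hT.2 _ (hPA _ hvP).1 c' hc' h c hr
  have hLS : L * S.card ≤ (C.filter fun v => φ v ∈ S).card := by
    rw [Finset.card_eq_sum_card_fiberwise (s := C.filter fun v => φ v ∈ S) (f := φ) (t := S)
      (fun v hv => (Finset.mem_filter.1 hv).2), mul_comm, ← smul_eq_mul]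
    refine Finset.card_nsmul_le_sum _ _ _ fun u hu => ?_
    obtain ⟨⟨v, hv, rfl⟩, -⟩ := (hP u).1 (Finset.mem_filter.1 hu).1
    refine (hC.lower v hv).trans (Finset.card_le_card fun w hw => ?_)
    rw [Finset.mem_filter] at hw
    simp only [Finset.mem_filter]
    exact ⟨⟨hw.1, hw.2 ▸ hu⟩, hw.2⟩
  have hblk : ((Finset.range n).filter fun v => ∃ c ∈ Te, blk v = c + 1).card =
      L * ∑ c ∈ Te, cap c := by
    rw [← sum_load, Finset.mul_sum]
    exact Finset.sum_congr rfl fun c hc => hB.load c (Finset.mem_filter.1 hc).2.1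
  -- The clients of `S` number at least `L * S.card`, and fewer than `L` of them are not kept in the
  -- blocks of `Te`. Divisibility of the block sizes by `L` therefore leaves no loss after rounding.
  have hS_le : S.card ≤ ∑ c ∈ Te, cap c := by
    have h1 := (Finset.card_le_card hsub).trans (Finset.card_union_le _ _)
    have h2 := hB.card_left_lt H hL e
    rw [hblk] at h1
    by_contra hcon
    have : L * (∑ c ∈ Te, cap c + 1) ≤ L * S.card := Nat.mul_le_mul_left L (by omega)
    rw [Nat.mul_add, Nat.mul_one] at this
    omega
  have hfin : ((Finset.range n).filter fun x => ∃ c ∈ Te, M x = c + 1) ∪ Q ⊆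
      ((Finset.range n).filter fun u => M u ≠ 0 ∧ era n core par (own u - 1) = e).filter
        fun u => τ ≤ U u := by
    intro x hx
    simp only [Finset.mem_union, Finset.mem_filter, Finset.mem_range] at hx ⊢
    rcases hx with ⟨hx, c, hc, hxc⟩ | hx
    · rw [hTe, Finset.mem_filter] at hc
      have hr := hM.assign x hx c hxc
      exact ⟨⟨hx, by omega, (H.reach_era hadj hr).symm.trans hc.2.2⟩, hUT x hx c hc.1 hxc⟩
    · rw [hQ, Finset.mem_filter] at hx
      push Not at hx
      exact ⟨⟨(hPA x hx.1).1, hx.2.1, ((hP x).1 hx.1).2.1⟩, ((hP x).1 hx.1).2.2⟩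
  have hdisj : Disjoint ((Finset.range n).filter fun x => ∃ c ∈ Te, M x = c + 1) Q := by
    rw [Finset.disjoint_left]
    intro x hx hx'
    simp only [Finset.mem_filter] at hx
    obtain ⟨-, c, hc, hxc⟩ := hx
    exact (Finset.mem_filter.1 hx').2 (Or.inr ⟨c, (Finset.mem_filter.1 hc).1, hxc⟩)
  have := Finset.card_le_card hfin
  rw [Finset.card_union_of_disjoint hdisj, ← sum_load, hload] at this
  omega

/-- A core center is hit if it is within five hops of `Z`; an opened vertex assigned to a hit core
center is then within `6 + 5 = 11` hops of `Z`. If all core centers of the component are hit, then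
all its opened vertices count with full capacity, and `card_level_le` at all levels suffices.
Otherwise each client is charged to an opened vertex near `Z`, or to a vertex outside `Z`. Blocks at
core centers that are not hit avoid `Z` and pay for themselves; the clients that stay nowhere are
paid for by vertices near the first such core center or near its parent. -/
theorem component_cut (hC : IsService n L adj U C φ)
    (H : CoreSystem n L adj (Allowed n L adj U) core par own rem cap)
    (hadj : IsReflGraph n adj) (hL : 1 ≤ L)
    (hB : IsBlocks n L adj core par own rem cap blk)
    (hM : IsGreedy n (Reach adj (Allowed n L adj U) core par own) U cap M)
    (Z : Finset ℕ) (e : ℕ) :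
    (C.filter fun v => era n core par (own v - 1) = e).card ≤
      ((Finset.range n \ Z).filter fun v => era n core par (own v - 1) = e).card +
      ∑ u ∈ ((Finset.range n).filter fun u => M u ≠ 0 ∧ ∃ z ∈ Z, Hops adj 11 z u).filter
        (fun u => era n core par (own u - 1) = e), U u := by
  set hit : ℕ → Prop := fun c => ∃ z ∈ Z, Hops adj 5 z c with hhit
  have hitY : ∀ u < n, ∀ c, Reach adj (Allowed n L adj U) core par own u c → hit c →
      ∃ z ∈ Z, Hops adj 11 z u := by
    rintro u hu c hr ⟨z, hz, hzc⟩
    exact ⟨z, hz, hzc.trans ((H.reach_hops hadj hr).symm hadj)⟩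
  by_cases hall : ∀ c, core c ≠ 0 → era n core par c = e → hit c
  · -- every core center of the component is close to `Z`
    refine le_trans ?_ (Nat.le_add_left _ _)
    have h1 : (C.filter fun v => era n core par (own v - 1) = e).card ≤
        ∑ u ∈ (C.image φ).filter (fun u => era n core par (own u - 1) = e), U u := by
      rw [Finset.card_eq_sum_card_fiberwise (f := φ)
        (t := (C.image φ).filter (fun u => era n core par (own u - 1) = e)) (fun v hv => by
          rw [Finset.mem_coe, Finset.mem_filter] at hv ⊢
          exact ⟨Finset.mem_image_of_mem _ hv.1, (hC.own_era H hadj hv.1).2 ▸ hv.2⟩)]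
      refine Finset.sum_le_sum fun u hu => ?_
      obtain ⟨v, hv, rfl⟩ := Finset.mem_image.1 (Finset.mem_filter.1 hu).1
      refine le_trans (Finset.card_le_card ?_) (hC.upper v hv)
      exact Finset.filter_subset_filter _ (Finset.filter_subset _ _)
    refine h1.trans ((sum_le_sum_of_level fun τ =>
      card_level_le hC H hadj hL hB hM e τ).trans (Finset.sum_le_sum_of_subset fun u hu => ?_))
    simp only [Finset.mem_filter, Finset.mem_range] at hu ⊢
    obtain ⟨hu, hMu, hue⟩ := hu
    obtain ⟨c, hc⟩ := Nat.exists_eq_succ_of_ne_zero hMu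
    have hr := hM.assign u hu c hc
    exact ⟨⟨hu, hMu, hitY u hu c hr (hall c hr.2.1 ((H.reach_era hadj hr).trans hue))⟩, hue⟩
  · push Not at hall
    obtain ⟨w₀, hw₀⟩ := hall
    -- the core centers of the component that are far from `Z`
    set W := (Finset.range n).filter fun c =>
      core c ≠ 0 ∧ era n core par c = e ∧ ¬ hit c with hW
    have hWmem : ∀ c, c ∈ W ↔ core c ≠ 0 ∧ era n core par c = e ∧ ¬ hit c := by
      intro c
      simp only [hW, Finset.mem_filter, Finset.mem_range]
      exact ⟨fun h => h.2, fun h => ⟨H.lt h.1, h⟩⟩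
    obtain ⟨w, hw, hwmin⟩ := W.exists_min_image core ⟨w₀, (hWmem w₀).2 hw₀⟩
    obtain ⟨hwc, hwe, hwh⟩ := (hWmem w).1 hw
    obtain ⟨T, hT, hRT, -⟩ := hM.exists_tight 0
      ((Finset.range n).filter fun u => M u = 0) (fun u hu => by
        simp only [Finset.mem_filter, Finset.mem_range] at hu
        exact ⟨hu.1, hu.2, Nat.zero_le _⟩)
    set Ht := T.filter fun c => core c ≠ 0 ∧ era n core par c = e ∧ hit c with hHt
    set left := (Finset.range n).filter fun v =>
        own v ≠ 0 ∧ era n core par (own v - 1) = e ∧ blk v = 0 with hleft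
    set BW := (Finset.range n).filter fun v => ∃ c ∈ W, blk v = c + 1 with hBW
    set BT := (Finset.range n).filter fun v => ∃ c ∈ Ht, blk v = c + 1 with hBT
    set Y := ((Finset.range n).filter fun u => M u ≠ 0 ∧ ∃ z ∈ Z, Hops adj 11 z u).filter
        (fun u => era n core par (own u - 1) = e) with hY
    set Y₁ := (Finset.range n).filter fun u => ∃ c ∈ Ht, M u = c + 1 with hY₁
    set Y₂ := Y.filter fun u => ∀ c ∈ T, M u ≠ c + 1 with hY₂
    -- The last part of the cover takes the clients kept at a hit core center outside `T`. Their
    -- center `φ v` is then neither rejected nor assigned into `T`, since in both cases its core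
    -- centers would all lie in `T`. So it is opened and belongs to `Y₂`.
    have hcover : C.filter (fun v => era n core par (own v - 1) = e) ⊆
        ((left ∪ BW) ∪ BT) ∪ C.filter fun v => φ v ∈ Y₂ := by
      intro v hv
      rw [Finset.mem_filter] at hv
      obtain ⟨hv, hve⟩ := hv
      obtain ⟨hown, hera⟩ := hC.own_era H hadj hv
      simp only [Finset.mem_union]
      rcases hb : blk v with _ | c
      · left; left; left
        simp only [hleft, Finset.mem_filter, Finset.mem_range]
        exact ⟨hC.lt v hv, hown, hve, hb⟩
      · have hr := hB.reach H hadj (hC.allowed v hv) (hadj.symm _ _ (hC.edge v hv)) hb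
        have hce : era n core par c = e := (hB.era_own H hadj hb).2.symm.trans hve
        by_cases hch : hit c
        · by_cases hcT : c ∈ T
          · left; right
            simp only [hBT, Finset.mem_filter, Finset.mem_range]
            exact ⟨hC.lt v hv, c, by simp only [hHt, Finset.mem_filter]
                                     exact ⟨hcT, hr.2.1, hce, hch⟩, hb⟩
          · right
            have hlt := (hC.allowed v hv).1
            simp only [hY₂, hY, Finset.mem_filter, Finset.mem_range]
            refine ⟨hv, ⟨⟨hlt, ?_, hitY _ hlt c hr hch⟩, hera.symm.trans hve⟩, ?_⟩
            · intro h0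
              exact hcT (hRT (φ v) (by
                simp only [Finset.mem_filter, Finset.mem_range]; exact ⟨hlt, h0⟩) c hr)
            · intro c' hc' h
              exact hcT (hT.2 _ hlt c' hc' h c hr)
        · left; left; right
          simp only [hBW, Finset.mem_filter, Finset.mem_range]
          exact ⟨hC.lt v hv, c, (hWmem c).2 ⟨hr.2.1, hce, hch⟩, hb⟩
    -- A saturated core center `c` keeps `L * cap c` clients and has exactly `cap c` opened vertices
    -- assigned to it, each of capacity at least `L`.
    have hBT_le : BT.card ≤ ∑ u ∈ Y₁, U u := by
      have h1 : BT.card = L * ∑ c ∈ Ht, cap c := by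
        rw [hBT, ← sum_load, Finset.mul_sum]
        refine Finset.sum_congr rfl fun c hc => hB.load c ?_
        rw [hHt, Finset.mem_filter] at hc
        exact hc.2.1
      have h2 : Y₁.card = ∑ c ∈ Ht, cap c := by
        rw [hY₁, ← sum_load]
        exact Finset.sum_congr rfl fun c hc => hT.1 c (Finset.mem_filter.1 hc).1
      rw [h1, ← h2, mul_comm, ← smul_eq_mul]
      refine Finset.card_nsmul_le_sum _ _ _ fun u hu => ?_
      simp only [hY₁, Finset.mem_filter, Finset.mem_range] at hu
      obtain ⟨hu, c, hc, huc⟩ := hu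
      exact (hM.assign u hu c huc).1.2.2
    have hY₂_le : (C.filter fun v => φ v ∈ Y₂).card ≤ ∑ u ∈ Y₂, U u := by
      rw [Finset.card_eq_sum_card_fiberwise (s := C.filter fun v => φ v ∈ Y₂)
        (f := φ) (t := Y₂) (fun v hv => (Finset.mem_filter.1 hv).2)]
      refine Finset.sum_le_sum fun u hu => ?_
      rcases Finset.eq_empty_or_nonempty ((C.filter fun v => φ v ∈ Y₂).filter fun v => φ v = u)
        with h | ⟨v, hv⟩
      · rw [h, Finset.card_empty]; exact Nat.zero_le _
      · simp only [Finset.mem_filter] at hv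
        obtain ⟨⟨hv, -⟩, rfl⟩ := hv
        refine le_trans (Finset.card_le_card ?_) (hC.upper v hv)
        exact Finset.filter_subset_filter _ (Finset.filter_subset _ _)
    have hYsum : ∑ u ∈ Y₁, U u + ∑ u ∈ Y₂, U u ≤ ∑ u ∈ Y, U u := by
      rw [← Finset.sum_union]
      · refine Finset.sum_le_sum_of_subset (Finset.union_subset (fun u hu => ?_)
          (Finset.filter_subset _ _))
        simp only [hY₁, hHt, Finset.mem_filter, Finset.mem_range] at hu
        obtain ⟨hu, c, ⟨hcT, hcc, hce, hch⟩, huc⟩ := hu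
        have hr := hM.assign u hu c huc
        simp only [hY, Finset.mem_filter, Finset.mem_range]
        exact ⟨⟨hu, by omega, hitY u hu c hr hch⟩, (H.reach_era hadj hr).symm.trans hce⟩
      · rw [Finset.disjoint_left]
        intro u hu hu'
        simp only [hY₁, hHt, Finset.mem_filter, Finset.mem_range] at hu
        obtain ⟨hu, c, ⟨hcT, hcc, hce, hch⟩, huc⟩ := hu
        exact (Finset.mem_filter.1 hu').2 c hcT huc
    have hBWmem : ∀ v ∈ BW, v ∈ (Finset.range n \ Z).filter fun v =>
        era n core par (own v - 1) = e := by
      intro v hv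
      simp only [hBW, Finset.mem_filter, Finset.mem_range] at hv
      obtain ⟨hv, c, hc, hvc⟩ := hv
      obtain ⟨hcc, hce, hch⟩ := (hWmem c).1 hc
      simp only [Finset.mem_filter, Finset.mem_sdiff, Finset.mem_range]
      exact ⟨⟨hv, fun hz => hch ⟨v, hz, (hB.hops H hadj hv hvc).2⟩⟩,
        (hB.era_own H hadj hvc).2.trans hce⟩
    -- The clients in `left` may lie in `Z`; they have to be paid for by vertices outside `Z` that
    -- `BW` does not use.
    have hsave : left.card + BW.card ≤ ((Finset.range n \ Z).filter fun v =>
        era n core par (own v - 1) = e).card := by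
      rcases hpw : par w with _ | q
      · -- the remaining clients are close to the root, hence not in `Z`
        rw [← Finset.card_union_of_disjoint]
        · refine Finset.card_le_card (Finset.union_subset (fun v hv => ?_) hBWmem)
          simp only [hleft, Finset.mem_filter, Finset.mem_range] at hv
          obtain ⟨hv, h1, h2, h3⟩ := hv
          obtain ⟨c, hc⟩ := Nat.exists_eq_succ_of_ne_zero h1
          have hcc := (H.own_spec v c hc).1
          have hsp : adj c v ∧ par c = 0 := by
            rcases hB.spec v c hc with h | h
            · omega
            · exact ⟨h.1, by omega⟩
          have hcw : c = w := by
            apply H.inj c w hcc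
            rw [← H.era_root hcc hsp.2, ← H.era_root hwc hpw, hwe]
            rw [hc] at h2
            exact h2
          subst hcw
          simp only [Finset.mem_filter, Finset.mem_sdiff, Finset.mem_range]
          exact ⟨⟨hv, fun hz => hwh ⟨v, hz,
            (hops_one.2 (hadj.symm _ _ hsp.1)).mono hadj hv (by norm_num)⟩⟩, h2⟩
        · rw [Finset.disjoint_left]
          intro v hv hv'
          simp only [hleft, hBW, Finset.mem_filter] at hv hv'
          obtain ⟨_, c, _, hvc⟩ := hv'
          omega
      · -- the neighbours of the parent of `w` are not in `Z`
        obtain ⟨hq, hqw, h4⟩ := H.par_spec w q hwc hpw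
        have hqe : era n core par q = e := (H.era_par hadj hwc hpw).symm.trans hwe
        have hqW : ∀ c ∈ W, core c ≠ core q := fun c hc h => by
          have := hwmin c hc; omega
        set N := (Finset.range n).filter fun v => adj q v with hN
        have hNL : left.card ≤ N.card :=
          (hB.card_left_lt H hL e).le.trans (H.allowed q hq).2.1
        refine (Nat.add_le_add_right hNL _).trans ?_
        rw [← Finset.card_union_of_disjoint]
        · refine Finset.card_le_card (Finset.union_subset (fun v hv => ?_) hBWmem)
          simp only [hN, Finset.mem_filter, Finset.mem_range] at hv
          have hov := H.own_adj v q hq (hadj.symm _ _ hv.2)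
          simp only [Finset.mem_filter, Finset.mem_sdiff, Finset.mem_range]
          refine ⟨⟨hv.1, fun hz => hwh ⟨v, hz, (hops_one.2 (hadj.symm _ _ hv.2)).trans
            (h4.symm hadj)⟩⟩, ?_⟩
          rw [hov]; exact hqe
        -- A neighbour of `q` stays at `q` or at the parent of `q`. Both precede `w`, the first core
        -- center in `W`, so they are not in `W`.
        · rw [Finset.disjoint_left]
          intro v hv hv'
          simp only [hN, hBW, Finset.mem_filter] at hv hv'
          obtain ⟨_, c, hc, hvc⟩ := hv'
          have hov := H.own_adj v q hq (hadj.symm _ _ hv.2)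
          rcases hB.spec v q hov with h | ⟨-, h⟩
          · have : q = c := by omega
            exact hqW c hc (by rw [this])
          · have := (H.par_spec q c hq (by omega)).2.1
            have := hwmin c hc
            omega
    have h1 := Finset.card_le_card hcover
    have h2 := Finset.card_union_le ((left ∪ BW) ∪ BT) (C.filter fun v => φ v ∈ Y₂)
    have h3 := Finset.card_union_le (left ∪ BW) BT
    have h4 := Finset.card_union_le left BW
    omega

/-- Every cut for the vertices opened by the greedy assignment has at least the capacity `C`. -/
theorem card_le_cut (hC : IsService n L adj U C φ)
    (H : CoreSystem n L adj (Allowed n L adj U) core par own rem cap)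
    (hadj : IsReflGraph n adj) (hL : 1 ≤ L)
    (hM : IsGreedy n (Reach adj (Allowed n L adj U) core par own) U cap M)
    (Z : Finset ℕ) :
    C.card ≤ (Finset.range n \ Z).card +
      ∑ u ∈ (Finset.range n).filter (fun u => M u ≠ 0 ∧ ∃ z ∈ Z, Hops adj 11 z u), U u := by
  obtain ⟨blk, hB⟩ := H.exists_blocks hadj
  have hCn : C ⊆ Finset.range n := fun v hv => Finset.mem_range.2 (hC.lt v hv)
  -- By truncated subtraction an unattached vertex falls into the fibre of vertex `0`. This does no
  -- harm: vertices of `C` are attached, and others only enlarge the right-hand side.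
  let E := (Finset.range n).image fun v => era n core par (own v - 1)
  have hmaps : ∀ S ⊆ Finset.range n, ∀ v ∈ S, era n core par (own v - 1) ∈ E :=
    fun S hS v hv => Finset.mem_image_of_mem _ (hS hv)
  rw [Finset.card_eq_sum_card_fiberwise (s := C) (t := E) (hmaps C hCn),
    Finset.card_eq_sum_card_fiberwise (s := Finset.range n \ Z) (t := E)
      (hmaps _ Finset.sdiff_subset),
    ← Finset.sum_fiberwise_of_maps_to (t := E) (hmaps _ (Finset.filter_subset _ _)),
    ← Finset.sum_add_distrib]
  exact Finset.sum_le_sum fun e _ => component_cut hC H hadj hL hB hM Z e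

/-- Every cut with the uniform capacity `L` has at least the capacity of all opened vertices. -/
theorem mul_card_le_cut
    (H : CoreSystem n L adj (Allowed n L adj U) core par own rem cap)
    (hadj : IsReflGraph n adj)
    (hM : IsGreedy n (Reach adj (Allowed n L adj U) core par own) U cap M)
    (Z : Finset ℕ) :
    L * ((Finset.range n).filter fun u => M u ≠ 0).card ≤ (Finset.range n \ Z).card +
      L * ((Finset.range n).filter fun u => M u ≠ 0 ∧ ∃ z ∈ Z, Hops adj 11 z u).card := by
  obtain ⟨blk, hB⟩ := H.exists_blocks hadj
  set W := (Finset.range n).filter fun c => core c ≠ 0 ∧ ¬ ∃ z ∈ Z, Hops adj 5 z c with hW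
  have h1 : (Finset.range n).filter (fun u => M u ≠ 0) ⊆
      ((Finset.range n).filter fun u => M u ≠ 0 ∧ ∃ z ∈ Z, Hops adj 11 z u) ∪
      (Finset.range n).filter fun u => ∃ c ∈ W, M u = c + 1 := by
    intro u hu
    simp only [Finset.mem_union, Finset.mem_filter, Finset.mem_range] at hu ⊢
    obtain ⟨hu, hMu⟩ := hu
    obtain ⟨c, hc⟩ := Nat.exists_eq_succ_of_ne_zero hMu
    have hr := hM.assign u hu c hc
    by_cases hit : ∃ z ∈ Z, Hops adj 5 z c
    · obtain ⟨z, hz, hzc⟩ := hit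
      exact Or.inl ⟨hu, hMu, z, hz, hzc.trans ((H.reach_hops hadj hr).symm hadj)⟩
    · refine Or.inr ⟨hu, c, ?_, hc⟩
      simp only [hW, Finset.mem_filter, Finset.mem_range]
      exact ⟨H.lt hr.2.1, hr.2.1, hit⟩
  -- An opened vertex far from `Z` is assigned to a core center that is not hit; the block of that
  -- center avoids `Z` and provides `L` clients for each unit of capacity.
  have h2 : L * ((Finset.range n).filter fun u => ∃ c ∈ W, M u = c + 1).card ≤
      (Finset.range n \ Z).card := by
    calc L * ((Finset.range n).filter fun u => ∃ c ∈ W, M u = c + 1).card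
        ≤ L * ∑ c ∈ W, cap c := by
          rw [← sum_load]
          exact Nat.mul_le_mul_left _ (Finset.sum_le_sum fun c _ => hM.load_le c)
      _ = ((Finset.range n).filter fun v => ∃ c ∈ W, blk v = c + 1).card := by
          rw [← sum_load, Finset.mul_sum]
          exact Finset.sum_congr rfl fun c hc => (hB.load c (Finset.mem_filter.1 hc).2.1).symm
      _ ≤ _ := by
          refine Finset.card_le_card fun v hv => ?_
          simp only [Finset.mem_filter, Finset.mem_range] at hv
          obtain ⟨hv, c, hc, hvc⟩ := hv
          rw [Finset.mem_sdiff, Finset.mem_range]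
          exact ⟨hv, fun hz => (Finset.mem_filter.1 hc).2.2 ⟨v, hz, (hB.hops H hadj hv hvc).2⟩⟩
  have h3 := Nat.mul_le_mul_left L ((Finset.card_le_card h1).trans (Finset.card_union_le _ _))
  rw [Nat.mul_add] at h3
  omega

end Cut

end CapCenter

namespace CapCenter

/-! ### Logical and arithmetical abbreviations of the source language -/

section Terms

open scoped Classical

variable {D : ℕ → ℕ → ℕ → ℕ → Prop} {s : Store}

/-- The truth of a term that is used as a test. -/
def Tm.Holds (D : ℕ → ℕ → ℕ → ℕ → Prop) (s : Store) (t : Tm) (ρ : ℕ → ℕ) : Prop :=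
  t.eval D s ρ ≠ 0

namespace Tm

/-- The entry of a vector, stored in the first column of an array. -/
def vec (a : ℕ) (i : Tm) : Tm := read a i (const 0)

def and (a b : Tm) : Tm := cond a b (const 0)

/-- Truth means being nonzero, so a sum serves as disjunction, a truncated difference as strict
inequality, and a bounded sum as existential quantifier. -/
def or (a b : Tm) : Tm := plus a b

def not (a : Tm) : Tm := cond a (const 0) (const 1)

def lt (a b : Tm) : Tm := minus b a

def le (a b : Tm) : Tm := not (lt b a)

def eq (a b : Tm) : Tm := and (le a b) (le b a)

def ex (x : ℕ) (t : Tm) : Tm := sum x t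

/-- The number of values of the variable `x` that satisfy `t`. -/
def count (x : ℕ) (t : Tm) : Tm := sum x (cond t (const 1) (const 0))

/-- The least value of the variable `y` that satisfies `t`; the variable `x` is auxiliary. -/
def least (x y : ℕ) (t : Tm) : Tm := count x (not (ex y (and (le (var y) (var x)) t)))

variable {ρ : ℕ → ℕ}

@[simp] theorem eval_const (k : ℕ) : (const k).eval D s ρ = k := rfl

@[simp] theorem eval_var (x : ℕ) : (var x).eval D s ρ = ρ x := rfl

@[simp] theorem eval_reg (x : ℕ) : (reg x).eval D s ρ = s.reg x := rfl

@[simp] theorem eval_read (a : ℕ) (i j : Tm) :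
    (read a i j).eval D s ρ = s.arr a (i.eval D s ρ) (j.eval D s ρ) := rfl

@[simp] theorem eval_vec (a : ℕ) (i : Tm) :
    (vec a i).eval D s ρ = s.arr a (i.eval D s ρ) 0 := rfl

@[simp] theorem eval_plus (a b : Tm) :
    (plus a b).eval D s ρ = a.eval D s ρ + b.eval D s ρ := rfl

@[simp] theorem eval_minus (a b : Tm) :
    (minus a b).eval D s ρ = a.eval D s ρ - b.eval D s ρ := rfl

@[simp] theorem eval_cond (t a b : Tm) : (cond t a b).eval D s ρ =
    if t.Holds D s ρ then a.eval D s ρ else b.eval D s ρ := by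
  simp only [Tm.eval, Holds]
  congr

@[simp] theorem eval_sum (x : ℕ) (t : Tm) : (sum x t).eval D s ρ =
    ∑ i ∈ Finset.range (s.reg 0), t.eval D s (Function.update ρ x i) := rfl

@[simp] theorem eval_count (x : ℕ) (t : Tm) : (count x t).eval D s ρ =
    ((Finset.range (s.reg 0)).filter fun i => t.Holds D s (Function.update ρ x i)).card := by
  simp only [count, eval_sum, eval_cond, eval_const, Finset.card_filter]

@[simp] theorem holds_read (a : ℕ) (i j : Tm) :
    (read a i j).Holds D s ρ ↔ s.arr a (i.eval D s ρ) (j.eval D s ρ) ≠ 0 := Iff.rfl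

@[simp] theorem holds_vec (a : ℕ) (i : Tm) :
    (vec a i).Holds D s ρ ↔ s.arr a (i.eval D s ρ) 0 ≠ 0 := Iff.rfl

@[simp] theorem holds_reg (x : ℕ) : (reg x).Holds D s ρ ↔ s.reg x ≠ 0 := Iff.rfl

@[simp] theorem holds_dle (i j k l : Tm) : (dle i j k l).Holds D s ρ ↔
    D (i.eval D s ρ) (j.eval D s ρ) (k.eval D s ρ) (l.eval D s ρ) := by
  simp [Holds, Tm.eval]

@[simp] theorem holds_and (a b : Tm) :
    (and a b).Holds D s ρ ↔ a.Holds D s ρ ∧ b.Holds D s ρ := by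
  unfold and Holds
  rw [eval_cond]
  unfold Holds
  split_ifs with h <;> simp [h]

@[simp] theorem holds_or (a b : Tm) :
    (or a b).Holds D s ρ ↔ a.Holds D s ρ ∨ b.Holds D s ρ := by
  unfold or Holds
  rw [eval_plus]
  omega

@[simp] theorem holds_not (a : Tm) : (not a).Holds D s ρ ↔ ¬ a.Holds D s ρ := by
  unfold not Holds
  rw [eval_cond]
  unfold Holds
  split_ifs with h <;> simp [h]

@[simp] theorem holds_lt (a b : Tm) :
    (lt a b).Holds D s ρ ↔ a.eval D s ρ < b.eval D s ρ := by
  unfold lt Holds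
  rw [eval_minus]
  omega

@[simp] theorem holds_le (a b : Tm) :
    (le a b).Holds D s ρ ↔ a.eval D s ρ ≤ b.eval D s ρ := by
  unfold le
  rw [holds_not, holds_lt, not_lt]

@[simp] theorem holds_eq (a b : Tm) :
    (eq a b).Holds D s ρ ↔ a.eval D s ρ = b.eval D s ρ := by
  unfold eq
  rw [holds_and, holds_le, holds_le]
  omega

@[simp] theorem holds_ex (x : ℕ) (t : Tm) :
    (ex x t).Holds D s ρ ↔ ∃ i < s.reg 0, t.Holds D s (Function.update ρ x i) := by
  unfold ex Holds
  rw [eval_sum, Ne, Finset.sum_eq_zero_iff]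
  simp

/-- The indices with no solution up to and including them form the initial segment before the first
solution, or the whole range if there is none. So the value `s.reg 0` stands for "not found". -/
theorem eval_least {x y : ℕ} {t : Tm} (P : ℕ → Prop)
    (h : ∀ i j, t.Holds D s (Function.update (Function.update ρ x i) y j) ↔ P j) (hxy : x ≠ y) :
    ((∃ i < s.reg 0, P i) → (least x y t).eval D s ρ < s.reg 0) ∧
      ((least x y t).eval D s ρ < s.reg 0 → P ((least x y t).eval D s ρ)) := by
  have hx : ∀ i j, Function.update (Function.update ρ x i) y j x = i := fun i j => by
    rw [Function.update_of_ne hxy, Function.update_self]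
  have hv : (least x y t).eval D s ρ =
      ((Finset.range (s.reg 0)).filter fun i => ¬ ∃ j < s.reg 0, j ≤ i ∧ P j).card := by
    unfold least
    simp [h, hx]
  rw [hv]
  by_cases hP : ∃ i < s.reg 0, P i
  · have hf := Nat.find_spec hP
    have : ((Finset.range (s.reg 0)).filter fun i => ¬ ∃ j < s.reg 0, j ≤ i ∧ P j) =
        Finset.range (Nat.find hP) := by
      ext i
      simp only [Finset.mem_filter, Finset.mem_range]
      constructor
      · rintro ⟨hi, hn⟩
        by_contra hlt
        exact hn ⟨_, hf.1, not_lt.1 hlt, hf.2⟩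
      · intro hi
        refine ⟨hi.trans hf.1, ?_⟩
        rintro ⟨j, hj, hji, hPj⟩
        exact Nat.find_min hP (lt_of_le_of_lt hji hi) ⟨hj, hPj⟩
    rw [this, Finset.card_range]
    exact ⟨fun _ => hf.1, fun _ => hf.2⟩
  · refine ⟨fun h => absurd h hP, fun hlt => ?_⟩
    rw [Finset.filter_true_of_mem, Finset.card_range] at hlt
    · exact absurd hlt (lt_irrefl _)
    · rintro i - ⟨j, hj, -, hPj⟩
      exact hP ⟨j, hj, hPj⟩

end Tm

@[simp] theorem env2_zero (n i j : ℕ) : env2 n i j 0 = i := rfl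

@[simp] theorem env2_one (n i j : ℕ) : env2 n i j 1 = j := rfl

/-- All array entries outside of the vertex range are zero. -/
def Clean (s : Store) : Prop := ∀ a i j, s.arr a i j ≠ 0 → i < s.reg 0 ∧ j < s.reg 0

theorem Clean.eq_zero {s : Store} (h : Clean s) {a i j : ℕ} (hi : s.reg 0 ≤ i) :
    s.arr a i j = 0 := by
  by_contra h0
  exact absurd (h a i j h0).1 (not_lt.2 hi)

namespace Cmd

/-- The registers to which a command writes. -/
def regs : Cmd → List ℕ
  | setR x _ => [x]
  | upd _ _ => []
  | seq P Q => P.regs ++ Q.regs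
  | ite _ P Q => P.regs ++ Q.regs
  | iter P => P.regs

/-- The arrays to which a command writes. -/
def arrs : Cmd → List ℕ
  | setR _ _ => []
  | upd a _ => [a]
  | seq P Q => P.arrs ++ Q.arrs
  | ite _ P Q => P.arrs ++ Q.arrs
  | iter P => P.arrs

theorem iterate_eq {α β : Type*} {f : α → α} {g : α → β} (h : ∀ x, g (f x) = g x) (m : ℕ) (x : α) :
    g (f^[m] x) = g x := by
  induction m with
  | zero => rfl
  | succ m ih => rw [Function.iterate_succ_apply', h, ih]

theorem eval_reg_of_notMem {x : ℕ} : ∀ (P : Cmd), x ∉ P.regs → ∀ s,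
    (P.eval D s).reg x = s.reg x := by
  intro P
  induction P with
  | setR y e =>
    intro h s
    simp only [regs, List.mem_singleton] at h
    simp [Cmd.eval, h]
  | upd a e => intro _ s; rfl
  | seq P Q hP hQ =>
    intro h s
    simp only [regs, List.mem_append, not_or] at h
    rw [Cmd.eval, hQ h.2, hP h.1]
  | ite e P Q hP hQ =>
    intro h s
    simp only [regs, List.mem_append, not_or] at h
    rw [Cmd.eval]
    split_ifs
    · exact hP h.1 s
    · exact hQ h.2 s
  | iter P hP =>
    intro h s
    exact iterate_eq (g := fun s : Store => s.reg x) (hP h) _ s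

theorem eval_arr_of_notMem {a : ℕ} : ∀ (P : Cmd), a ∉ P.arrs → ∀ s,
    (P.eval D s).arr a = s.arr a := by
  intro P
  induction P with
  | setR y e => intro _ s; rfl
  | upd b e =>
    intro h s
    simp only [arrs, List.mem_singleton] at h
    simp [Cmd.eval, h]
  | seq P Q hP hQ =>
    intro h s
    simp only [arrs, List.mem_append, not_or] at h
    rw [Cmd.eval, hQ h.2, hP h.1]
  | ite e P Q hP hQ =>
    intro h s
    simp only [arrs, List.mem_append, not_or] at h
    rw [Cmd.eval]
    split_ifs
    · exact hP h.1 s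
    · exact hQ h.2 s
  | iter P hP =>
    intro h s
    exact iterate_eq (g := fun s : Store => s.arr a) (hP h) _ s

theorem eval_clean : ∀ (P : Cmd), 0 ∉ P.regs → ∀ s, Clean s → Clean (P.eval D s) := by
  intro P
  induction P with
  | setR y e =>
    intro h s hs a i j h0
    rw [eval_reg_of_notMem _ h]
    exact hs a i j h0
  | upd b e =>
    intro h s hs a i j h0
    simp only [Cmd.eval] at h0 ⊢
    split_ifs at h0 with h1
    · exact h1.2
    · exact hs a i j h0
  | seq P Q hP hQ =>
    intro h s hs
    simp only [regs, List.mem_append, not_or] at h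
    exact hQ h.2 _ (hP h.1 s hs)
  | ite e P Q hP hQ =>
    intro h s hs
    simp only [regs, List.mem_append, not_or] at h
    rw [Cmd.eval]
    split_ifs
    · exact hP h.1 s hs
    · exact hQ h.2 s hs
  | iter P hP =>
    intro h s hs
    rw [Cmd.eval]
    generalize s.reg 0 = m
    induction m with
    | zero => exact hs
    | succ m ih => rw [Function.iterate_succ_apply']; exact hP h _ ih

@[simp] theorem eval_seq (P Q : Cmd) (s : Store) :
    (seq P Q).eval D s = Q.eval D (P.eval D s) := rfl

@[simp] theorem eval_setR_reg (x : ℕ) (e : Tm) (s : Store) (y : ℕ) :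
    ((setR x e).eval D s).reg y =
      if y = x then e.eval D s (fun _ => s.reg 0) else s.reg y := rfl

@[simp] theorem eval_setR_arr (x : ℕ) (e : Tm) (s : Store) :
    ((setR x e).eval D s).arr = s.arr := rfl

@[simp] theorem eval_upd_reg (a : ℕ) (e : Tm) (s : Store) :
    ((upd a e).eval D s).reg = s.reg := rfl

theorem eval_upd_arr_of_ne {a b : ℕ} (h : b ≠ a) (e : Tm) (s : Store) :
    ((upd a e).eval D s).arr b = s.arr b := by
  simp [Cmd.eval, h]

theorem eval_upd_arr {s : Store} (hs : Clean s) (a : ℕ) (e : Tm) (i j : ℕ) :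
    ((upd a e).eval D s).arr a i j =
      if i < s.reg 0 ∧ j < s.reg 0 then e.eval D s (env2 (s.reg 0) i j) else 0 := by
  simp only [Cmd.eval, true_and]
  split_ifs with h
  · rfl
  · by_contra h0
    exact h (hs a i j h0)

theorem eval_upd_vec {s : Store} (hs : Clean s) (a : ℕ) (e : Tm) (i : ℕ) :
    ((upd a e).eval D s).arr a i 0 =
      if i < s.reg 0 then e.eval D s (env2 (s.reg 0) i 0) else 0 := by
  rw [eval_upd_arr hs]
  congr 1
  apply propext
  exact ⟨fun h => h.1, fun h => ⟨h, by omega⟩⟩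

theorem eval_ite (e : Tm) (P Q : Cmd) (s : Store) : (ite e P Q).eval D s =
    if e.Holds D s (fun _ => s.reg 0) then P.eval D s else Q.eval D s := by
  rw [Cmd.eval]
  unfold Tm.Holds
  congr

end Cmd

end Terms

end CapCenter

namespace CapCenter

/-! ### Augmenting paths by breadth-first levels. -/

section Augment

open scoped Classical

variable {n : ℕ} {G : ℕ → ℕ → Prop} {cap M M₀ lev : ℕ → ℕ}

/-- Levels of the right vertices: a vertex of level `1` is not saturated, and from a vertex of a
higher level one gets to a lower level through a vertex that is assigned to it. -/
structure IsLevels (n : ℕ) (G : ℕ → ℕ → Prop) (cap M lev : ℕ → ℕ) : Prop where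
  one : ∀ j, lev j = 1 → load n M j < cap j
  pos : ∀ j < n, load n M j < cap j → lev j ≠ 0
  step : ∀ j, 1 < lev j → ∃ i < n, M i = j + 1 ∧ ∃ j', G i j' ∧ lev j' ≠ 0 ∧ lev j' < lev j
  closed : ∀ i < n, ∀ j < n, M i = j + 1 → lev j = 0 → ∀ j', G i j' → lev j' = 0

/-- Breadth-first search from the unsaturated vertices: a vertex first reached in round `m + 1`
receives level `m + 2`. The reached set grows within `n` vertices and, once it pauses, never grows
again; so `n` rounds reach everything. -/
theorem isLevels_of_rec (lev : ℕ → ℕ → ℕ)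
    (h0 : ∀ j, lev 0 j = if j < n ∧ load n M j < cap j then 1 else 0)
    (hs : ∀ m j, lev (m + 1) j = if j < n then if lev m j ≠ 0 then lev m j else
      if ∃ i < n, M i = j + 1 ∧ ∃ j', G i j' ∧ lev m j' ≠ 0 then m + 2 else 0 else 0) :
    IsLevels n G cap M (lev n) ∧ ∀ j, lev n j ≤ n + 1 := by
  have hlt : ∀ m j, lev m j ≠ 0 → j < n := by
    intro m j h
    cases m with
    | zero => rw [h0] at h; split_ifs at h with h'; exacts [h'.1, absurd rfl h]
    | succ m => rw [hs] at h; split_ifs at h <;> first | assumption | exact absurd rfl h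
  have hle : ∀ m j, lev m j ≤ m + 1 := by
    intro m
    induction m with
    | zero => intro j; rw [h0]; split_ifs <;> omega
    | succ m ih => intro j; have := ih j; rw [hs]; split_ifs <;> omega
  have hstay : ∀ m j, lev m j ≠ 0 → lev (m + 1) j = lev m j := by
    intro m j h
    rw [hs, if_pos (hlt m j h), if_pos h]
  have hone : ∀ m j, lev m j = 1 → load n M j < cap j := by
    intro m
    induction m with
    | zero => intro j h; rw [h0] at h; split_ifs at h with h'; exact h'.2
    | succ m ih =>
      intro j h
      by_cases hj : lev m j = 0
      · rw [hs, if_neg (not_not.2 hj)] at h; split_ifs at h; omega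
      · rw [hstay m j hj] at h; exact ih j h
  have hpos : ∀ m, ∀ j < n, load n M j < cap j → lev m j ≠ 0 := by
    intro m
    induction m with
    | zero => intro j hj h; rw [h0, if_pos ⟨hj, h⟩]; omega
    | succ m ih => intro j hj h; rw [hstay m j (ih j hj h)]; exact ih j hj h
  have hstep : ∀ m j, 1 < lev m j →
      ∃ i < n, M i = j + 1 ∧ ∃ j', G i j' ∧ lev m j' ≠ 0 ∧ lev m j' < lev m j := by
    intro m
    induction m with
    | zero => intro j h; rw [h0] at h; split_ifs at h <;> omega
    | succ m ih =>
      intro j h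
      by_cases hj : lev m j = 0
      · have h1 := h
        rw [hs, if_neg (not_not.2 hj)] at h1
        split_ifs at h1 with h2 h3
        · obtain ⟨i, hi, hij, j', hG', hj'⟩ := h3
          refine ⟨i, hi, hij, j', hG', ?_, ?_⟩
          · rw [hstay m j' hj']; exact hj'
          · rw [hstay m j' hj', hs, if_pos h2, if_neg (not_not.2 hj), if_pos ⟨i, hi, hij, j', hG', hj'⟩]
            have := hle m j'
            omega
        · omega
        · omega
      · rw [hstay m j hj] at h ⊢
        obtain ⟨i, hi, hij, j', hG', hj', hl⟩ := ih j h
        exact ⟨i, hi, hij, j', hG', by rw [hstay m j' hj']; exact hj',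
          by rw [hstay m j' hj']; exact hl⟩
  set S : ℕ → Finset ℕ := fun m => (Finset.range n).filter fun j => lev m j ≠ 0 with hS
  have hmem : ∀ m j, j ∈ S m ↔ lev m j ≠ 0 := by
    intro m j
    simp only [hS, Finset.mem_filter, Finset.mem_range]
    exact ⟨fun h => h.2, fun h => ⟨hlt m j h, h⟩⟩
  have hsub : ∀ m, S m ⊆ S (m + 1) := fun m j hj => by
    rw [hmem] at hj ⊢; rw [hstay m j hj]; exact hj
  have hnext : ∀ m, S m = S (m + 1) → S (m + 1) = S (m + 2) := by
    intro m h
    refine Finset.Subset.antisymm (hsub _) fun j hj => ?_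
    rw [hmem] at hj ⊢
    intro hj0
    have hjn := hlt _ j hj
    rw [hs, if_pos hjn, if_neg (not_not.2 hj0)] at hj
    split_ifs at hj with h3
    · obtain ⟨i, hi, hij, j', hG', hj'⟩ := h3
      rw [← hmem, ← h, hmem] at hj'
      rw [hs, if_pos hjn] at hj0
      split_ifs at hj0 with h4 h5
      · exact h4 hj0
      · exact h5 ⟨i, hi, hij, j', hG', hj'⟩
    · exact hj rfl
  have hstable : (S n).card = (S (n + 1)).card := by
    have hmono : Monotone fun m => (S m).card :=
      monotone_nat_of_le_succ fun m => Finset.card_le_card (hsub m)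
    have hb : ∀ m, (S m).card ≤ n := fun m =>
      (Finset.card_filter_le _ _).trans (Finset.card_range n).le
    have hst : ∀ m, (S m).card = (S (m + 1)).card → (S (m + 1)).card = (S (m + 2)).card :=
      fun m h => by rw [hnext m (Finset.eq_of_subset_of_card_le (hsub m) h.ge)]
    exact (Nat.stabilises_of_monotone hmono hb hst (Nat.le_succ n)).symm
  have hSn : S n = S (n + 1) := Finset.eq_of_subset_of_card_le (hsub n) hstable.ge
  refine ⟨⟨hone n, hpos n, hstep n, ?_⟩, hle n⟩
  intro i hi j hj hij hj0 j' hG'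
  by_contra hj'
  have : j ∈ S (n + 1) := by
    rw [hmem, hs, if_pos hj, if_neg (not_not.2 hj0), if_pos ⟨i, hi, hij, j', hG', hj'⟩]
    omega
  rw [← hSn, hmem] at this
  exact this hj0

/-- Unsaturated vertices have a level, so those without one are saturated; and the search being
complete, nobody assigned to them has a neighbour with a level. -/
theorem IsLevels.isTight (h : IsLevels n G cap M lev) (hG : ∀ i j, G i j → j < n)
    (hcap : ∀ j, load n M j ≤ cap j) :
    IsTight n G cap M ((Finset.range n).filter fun j => lev j = 0) := by
  refine ⟨fun j hj => ?_, fun i hi j hj hij j' hG' => ?_⟩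
  · rw [Finset.mem_filter, Finset.mem_range] at hj
    refine le_antisymm (hcap j) (not_lt.1 fun hlt => h.pos j hj.1 hlt hj.2)
  · rw [Finset.mem_filter, Finset.mem_range] at hj ⊢
    exact ⟨hG i j' hG', h.closed i hi j hj.1 hij hj.2 j' hG'⟩

theorem load_update_succ {i j : ℕ} (hi : i < n) (h0 : M i = 0) (j' : ℕ) :
    load n (Function.update M i (j + 1)) j' = load n M j' + if j' = j then 1 else 0 := by
  unfold load
  split_ifs with h
  · subst h
    have hi' : i ∉ (Finset.range n).filter fun i => M i = j' + 1 := by simp [h0]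
    rw [← Finset.card_insert_of_notMem hi']
    refine congrArg Finset.card (Finset.ext fun x => ?_)
    simp only [Finset.mem_filter, Finset.mem_range, Finset.mem_insert, Function.update_apply]
    by_cases hx : x = i
    · subst hx; simp [hi]
    · simp [hx]
  · refine (congrArg Finset.card (Finset.ext fun x => ?_)).trans (Nat.add_zero _).symm
    simp only [Finset.mem_filter, Finset.mem_range, Function.update_apply]
    by_cases hx : x = i
    · subst hx; simp [h0, Ne.symm h]
    · simp [hx]

theorem load_update_zero {i j : ℕ} (hi : i < n) (h0 : M i = j + 1) (j' : ℕ) :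
    load n (Function.update M i 0) j' + (if j' = j then 1 else 0) = load n M j' := by
  have h1 := load_update_succ (M := Function.update M i 0) (j := j) hi (by simp) j'
  rw [Function.update_idem, ← h0, Function.update_eq_self] at h1
  exact h1.symm

/-- The state of an augmentation of `M₀` at the vertex `i₀`: if `c = 0`, then it is completed, and
if `c = x + 1`, then `x` is unassigned and has a neighbour of a positive level below `l`. -/
structure IsWalk (n : ℕ) (G : ℕ → ℕ → Prop) (cap M₀ lev : ℕ → ℕ) (i₀ : ℕ) (M : ℕ → ℕ)
    (c l : ℕ) : Prop where
  assign : IsAssignment n G M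
  matched : ∀ i < n, (M i ≠ 0 ∨ c = i + 1 ↔ M₀ i ≠ 0 ∨ i = i₀)
  load_ge : ∀ j, load n M₀ j ≤ load n M j
  load_le : ∀ j, load n M j ≤ cap j
  current : ∀ x, c = x + 1 → x < n ∧ M x = 0 ∧ (∀ j, load n M j = load n M₀ j) ∧
    (∃ j, G x j ∧ lev j ≠ 0 ∧ lev j < l) ∧ ∀ i j, lev j < l → (M i = j + 1 ↔ M₀ i = j + 1)

variable {i₀ x l j : ℕ}

/-- Only here does a load increase, and level `1` guarantees room for it. -/
theorem IsWalk.finish (h : IsWalk n G cap M₀ lev i₀ M (x + 1) l) (hl : IsLevels n G cap M₀ lev)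
    (hG : G x j) (hj : lev j = 1) (l' : ℕ) :
    IsWalk n G cap M₀ lev i₀ (Function.update M x (j + 1)) 0 l' := by
  obtain ⟨hx, hx0, hload, -, -⟩ := h.current x rfl
  refine ⟨?_, ?_, ?_, ?_, by intro x hx; omega⟩
  · intro i hi j' hij
    rw [Function.update_apply] at hij
    split_ifs at hij with hix
    · subst hix
      have : j' = j := by omega
      rwa [this]
    · exact h.assign i hi j' hij
  · intro i hi
    rw [← h.matched i hi, Function.update_apply]
    split_ifs with hix
    · subst hix; simp
    · simp [Ne.symm hix]
  · intro j'
    rw [load_update_succ hx hx0, hload]; omega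
  · intro j'
    rw [load_update_succ hx hx0, hload]
    have h1 := hl.one j hj
    have h2 := h.load_le j'
    rw [hload] at h2
    split_ifs with h3
    · rw [h3]; omega
    · omega

/-- The vertex `x` takes the place of `i` at `j`, so all loads are unchanged. Only assignments to
`j` were touched, hence below the new bound `lev j` the assignment still agrees with `M₀`, for which
the levels were computed. -/
theorem IsWalk.move (h : IsWalk n G cap M₀ lev i₀ M (x + 1) l) (hG : G x j) (hjl : lev j < l)
    {i : ℕ} (hi : i < n) (hij : M i = j + 1) (hn : ∃ j', G i j' ∧ lev j' ≠ 0 ∧ lev j' < lev j) :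
    IsWalk n G cap M₀ lev i₀ (Function.update (Function.update M x (j + 1)) i 0) (i + 1)
      (lev j) := by
  obtain ⟨hx, hx0, hload, -, hsame⟩ := h.current x rfl
  have hix : i ≠ x := by rintro rfl; omega
  have hl : ∀ j', load n (Function.update (Function.update M x (j + 1)) i 0) j' =
      load n M₀ j' := by
    intro j'
    have h1 := load_update_zero (M := Function.update M x (j + 1)) (j := j) hi
      (by rw [Function.update_of_ne hix, hij]) j'
    rw [load_update_succ hx hx0, hload] at h1
    omega
  have hv : ∀ y, Function.update (Function.update M x (j + 1)) i 0 y =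
      if y = i then 0 else if y = x then j + 1 else M y := by
    intro y
    rw [Function.update_apply, Function.update_apply]
  refine ⟨?_, ?_, fun j' => (hl j').ge, fun j' => ?_, ?_⟩
  · intro y hy j' hyj
    rw [hv] at hyj
    split_ifs at hyj with h1 h2
    · subst h2
      have : j' = j := by omega
      rwa [this]
    · exact h.assign y hy j' hyj
  · intro y hy
    rw [← h.matched y hy, hv]
    split_ifs with h1 h2
    · subst h1; simp [hij]
    · subst h2; simp
    · simp [Ne.symm h1, Ne.symm h2]
  · rw [hl, ← hload]; exact h.load_le j'
  · intro y hy
    have : y = i := by omega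
    subst this
    refine ⟨hi, by rw [hv, if_pos rfl], hl, hn, fun z j' hz => ?_⟩
    rw [← hsame z j' (hz.trans hjl), hv]
    split_ifs with h1 h2
    · subst h1
      have : j ≠ j' := by rintro rfl; omega
      rw [hij]
      exact ⟨False.elim, fun h => by omega⟩
    · subst h2
      have : j ≠ j' := by rintro rfl; omega
      rw [hx0]
      constructor <;> intro h <;> omega
    · rfl

end Augment

end CapCenter

namespace CapCenter

/-! ### The program for assignments -/

section MatchProgram

open scoped Classical

local notation "aU" => 0
local notation "aAG" => 16
local notation "aCAP" => 17
local notation "aMA" => 18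
local notation "aLEV" => 19

/-- The vector in the first column of an array. -/
abbrev Store.vec (s : Store) (a i : ℕ) : ℕ := s.arr a i 0

/-- The relation given by the nonzero entries of an array. -/
abbrev Store.mat (s : Store) (a i j : ℕ) : Prop := s.arr a i j ≠ 0

open Tm Cmd

/-- One step of the computation of the levels. -/
def levelStep : Cmd :=
  seq (upd aLEV (cond (vec aLEV (var 0)) (vec aLEV (var 0))
      (cond (ex 2 (and (eq (vec aMA (var 2)) (plus (var 0) (const 1)))
        (ex 3 (and (read aAG (var 2) (var 3)) (vec aLEV (var 3))))))
        (plus (reg 12) (const 1)) (const 0))))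
    (setR 12 (plus (reg 12) (const 1)))

/-- The computation of the levels. -/
def levels : Cmd :=
  seq (upd aLEV (cond (lt (count 2 (eq (vec aMA (var 2)) (plus (var 0) (const 1))))
      (vec aCAP (var 0))) (const 1) (const 0)))
    (seq (setR 12 (const 1)) (iter levelStep))

/-- One step of an augmentation; register `13` contains the successor of the current vertex and
register `14` the current bound for the levels. -/
def walkStep : Cmd :=
  ite (reg 13)
    (seq (setR 10 (least 2 3 (and (read aAG (minus (reg 13) (const 1)) (var 3))
        (and (vec aLEV (var 3)) (lt (vec aLEV (var 3)) (reg 14))))))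
    (seq (setR 11 (least 2 3 (and (eq (vec aMA (var 3)) (plus (reg 10) (const 1)))
        (ex 4 (and (read aAG (var 3) (var 4)) (and (vec aLEV (var 4))
          (lt (vec aLEV (var 4)) (vec aLEV (reg 10)))))))))
    (seq (upd aMA (cond (and (eq (var 0) (reg 11)) (lt (const 1) (vec aLEV (reg 10)))) (const 0)
        (cond (eq (var 0) (minus (reg 13) (const 1))) (plus (reg 10) (const 1))
          (vec aMA (var 0)))))
    (seq (setR 13 (cond (lt (const 1) (vec aLEV (reg 10))) (plus (reg 11) (const 1)) (const 0)))
      (setR 14 (vec aLEV (reg 10)))))))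
    (setR 13 (const 0))

/-- The augmentation of the assignment at the vertex in register `9`. -/
def augment : Cmd :=
  seq levels
    (seq (setR 13 (cond (and (lt (reg 9) (reg 0)) (and (not (vec aMA (reg 9)))
        (ex 2 (and (read aAG (reg 9) (var 2)) (vec aLEV (var 2)))))) (plus (reg 9) (const 1))
        (const 0)))
    (seq (setR 14 (plus (reg 0) (const 2))) (seq (iter walkStep) walkStep)))

/-- Augmentation at all vertices in the order of decreasing capacities. -/
def matchAll : Cmd :=
  seq (setR 16 (const 0)) (iter
    (seq (setR 9 (least 2 3 (eq (count 4 (or (lt (vec aU (var 3)) (vec aU (var 4)))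
        (and (eq (vec aU (var 3)) (vec aU (var 4))) (lt (var 4) (var 3))))) (reg 16))))
    (seq augment (setR 16 (plus (reg 16) (const 1))))))

variable {D : ℕ → ℕ → ℕ → ℕ → Prop} {s : Store}

theorem levels_spec (hs : Clean s) :
    IsLevels (s.reg 0) (s.mat aAG) (s.vec aCAP) (s.vec aMA) ((levels.eval D s).vec aLEV) ∧
      ∀ j, (levels.eval D s).vec aLEV j ≤ s.reg 0 + 1 := by
  set s₁ := (setR 12 (const 1)).eval D ((upd aLEV (cond (lt (count 2 (eq (vec aMA (var 2))
    (plus (var 0) (const 1)))) (vec aCAP (var 0))) (const 1) (const 0))).eval D s) with hs₁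
  have hc₁ : Clean s₁ := eval_clean _ (by decide) _ (eval_clean _ (by decide) _ hs)
  set t : ℕ → Store := fun m => (levelStep.eval D)^[m] s₁ with ht
  have hsucc : ∀ m, t (m + 1) = levelStep.eval D (t m) := fun m =>
    Function.iterate_succ_apply' _ _ _
  have ha : ∀ a, a ≠ aLEV → ∀ m, (t m).arr a = s.arr a := by
    intro a h m
    refine (iterate_eq (g := fun s : Store => s.arr a)
      (eval_arr_of_notMem levelStep (by simpa [levelStep, arrs] using h)) m s₁).trans ?_
    rw [hs₁, eval_setR_arr, eval_upd_arr_of_ne h]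
  have h0 : ∀ m, (t m).reg 0 = s.reg 0 := fun m =>
    iterate_eq (g := fun s : Store => s.reg 0) (eval_reg_of_notMem levelStep (by decide)) m s₁
  have hcl : ∀ m, Clean (t m) := by
    intro m
    induction m with
    | zero => exact hc₁
    | succ m ih => rw [hsucc]; exact eval_clean _ (by decide) _ ih
  have h12 : ∀ m, (t m).reg 12 = m + 1 := by
    intro m
    induction m with
    | zero => simp [ht, hs₁]
    | succ m ih => rw [hsucc]; simp [levelStep, ih]
  refine isLevels_of_rec (lev := fun m => (t m).vec aLEV) ?_ ?_
  · intro j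
    show s₁.arr aLEV j 0 = _
    rw [hs₁, eval_setR_arr, eval_upd_vec hs]
    simp only [eval_cond, holds_lt, eval_count, holds_eq, eval_vec, eval_var, eval_plus,
      eval_const]
    by_cases hj : j < s.reg 0
    · simp [hj, load]
    · simp [hj]
  · intro m j
    show (t (m + 1)).arr aLEV j 0 = _
    rw [hsucc, levelStep, eval_seq, eval_setR_arr, eval_upd_vec (hcl m)]
    have hG' : ∀ i, (∃ j < s.reg 0, ¬ s.arr aAG i j = 0 ∧ ¬ (t m).arr aLEV j 0 = 0) ↔
        ∃ j, ¬ s.arr aAG i j = 0 ∧ ¬ (t m).arr aLEV j 0 = 0 := fun i =>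
      exists_congr fun j => ⟨fun h => h.2, fun h => ⟨(hs _ _ _ h.1).2, h⟩⟩
    simp [h0, h12, ha, hG', Store.vec]

/-- The strict decrease of the bound in register `14` is what makes the walk end. -/
theorem walkStep_spec (hs : Clean s) {i₀ : ℕ} {M₀ : ℕ → ℕ}
    (hl : IsLevels (s.reg 0) (s.mat aAG) (s.vec aCAP) M₀ (s.vec aLEV))
    (h : IsWalk (s.reg 0) (s.mat aAG) (s.vec aCAP) M₀ (s.vec aLEV) i₀ (s.vec aMA) (s.reg 13)
      (s.reg 14)) :
    IsWalk (s.reg 0) (s.mat aAG) (s.vec aCAP) M₀ (s.vec aLEV) i₀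
      ((walkStep.eval D s).vec aMA) ((walkStep.eval D s).reg 13) ((walkStep.eval D s).reg 14) ∧
    ((walkStep.eval D s).reg 13 = 0 ∨ (walkStep.eval D s).reg 14 < s.reg 14) := by
  rw [walkStep, eval_ite]
  by_cases h13 : s.reg 13 = 0
  · rw [if_neg (by simp [h13])]
    refine ⟨?_, Or.inl rfl⟩
    rw [h13] at h
    exact h
  obtain ⟨x, hx⟩ := Nat.exists_eq_succ_of_ne_zero h13
  rw [if_pos (by simp [h13])]
  rw [hx] at h
  obtain ⟨hxn, hx0, -, ⟨j₀, hj₀⟩, hsame⟩ := h.current x rfl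
  rw [eval_seq]
  set j := (least 2 3 (and (read aAG (minus (reg 13) (const 1)) (var 3))
        (and (vec aLEV (var 3)) (lt (vec aLEV (var 3)) (reg 14))))).eval D s (fun _ => s.reg 0)
    with hj
  obtain ⟨hjn, hjP⟩ := eval_least (D := D) (s := s) (ρ := fun _ => s.reg 0) (x := 2) (y := 3)
    (t := and (read aAG (minus (reg 13) (const 1)) (var 3))
        (and (vec aLEV (var 3)) (lt (vec aLEV (var 3)) (reg 14))))
    (fun j => s.mat aAG x j ∧ s.vec aLEV j ≠ 0 ∧ s.vec aLEV j < s.reg 14)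
    (by intro i j; simp [hx]) (by decide)
  rw [← hj] at hjn hjP
  obtain ⟨hG, hj0, hjl⟩ := hjP (hjn ⟨j₀, (hs _ _ _ hj₀.1).2, hj₀⟩)
  set s₁ := (setR 10 (least 2 3 (and (read aAG (minus (reg 13) (const 1)) (var 3))
        (and (vec aLEV (var 3)) (lt (vec aLEV (var 3)) (reg 14)))))).eval D s with hs₁
  have h10 : s₁.reg 10 = j := by rw [hs₁, eval_setR_reg, if_pos rfl]
  have hr₁ : ∀ r, r ≠ 10 → s₁.reg r = s.reg r := fun r hr => by
    rw [hs₁, eval_setR_reg, if_neg hr]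
  have ha₁ : s₁.arr = s.arr := rfl
  have hc₁ : Clean s₁ := eval_clean _ (by decide) _ hs
  rw [eval_seq]
  set i := (least 2 3 (and (eq (vec aMA (var 3)) (plus (reg 10) (const 1)))
        (ex 4 (and (read aAG (var 3) (var 4)) (and (vec aLEV (var 4))
          (lt (vec aLEV (var 4)) (vec aLEV (reg 10)))))))).eval D s₁ (fun _ => s₁.reg 0) with hi
  obtain ⟨hin, hiP⟩ := eval_least (D := D) (s := s₁) (ρ := fun _ => s₁.reg 0) (x := 2) (y := 3)
    (t := and (eq (vec aMA (var 3)) (plus (reg 10) (const 1)))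
        (ex 4 (and (read aAG (var 3) (var 4)) (and (vec aLEV (var 4))
          (lt (vec aLEV (var 4)) (vec aLEV (reg 10)))))))
    (fun i => s.vec aMA i = j + 1 ∧ ∃ j', s.mat aAG i j' ∧ s.vec aLEV j' ≠ 0 ∧
      s.vec aLEV j' < s.vec aLEV j)
    (by
      intro i j'
      simp only [holds_and, holds_eq, eval_vec, eval_plus, eval_var, eval_reg, eval_const,
        holds_ex, holds_read, holds_lt, h10, ha₁, holds_vec]
      simp
      intro _
      exact exists_congr fun j => ⟨fun h => h.2, fun h => ⟨by
        rw [hr₁ 0 (by decide)]; exact (hs _ _ _ h.1).2, h⟩⟩) (by decide)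
  rw [← hi, hr₁ 0 (by decide)] at hin
  rw [← hi, hr₁ 0 (by decide)] at hiP
  set s₂ := (setR 11 (least 2 3 (and (eq (vec aMA (var 3)) (plus (reg 10) (const 1)))
        (ex 4 (and (read aAG (var 3) (var 4)) (and (vec aLEV (var 4))
          (lt (vec aLEV (var 4)) (vec aLEV (reg 10))))))))).eval D s₁ with hs₂
  have h11 : s₂.reg 11 = i := by rw [hs₂, eval_setR_reg, if_pos rfl]
  have hr₂ : ∀ r, r ≠ 11 → s₂.reg r = s₁.reg r := fun r hr => by
    rw [hs₂, eval_setR_reg, if_neg hr]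
  have ha₂ : s₂.arr = s.arr := rfl
  have hc₂ : Clean s₂ := eval_clean _ (by decide) _ hc₁
  have h10' : s₂.reg 10 = j := by rw [hr₂ _ (by decide), h10]
  have h13' : s₂.reg 13 = x + 1 := by rw [hr₂ _ (by decide), hr₁ _ (by decide), hx]
  have h0' : s₂.reg 0 = s.reg 0 := by rw [hr₂ _ (by decide), hr₁ _ (by decide)]
  clear_value s₂ i j
  have hM : ∀ y, ((upd aMA (cond (and (eq (var 0) (reg 11)) (lt (const 1) (vec aLEV (reg 10))))
        (const 0) (cond (eq (var 0) (minus (reg 13) (const 1))) (plus (reg 10) (const 1))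
          (vec aMA (var 0))))).eval D s₂).arr aMA y 0 = if y < s.reg 0 then
      if y = i ∧ 1 < s.vec aLEV j then 0 else if y = x then j + 1 else s.vec aMA y else 0 := by
    intro y
    rw [eval_upd_vec hc₂]
    simp [h10', h11, h13', h0', ha₂]
  have hL : ((upd aMA (cond (and (eq (var 0) (reg 11)) (lt (const 1) (vec aLEV (reg 10))))
        (const 0) (cond (eq (var 0) (minus (reg 13) (const 1))) (plus (reg 10) (const 1))
          (vec aMA (var 0))))).eval D s₂).arr aLEV = s.arr aLEV := by
    rw [eval_upd_arr_of_ne (by decide), ha₂]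
  simp only [eval_seq, eval_setR_reg, eval_setR_arr, eval_cond, eval_vec, eval_reg, hL, holds_lt,
    eval_const, eval_plus, eval_upd_reg, h10', h11]
  by_cases h1 : 1 < s.vec aLEV j
  · obtain ⟨i', hi', hij', hn'⟩ := hl.step j h1
    obtain ⟨hij, hn⟩ := hiP (hin ⟨i', hi', (hsame i' j hjl).2 hij', hn'⟩)
    have hi : i < s.reg 0 := (hs _ _ _ (show s.arr aMA i 0 ≠ 0 by
      have : s.arr aMA i 0 = j + 1 := hij
      omega)).1
    have := h.move hG hjl hi hij hn
    refine ⟨?_, Or.inr ?_⟩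
    · convert this using 1
      · funext y
        refine (hM y).trans ?_
        rw [Function.update_apply, Function.update_apply]
        by_cases hy : y < s.reg 0
        · simp [hy, h1]
        · have hyi : y ≠ i := by omega
          have hyx : y ≠ x := by omega
          simp [hy, hyi, hyx, hs.eq_zero (not_lt.1 hy)]
      · simp [h1]
      · simp
    · simpa using hjl
  · have := h.finish hl hG (by omega) (s.vec aLEV j)
    refine ⟨?_, Or.inl (by simp [h1])⟩
    convert this using 1
    · funext y
      refine (hM y).trans ?_
      rw [Function.update_apply]
      by_cases hy : y < s.reg 0
      · simp [hy, h1]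
      · have hyx : y ≠ x := by omega
        simp [hy, hyx, hs.eq_zero (not_lt.1 hy)]
    · simp [h1]
    · simp

theorem walkStep_eval_of_zero (h : s.reg 13 = 0) : (walkStep.eval D s).arr = s.arr ∧
    (walkStep.eval D s).reg 13 = 0 := by
  rw [walkStep, eval_ite, if_neg (by simp [h])]
  exact ⟨rfl, rfl⟩

/-- What an extension `M` of the assignment `M₀` at the vertex `i₀` preserves. -/
structure IsExtension (n : ℕ) (G : ℕ → ℕ → Prop) (cap M₀ M : ℕ → ℕ) : Prop where
  assign : IsAssignment n G M
  kept : ∀ i < n, M₀ i ≠ 0 → M i ≠ 0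
  load_ge : ∀ j, load n M₀ j ≤ load n M j
  load_le : ∀ j, load n M j ≤ cap j

theorem IsExtension.trans {n : ℕ} {G : ℕ → ℕ → Prop} {cap M₀ M₁ M₂ : ℕ → ℕ}
    (h : IsExtension n G cap M₀ M₁) (h' : IsExtension n G cap M₁ M₂) :
    IsExtension n G cap M₀ M₂ :=
  ⟨h'.assign, fun i hi h0 => h'.kept i hi (h.kept i hi h0),
    fun j => (h.load_ge j).trans (h'.load_ge j), h'.load_le⟩

/-- Either the vertex in register `9` has a neighbour with a level, and the walk ends with this
vertex assigned; or all its neighbours lie in the tight set of vertices without level, and nothing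
is changed. -/
theorem augment_spec (hs : Clean s) (hM : IsAssignment (s.reg 0) (s.mat aAG) (s.vec aMA))
    (hload : ∀ j, load (s.reg 0) (s.vec aMA) j ≤ s.vec aCAP j) :
    IsExtension (s.reg 0) (s.mat aAG) (s.vec aCAP) (s.vec aMA) ((augment.eval D s).vec aMA) ∧
    (∀ i < s.reg 0, (augment.eval D s).vec aMA i ≠ 0 → s.vec aMA i ≠ 0 ∨ i = s.reg 9) ∧
    (s.reg 9 < s.reg 0 → (augment.eval D s).vec aMA (s.reg 9) = 0 →
      ∃ T, IsTight (s.reg 0) (s.mat aAG) (s.vec aCAP) ((augment.eval D s).vec aMA) T ∧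
        ∀ j, s.mat aAG (s.reg 9) j → j ∈ T) := by
  obtain ⟨hl, hle⟩ := levels_spec (D := D) hs
  have hG : ∀ i j, s.mat aAG i j → j < s.reg 0 := fun i j h => (hs _ _ _ h).2
  set s₁ := levels.eval D s with hs₁
  have ha₁ : ∀ a, a ≠ aLEV → s₁.arr a = s.arr a := fun a h =>
    eval_arr_of_notMem levels (by simpa [levels, levelStep, arrs] using h) s
  have hr₁ : ∀ r, r ≠ 12 → s₁.reg r = s.reg r := fun r h =>
    eval_reg_of_notMem levels (by simpa [levels, levelStep, regs] using h) s
  have hc₁ : Clean s₁ := eval_clean _ (by decide) _ hs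
  set c : ℕ := if (s.reg 9 < s.reg 0 ∧ s.vec aMA (s.reg 9) = 0 ∧
    ∃ j, s.mat aAG (s.reg 9) j ∧ s₁.vec aLEV j ≠ 0) then s.reg 9 + 1 else 0 with hcdef
  set s₃ := (setR 14 (plus (reg 0) (const 2))).eval D ((setR 13 (cond (and (lt (reg 9) (reg 0))
    (and (not (vec aMA (reg 9))) (ex 2 (and (read aAG (reg 9) (var 2)) (vec aLEV (var 2))))))
      (plus (reg 9) (const 1)) (const 0))).eval D s₁) with hs₃
  have hc₃ : Clean s₃ := eval_clean _ (by decide) _ (eval_clean _ (by decide) _ hc₁)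
  have ha₃ : s₃.arr = s₁.arr := rfl
  have h14 : s₃.reg 14 = s.reg 0 + 2 := by simp [hs₃, hr₁]
  have h0₃ : s₃.reg 0 = s.reg 0 := by simp [hs₃, hr₁]
  have h13 : s₃.reg 13 = c := by
    have : (∃ j < s.reg 0, ¬ s.arr aAG (s.reg 9) j = 0 ∧ ¬ s₁.arr aLEV j 0 = 0) ↔
        ∃ j, s.mat aAG (s.reg 9) j ∧ s₁.vec aLEV j ≠ 0 :=
      exists_congr fun j => ⟨fun h => h.2, fun h => ⟨hG _ _ h.1, h⟩⟩
    rw [hcdef, ← this]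
    simp [hs₃, hr₁, ha₁]
  set t : ℕ → Store := fun m => (walkStep.eval D)^[m] s₃ with ht
  have hsucc : ∀ m, t (m + 1) = walkStep.eval D (t m) := fun m =>
    Function.iterate_succ_apply' _ _ _
  have hfin : augment.eval D s = t (s.reg 0 + 1) := by
    rw [hsucc]
    simp only [augment, eval_seq, ht, ← h0₃]
    rfl
  have hat : ∀ a, a ≠ aMA → ∀ m, (t m).arr a = s₁.arr a := fun a h m =>
    (iterate_eq (g := fun s : Store => s.arr a)
      (eval_arr_of_notMem walkStep (by simpa [walkStep, arrs] using h)) m s₃).trans (by rw [ha₃])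
  have h0t : ∀ m, (t m).reg 0 = s.reg 0 := fun m =>
    (iterate_eq (g := fun s : Store => s.reg 0)
      (eval_reg_of_notMem walkStep (by decide)) m s₃).trans h0₃
  have hct : ∀ m, Clean (t m) := by
    intro m
    induction m with
    | zero => exact hc₃
    | succ m ih => rw [hsucc]; exact eval_clean _ (by decide) _ ih
  rw [hfin]
  by_cases hcond : s.reg 9 < s.reg 0 ∧ s.vec aMA (s.reg 9) = 0 ∧
    ∃ j, s.mat aAG (s.reg 9) j ∧ s₁.vec aLEV j ≠ 0
  · rw [hcdef, if_pos hcond] at h13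
    obtain ⟨h9, hM0, j, hGj, hj⟩ := hcond
    have hinv : ∀ m, IsWalk (s.reg 0) (s.mat aAG) (s.vec aCAP) (s.vec aMA) (s₁.vec aLEV)
        (s.reg 9) ((t m).vec aMA) ((t m).reg 13) ((t m).reg 14) ∧
        ((t m).reg 13 = 0 ∨ (t m).reg 14 + m ≤ s.reg 0 + 2) := by
      intro m
      induction m with
      | zero =>
        have e : (t 0).vec aMA = s.vec aMA := by
          funext y; show s₁.arr aMA y 0 = _; rw [ha₁ _ (by decide)]
        rw [e]
        show IsWalk _ _ _ _ _ _ _ (s₃.reg 13) (s₃.reg 14) ∧ (s₃.reg 13 = 0 ∨ s₃.reg 14 + 0 ≤ _)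
        rw [h13, h14]
        refine ⟨⟨hM, ?_, fun _ => le_rfl, hload, ?_⟩, Or.inr le_rfl⟩
        · intro i _
          rw [Nat.add_right_cancel_iff, eq_comm (a := s.reg 9)]
        · intro x hx
          have : x = s.reg 9 := by omega
          subst this
          refine ⟨h9, hM0, fun _ => rfl, ⟨j, hGj, hj, ?_⟩, fun _ _ _ => Iff.rfl⟩
          have := hle j
          omega
      | succ m ih =>
        have e1 : (t m).mat aAG = s.mat aAG := by
          funext i j
          simp only [Store.mat, hat aAG (by decide), ha₁ aAG (by decide)]
        have e2 : (t m).vec aCAP = s.vec aCAP := by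
          funext i
          simp only [Store.vec, hat aCAP (by decide), ha₁ aCAP (by decide)]
        have e3 : (t m).vec aLEV = s₁.vec aLEV := by
          funext i
          simp only [Store.vec, hat aLEV (by decide)]
        have := walkStep_spec (D := D) (s := t m) (hct m) (i₀ := s.reg 9) (M₀ := s.vec aMA)
          (by rw [e1, e2, e3, h0t]; exact hl) (by rw [e1, e2, e3, h0t]; exact ih.1)
        rw [e1, e2, e3, h0t, ← hsucc] at this
        refine ⟨this.1, ?_⟩
        rcases ih.2 with h | h
        · rw [hsucc]
          exact Or.inl (walkStep_eval_of_zero h).2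
        · exact this.2.imp id fun hlt => by omega
    obtain ⟨hw, hz⟩ := hinv (s.reg 0 + 1)
    -- Levels are at most `n + 1`, so the bound starts at `n + 2` and after `n + 1` steps is at most
    -- `1`. An unfinished walk would need a positive level below it.
    have hz0 : (t (s.reg 0 + 1)).reg 13 = 0 := by
      rcases hz with hz | hz
      · exact hz
      · by_contra hne
        obtain ⟨x, hx⟩ := Nat.exists_eq_succ_of_ne_zero hne
        obtain ⟨-, -, -, ⟨j', -, h1, h2⟩, -⟩ := hw.current x hx
        omega
    rw [hz0] at hw
    have hm : ∀ i < s.reg 0, ((t (s.reg 0 + 1)).vec aMA i ≠ 0 ↔ s.vec aMA i ≠ 0 ∨ i = s.reg 9) :=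
      fun i hi => by rw [← hw.matched i hi]; simp
    exact ⟨⟨hw.assign, fun i hi h => (hm i hi).2 (Or.inl h), hw.load_ge, hw.load_le⟩,
      fun i hi h => (hm i hi).1 h, fun h h' => absurd h' ((hm _ h).2 (Or.inr rfl))⟩
  · rw [hcdef, if_neg hcond] at h13
    have hinv : ∀ m, (t m).arr = s₁.arr ∧ (t m).reg 13 = 0 := by
      intro m
      induction m with
      | zero => exact ⟨ha₃, h13⟩
      | succ m ih =>
        have := walkStep_eval_of_zero (D := D) ih.2
        rw [hsucc, this.1]
        exact ⟨ih.1, this.2⟩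
    have e : (t (s.reg 0 + 1)).vec aMA = s.vec aMA := by
      funext y; rw [Store.vec, (hinv _).1, ha₁ _ (by decide)]
    rw [e]
    refine ⟨⟨hM, fun _ _ h => h, fun _ => le_rfl, hload⟩, fun _ _ h => Or.inl h, fun h9 hM0 =>
      ⟨_, hl.isTight hG hload, fun j hj => ?_⟩⟩
    rw [Finset.mem_filter, Finset.mem_range]
    refine ⟨hG _ _ hj, ?_⟩
    by_contra hlev
    exact hcond ⟨h9, hM0, j, hj, hlev⟩

/-- The position of `u` in the order of decreasing capacities. -/
noncomputable def rank (n : ℕ) (U : ℕ → ℕ) (u : ℕ) : ℕ :=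
  ((Finset.range n).filter fun y => U u < U y ∨ U u = U y ∧ y < u).card

theorem rank_lt {n : ℕ} (U : ℕ → ℕ) {u : ℕ} (hu : u < n) : rank n U u < n := by
  refine lt_of_lt_of_eq (Finset.card_lt_card ?_) (Finset.card_range n)
  refine (Finset.ssubset_iff_of_subset (Finset.filter_subset _ _)).2 ⟨u, Finset.mem_range.2 hu, ?_⟩
  simp

theorem rank_lt_rank {n : ℕ} {U : ℕ → ℕ} {u x : ℕ} (hx : x < n)
    (h : U u < U x ∨ U u = U x ∧ x < u) : rank n U x < rank n U u := by
  refine Finset.card_lt_card ((Finset.ssubset_iff_of_subset fun y hy => ?_).2 ⟨x, ?_, ?_⟩)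
  · rw [Finset.mem_filter] at hy ⊢
    exact ⟨hy.1, by omega⟩
  · rw [Finset.mem_filter, Finset.mem_range]; exact ⟨hx, h⟩
  · simp

theorem rank_injOn {n : ℕ} {U : ℕ → ℕ} {u x : ℕ} (hu : u < n) (hx : x < n)
    (h : rank n U u = rank n U x) : u = x := by
  by_contra hne
  have h1 := mt (rank_lt_rank (U := U) (u := u) hx) (by omega)
  have h2 := mt (rank_lt_rank (U := U) (u := x) hu) (by omega)
  omega

theorem le_of_rank_lt {n : ℕ} {U : ℕ → ℕ} {u x : ℕ} (hu : u < n)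
    (h : rank n U x < rank n U u) : U u ≤ U x := by
  by_contra hlt
  have := rank_lt_rank (U := U) (u := x) hu (Or.inl (not_le.1 hlt))
  omega

/-- When `u` is rejected, the occupants of its tight set were assigned at the start or treated
before `u`, hence have at least its capacity. By `IsTight.mono` the set and its occupants survive
all later augmentations. Admitting an initial assignment permits a second run that continues the
first. -/
theorem matchAll_spec (hs : Clean s) (hM : IsAssignment (s.reg 0) (s.mat aAG) (s.vec aMA))
    (hload : ∀ j, load (s.reg 0) (s.vec aMA) j ≤ s.vec aCAP j) :
    IsExtension (s.reg 0) (s.mat aAG) (s.vec aCAP) (s.vec aMA) ((matchAll.eval D s).vec aMA) ∧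
    ∀ u < s.reg 0, (matchAll.eval D s).vec aMA u = 0 →
      ∃ T, IsTight (s.reg 0) (s.mat aAG) (s.vec aCAP) ((matchAll.eval D s).vec aMA) T ∧
        (∀ j, s.mat aAG u j → j ∈ T) ∧ ∀ x < s.reg 0, ∀ j ∈ T,
          (matchAll.eval D s).vec aMA x = j + 1 → s.vec aMA x ≠ 0 ∨ s.vec aU u ≤ s.vec aU x := by
  set body : Cmd := (seq (setR 9 (least 2 3 (eq (count 4 (or (lt (vec aU (var 3)) (vec aU (var 4)))
        (and (eq (vec aU (var 3)) (vec aU (var 4))) (lt (var 4) (var 3))))) (reg 16))))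
    (seq augment (setR 16 (plus (reg 16) (const 1))))) with hbody
  set n := s.reg 0 with hn
  set t : ℕ → Store := fun m => (body.eval D)^[m] ((setR 16 (const 0)).eval D s) with ht
  have hsucc : ∀ m, t (m + 1) = body.eval D (t m) := fun m =>
    Function.iterate_succ_apply' _ _ _
  have hat : ∀ a, a ≠ aMA → a ≠ aLEV → ∀ m, (t m).arr a = s.arr a := fun a h h' m =>
    iterate_eq (g := fun s : Store => s.arr a)
      (eval_arr_of_notMem body (by
        simpa [hbody, augment, levels, levelStep, walkStep, arrs] using ⟨h', h⟩)) m _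
  have h0t : ∀ m, (t m).reg 0 = n := fun m =>
    iterate_eq (g := fun s : Store => s.reg 0) (eval_reg_of_notMem body (by decide)) m _
  have hct : ∀ m, Clean (t m) := by
    intro m
    induction m with
    | zero => exact eval_clean _ (by decide) _ hs
    | succ m ih => rw [hsucc]; exact eval_clean _ (by decide) _ ih
  have hfin : matchAll.eval D s = t n := rfl
  have hmat : ∀ m, (t m).mat aAG = s.mat aAG := fun m => by
    funext i j; simp only [Store.mat, hat aAG (by decide) (by decide)]
  have hcap : ∀ m, (t m).vec aCAP = s.vec aCAP := fun m => by
    funext i; simp only [Store.vec, hat aCAP (by decide) (by decide)]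
  have h16 : ∀ m, (t m).reg 16 = m := by
    intro m
    induction m with
    | zero => rfl
    | succ m ih =>
      rw [hsucc, hbody, eval_seq, eval_seq, eval_setR_reg, if_pos rfl, eval_plus, eval_reg,
        eval_const, eval_reg_of_notMem augment (by decide), eval_setR_reg, if_neg (by decide), ih]
  have hinv : ∀ m, IsExtension n (s.mat aAG) (s.vec aCAP) (s.vec aMA) ((t m).vec aMA) ∧
      (∀ x < n, (t m).vec aMA x ≠ 0 → s.vec aMA x ≠ 0 ∨ rank n (s.vec aU) x < m) ∧
      ∀ u < n, rank n (s.vec aU) u < m → (t m).vec aMA u = 0 →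
        ∃ T, IsTight n (s.mat aAG) (s.vec aCAP) ((t m).vec aMA) T ∧
          (∀ j, s.mat aAG u j → j ∈ T) ∧ ∀ x < n, ∀ j ∈ T,
            (t m).vec aMA x = j + 1 → s.vec aMA x ≠ 0 ∨ s.vec aU u ≤ s.vec aU x := by
    intro m
    induction m with
    | zero =>
      exact ⟨⟨hM, fun _ _ h => h, fun _ => le_rfl, hload⟩, fun _ _ h => Or.inl h,
        fun _ _ h => absurd h (Nat.not_lt_zero _)⟩
    | succ m ih =>
      obtain ⟨hext, hold, hrej⟩ := ih
      set i₀ := (least 2 3 (eq (count 4 (or (lt (vec aU (var 3)) (vec aU (var 4)))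
        (and (eq (vec aU (var 3)) (vec aU (var 4))) (lt (var 4) (var 3))))) (reg 16))).eval D (t m)
        (fun _ => (t m).reg 0) with hi₀
      obtain ⟨hex, hi₀m⟩ := eval_least (D := D) (s := t m) (ρ := fun _ => (t m).reg 0) (x := 2)
        (y := 3) (t := eq (count 4 (or (lt (vec aU (var 3)) (vec aU (var 4)))
          (and (eq (vec aU (var 3)) (vec aU (var 4))) (lt (var 4) (var 3))))) (reg 16))
        (fun u => rank n (s.vec aU) u = m) (by
          intro i j
          simp [h16, rank, h0t, hat]) (by decide)
      rw [← hi₀, h0t] at hi₀m hex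
      set s₁ := (setR 9 (least 2 3 (eq (count 4 (or (lt (vec aU (var 3)) (vec aU (var 4)))
        (and (eq (vec aU (var 3)) (vec aU (var 4))) (lt (var 4) (var 3))))) (reg 16)))).eval D (t m)
        with hs₁
      have e0 : s₁.reg 0 = n := (h0t m)
      have e9 : s₁.reg 9 = i₀ := rfl
      have e1 : s₁.mat aAG = s.mat aAG := hmat m
      have e2 : s₁.vec aCAP = s.vec aCAP := hcap m
      have e3 : s₁.vec aMA = (t m).vec aMA := rfl
      have e4 : (t (m + 1)).vec aMA = (augment.eval D s₁).vec aMA := by rw [hsucc]; rfl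
      obtain ⟨hext', hold', hrej'⟩ := augment_spec (D := D) (s := s₁) (eval_clean _ (by decide) _ (hct m))
        (by rw [e0, e1, e3]; exact hext.assign) (by rw [e0, e2, e3]; exact hext.load_le)
      rw [e0, e1, e2, e3, ← e4] at hext'
      rw [e0, e3, e9, ← e4] at hold'
      rw [e0, e1, e2, e9, ← e4] at hrej'
      clear_value i₀
      have hold₂ : ∀ x < n, (t (m + 1)).vec aMA x ≠ 0 →
          s.vec aMA x ≠ 0 ∨ rank n (s.vec aU) x < m + 1 := by
        intro x hx h
        rcases hold' x hx h with h | rfl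
        · exact (hold x hx h).imp id fun h => by omega
        · exact Or.inr (by rw [hi₀m hx]; omega)
      refine ⟨hext.trans hext', hold₂, fun u hu hum hu0 => ?_⟩
      rcases Nat.lt_succ_iff_lt_or_eq.1 hum with hlt | heq
      · have hu0' : (t m).vec aMA u = 0 := by
          by_contra h
          exact hext'.kept u hu h hu0
        obtain ⟨T, hT, hGT, hUT⟩ := hrej u hu hlt hu0'
        obtain ⟨hT', hback⟩ := hT.mono hext'.assign hext'.load_le hext'.kept
        refine ⟨T, hT', hGT, fun x hx j hj hxj => ?_⟩
        obtain ⟨j', hj', hxj'⟩ := hback x hx j hj hxj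
        exact hUT x hx j' hj' hxj'
      · have hi₀n := hex ⟨u, hu, heq⟩
        have hui : u = i₀ := rank_injOn hu hi₀n (heq.trans (hi₀m hi₀n).symm)
        subst hui
        obtain ⟨T, hT, hGT⟩ := hrej' hu hu0
        refine ⟨T, hT, hGT, fun x hx j hj hxj => ?_⟩
        rcases hold₂ x hx (by omega) with h | h
        · exact Or.inl h
        · right
          rcases Nat.lt_succ_iff_lt_or_eq.1 h with h | h
          · exact le_of_rank_lt hu (by omega)
          · rw [rank_injOn hx hu (h.trans heq.symm)]
  rw [hfin]
  obtain ⟨h1, -, h3⟩ := hinv n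
  exact ⟨h1, fun u hu hu0 => h3 u hu (rank_lt _ hu) hu0⟩

end MatchProgram

end CapCenter

namespace CapCenter

/-! ### Invariants for the selection of core centers and for the flow of clients. -/

section CoreStage

open scoped Classical

variable {n L m : ℕ} {adj : ℕ → ℕ → Prop} {A : ℕ → Prop} {core par own rem cap : ℕ → ℕ}

/-- The state of the selection of core centers after `m` steps. -/
structure IsCoreStage (n : ℕ) (adj : ℕ → ℕ → Prop) (A : ℕ → Prop) (core par : ℕ → ℕ) (m : ℕ) :
    Prop where
  le : ∀ c, core c ≤ m
  allowed : ∀ c, core c ≠ 0 → A c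
  inj : ∀ c c', core c ≠ 0 → core c = core c' → c = c'
  sep : ∀ c c', core c ≠ 0 → core c' ≠ 0 → Hops adj 2 c c' → c = c'
  par_spec : ∀ c q, core c ≠ 0 → par c = q + 1 → core q ≠ 0 ∧ core q < core c ∧ Hops adj 4 c q
  root_sep : ∀ c x, core c ≠ 0 → par c = 0 → A x →
    (∀ c', core c' ≠ 0 → core c' < core c → ¬ Hops adj 2 x c') →
    ∀ c', core c' ≠ 0 → core c' < core c → ¬ Hops adj 4 x c'
  progress : m ≤ ((Finset.range n).filter fun c => core c ≠ 0).card ∨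
    ∀ u, A u → ∃ c, core c ≠ 0 ∧ Hops adj 2 u c

theorem isCoreStage_zero : IsCoreStage n adj A (fun _ => 0) par 0 :=
  ⟨fun _ => le_rfl, fun _ h => absurd rfl h, fun _ _ h => absurd rfl h,
    fun _ _ h => absurd rfl h, fun _ _ h => absurd rfl h, fun _ _ h => absurd rfl h,
    Or.inl (Nat.zero_le _)⟩

theorem IsCoreStage.succ_of_covered (h : IsCoreStage n adj A core par m)
    (hc : ∀ u, A u → ∃ c, core c ≠ 0 ∧ Hops adj 2 u c) : IsCoreStage n adj A core par (m + 1) :=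
  ⟨fun c => (h.le c).trans (Nat.le_succ m), h.allowed, h.inj, h.sep, h.par_spec, h.root_sep,
    Or.inr hc⟩

/-- For older roots `root_sep` mentions only core centers before them, so the newcomer is
irrelevant. If `x` itself becomes a root, then `y` is no vertex, so no core center is within four
hops of `x`; then, by the preference expressed in `hx4`, the same holds for every uncovered allowed
vertex. -/
theorem IsCoreStage.add (h : IsCoreStage n adj A core par m) (hadj : IsReflGraph n adj)
    {x y : ℕ} (hx : x < n) (hxA : A x) (hx2 : ∀ c, core c ≠ 0 → ¬ Hops adj 2 x c)
    (hx4 : (∃ c, core c ≠ 0 ∧ Hops adj 4 x c) ∨ ∀ x', A x' →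
      (∀ c, core c ≠ 0 → ¬ Hops adj 2 x' c) → ∀ c, core c ≠ 0 → ¬ Hops adj 4 x' c)
    (hy : (∃ c, core c ≠ 0 ∧ Hops adj 4 x c) → y < n)
    (hy' : y < n → core y ≠ 0 ∧ Hops adj 4 x y) :
    IsCoreStage n adj A (Function.update core x (m + 1))
      (Function.update par x (if y < n then y + 1 else 0)) (m + 1) := by
  have hx0 : core x = 0 := by
    by_contra h0
    exact hx2 x h0 ⟨x, hadj.refl x hx, x, hadj.refl x hx, rfl⟩
  have hc : ∀ c, Function.update core x (m + 1) c = if c = x then m + 1 else core c :=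
    fun c => Function.update_apply _ _ _ _
  have hne : ∀ c, core c ≠ 0 → c ≠ x := fun c h0 hcx => h0 (hcx ▸ hx0)
  have hold : ∀ c, core c ≠ 0 → Function.update core x (m + 1) c = core c := fun c h0 => by
    rw [hc, if_neg (hne c h0)]
  refine ⟨?_, ?_, ?_, ?_, ?_, ?_, ?_⟩
  · intro c
    have := h.le c
    rw [hc]; split_ifs <;> omega
  · intro c h0
    rw [hc] at h0
    split_ifs at h0 with hcx
    · rwa [hcx]
    · exact h.allowed c h0
  · intro c c' h0 he
    have h1 := h.le c
    have h2 := h.le c'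
    rw [hc] at h0
    rw [hc, hc] at he
    split_ifs at h0 he with h3 h4 h5
    · rw [h3, h4]
    · omega
    · omega
    · exact h.inj c c' h0 he
  · intro c c' h0 h0' h2
    rw [hc] at h0 h0'
    split_ifs at h0 h0' with h3 h4 h5
    · rw [h3, h4]
    · subst h3; exact absurd h2 (hx2 c' h0')
    · subst h5; exact absurd (h2.symm hadj) (hx2 c h0)
    · exact h.sep c c' h0 h0' h2
  · intro c q h0 hp
    rw [Function.update_apply] at hp
    by_cases hcx : c = x
    · subst hcx
      rw [if_pos rfl] at hp
      split_ifs at hp with hyn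
      · have : y = q := by omega
        subst this
        obtain ⟨h1, h2⟩ := hy' hyn
        refine ⟨by rwa [hold y h1], ?_, h2⟩
        rw [hold y h1, Function.update_self]
        exact Nat.lt_succ_of_le (h.le y)
    · rw [if_neg hcx] at hp
      rw [hc, if_neg hcx] at h0
      obtain ⟨h1, h2, h3⟩ := h.par_spec c q h0 hp
      rw [hold c h0, hold q h1]
      exact ⟨h1, h2, h3⟩
  · intro c z h0 hp hz hz2 c' h0' hlt
    have key : ∀ d, core d ≠ 0 → core d < Function.update core x (m + 1) c →
        ¬ Hops adj 2 z d := fun d hd hdl => hz2 d (by rwa [hold d hd]) (by rwa [hold d hd])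
    have hc'x : c' ≠ x := by
      rintro rfl
      have := h.le c
      rw [Function.update_self, hc] at hlt
      split_ifs at hlt <;> omega
    rw [hc, if_neg hc'x] at h0'
    rw [hold c' h0'] at hlt
    by_cases hcx : c = x
    · subst hcx
      rw [Function.update_self] at hp hlt key
      have hyn : ¬ y < n := fun hyn => by rw [if_pos hyn] at hp; omega
      rcases hx4 with h4 | h4
      · exact absurd (hy h4) hyn
      · exact h4 z hz (fun d hd => key d hd (Nat.lt_succ_of_le (h.le d))) c' h0'
    · rw [hc, if_neg hcx] at h0 hlt key
      rw [Function.update_of_ne hcx] at hp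
      exact h.root_sep c z h0 hp hz key c' h0' hlt
  · rcases h.progress with hp | hp
    · left
      refine Nat.succ_le_of_lt (hp.trans_lt (Finset.card_lt_card
        ((Finset.ssubset_iff_of_subset fun c hcm => ?_).2 ⟨x, ?_, ?_⟩)))
      · rw [Finset.mem_filter] at hcm ⊢
        exact ⟨hcm.1, by rw [hold c hcm.2]; exact hcm.2⟩
      · rw [Finset.mem_filter, Finset.mem_range]
        exact ⟨hx, by rw [Function.update_self]; omega⟩
      · rw [Finset.mem_filter]; exact fun h => h.2 hx0
    · obtain ⟨c, h0, h2⟩ := hp x hxA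
      exact absurd h2 (hx2 c h0)

/-- If each of the `n` steps has added a core center, then every vertex is one and covers itself
through its loop. -/
theorem IsCoreStage.cover (h : IsCoreStage n adj A core par n) (hadj : IsReflGraph n adj)
    (hA : ∀ u, A u → u < n) (u : ℕ) (hu : A u) : ∃ c, core c ≠ 0 ∧ Hops adj 2 u c := by
  rcases h.progress with hp | hp
  · have heq := Finset.eq_of_subset_of_card_le (Finset.filter_subset (fun c => core c ≠ 0)
      (Finset.range n)) (by rwa [Finset.card_range])
    have : u ∈ Finset.range n := Finset.mem_range.2 (hA u hu)
    rw [← heq, Finset.mem_filter] at this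
    exact ⟨u, this.2, u, hadj.refl u (hA u hu), u, hadj.refl u (hA u hu), rfl⟩
  · exact hp u hu

/-- The clients that are available at the core center `c`. -/
noncomputable def avail (n : ℕ) (core par own rem : ℕ → ℕ) (c : ℕ) : ℕ :=
  load n own c + ∑ c' ∈ (Finset.range n).filter (fun c' => core c' ≠ 0 ∧ par c' = c + 1), rem c'

/-- All data of a system of core centers but the flow of the clients. -/
structure IsCoreBase (n : ℕ) (adj : ℕ → ℕ → Prop) (A : ℕ → Prop) (core par own : ℕ → ℕ) :
    Prop where
  stage : IsCoreStage n adj A core par n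
  own_spec : ∀ v c, own v = c + 1 → core c ≠ 0 ∧ ∃ u, A u ∧ adj v u ∧ Hops adj 2 u c
  own_adj : ∀ v c, core c ≠ 0 → adj v c → own v = c + 1
  own_ne : ∀ v u, A u → adj v u → own v ≠ 0

/-- The state of the computation of the flow of the clients: it is correct for the core centers
after position `t`. -/
structure IsFlowStage (n L : ℕ) (core par own rem cap : ℕ → ℕ) (t : ℕ) : Prop where
  rem_lt : ∀ c, core c ≠ 0 → rem c < L
  flow : ∀ c, t < core c → avail n core par own rem c = L * cap c + rem c

/-- A remainder is smaller than the number of neighbours of its core center, which are all attached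
to it. So the remainders of the children are bounded by disjoint sets of clients. The bound `n` is
what makes division by counting possible. -/
theorem IsCoreBase.avail_le {U : ℕ → ℕ}
    (h : IsCoreBase n adj (Allowed n L adj U) core par own) (hadj : IsReflGraph n adj)
    (hrem : ∀ c, core c ≠ 0 → rem c < L) (c : ℕ) :
    avail n core par own rem c ≤ n := by
  set K := (Finset.range n).filter (fun c' => core c' ≠ 0 ∧ par c' = c + 1) with hK
  have hcK : c ∉ K := by
    rw [hK, Finset.mem_filter]
    rintro ⟨-, h0, hp⟩
    exact absurd (h.stage.par_spec c c h0 hp).2.1 (lt_irrefl _)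
  have h1 : ∑ c' ∈ K, rem c' ≤ ∑ c' ∈ K, load n own c' := by
    refine Finset.sum_le_sum fun c' hc' => ?_
    rw [hK, Finset.mem_filter] at hc'
    refine (hrem c' hc'.2.1).le.trans ((h.stage.allowed c' hc'.2.1).2.1.trans ?_)
    refine Finset.card_le_card fun v hv => ?_
    rw [Finset.mem_filter] at hv ⊢
    exact ⟨hv.1, h.own_adj v c' hc'.2.1 (hadj.symm _ _ hv.2)⟩
  have h2 := Finset.sum_insert (f := fun j => load n own j) hcK
  have h3 : ∑ j ∈ insert c K, load n own j ≤ n := by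
    rw [sum_load]
    exact (Finset.card_filter_le _ _).trans (Finset.card_range n).le
  unfold avail
  rw [← hK]
  omega

/-- Children come after their parents, so the new remainder at position `m + 1` does not enter the
numbers available at this or any later position. -/
theorem IsFlowStage.next (hL : 0 < L) (h : IsFlowStage n L core par own rem cap (m + 1))
    (hpar : ∀ c q, core c ≠ 0 → par c = q + 1 → core q < core c) :
    IsFlowStage n L core par own
      (fun c => if core c = m + 1 then avail n core par own rem c % L else rem c)
      (fun c => if core c = m + 1 then avail n core par own rem c / L else cap c) m := by
  refine ⟨fun c hc => ?_, fun c hc => ?_⟩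
  · show (if _ then _ else _) < L
    split_ifs
    · exact Nat.mod_lt _ hL
    · exact h.rem_lt c hc
  · have hch : avail n core par own
        (fun c => if core c = m + 1 then avail n core par own rem c % L else rem c) c =
        avail n core par own rem c := by
      unfold avail
      congr 1
      refine Finset.sum_congr rfl fun c' hc' => ?_
      rw [Finset.mem_filter] at hc'
      have := hpar c' c hc'.2.1 hc'.2.2
      exact if_neg (by omega)
    rw [hch]
    show _ = L * (if _ then _ else _) + (if _ then _ else _)
    split_ifs with h1
    · exact (Nat.div_add_mod _ _).symm
    · exact h.flow c (by omega)

theorem IsCoreBase.coreSystem {U : ℕ → ℕ}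
    (h : IsCoreBase n adj (Allowed n L adj U) core par own) (hadj : IsReflGraph n adj)
    (hf : IsFlowStage n L core par own rem cap 0) :
    CoreSystem n L adj (Allowed n L adj U) core par own rem cap where
  allowed := h.stage.allowed
  inj := h.stage.inj
  sep c c' v hc hc' h1 h2 :=
    h.stage.sep c c' hc hc' ⟨v, h1, hops_one.2 (hadj.symm _ _ h2)⟩
  cover := h.stage.cover hadj fun _ hu => hu.1
  par_spec := h.stage.par_spec
  root_sep := h.stage.root_sep
  own_spec := h.own_spec
  own_adj := h.own_adj
  own_ne := h.own_ne
  rem_lt := hf.rem_lt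
  flow c hc := hf.flow c (Nat.pos_of_ne_zero hc)

/-- Without a division instruction, the quotient is found by counting the positive multiples of `L`
up to `t`; the quotient is at most `n`, so the range below `n` contains enough of them. -/
theorem card_mul_le {t : ℕ} (hL : 0 < L) (ht : t ≤ n) :
    ((Finset.range n).filter fun j => (j + 1) * L ≤ t).card = t / L := by
  have : (Finset.range n).filter (fun j => (j + 1) * L ≤ t) = Finset.range (t / L) := by
    ext j
    rw [Finset.mem_filter, Finset.mem_range, Finset.mem_range, ← Nat.le_div_iff_mul_le hL]
    have := Nat.div_le_self t L
    omega
  rw [this, Finset.card_range]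

theorem sum_range_ite_lt (n q L : ℕ) (hq : q ≤ n) :
    (∑ j ∈ Finset.range n, if j < q then L else 0) = q * L := by
  rw [← Finset.sum_filter, Finset.sum_const, smul_eq_mul]
  congr 1
  have : (Finset.range n).filter (fun j => j < q) = Finset.range q := by
    ext j
    rw [Finset.mem_filter, Finset.mem_range, Finset.mem_range]
    omega
  rw [this, Finset.card_range]

end CoreStage

end CapCenter

namespace CapCenter

/-! ### The program for core centers -/

section CoreProgram

open scoped Classical

local notation "aU" => 0
local notation "aADJ" => 4
local notation "aH2" => 5
local notation "aH4" => 6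
local notation "aH11" => 9
local notation "aAA" => 10
local notation "aCORE" => 11
local notation "aPAR" => 12
local notation "aOWN" => 13
local notation "aREM" => 14
local notation "aTT" => 15
local notation "aAG" => 16
local notation "aCAP" => 17
local notation "aQQ" => 21

open Tm Cmd

/-- The composition of two relations. -/
def compose (a b c : ℕ) : Cmd :=
  upd a (ex 2 (and (read b (var 0) (var 2)) (read c (var 2) (var 1))))

/-- The threshold graph for the pair of vertices in the registers `3` and `4`, its powers, and the
vertices that may be opened. Register `5` is the lower bound, but at least one. -/
def initGraph : Cmd :=
  seq (setR 5 (plus (reg 1) (minus (const 1) (reg 1))))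
  (seq (upd aADJ (dle (var 0) (var 1) (reg 3) (reg 4)))
  (seq (compose aH2 aADJ aADJ)
  (seq (compose aH4 aH2 aH2)
  (seq (compose aH11 aH4 aH4)
  (seq (compose aH11 aH11 aH2)
  (seq (compose aH11 aH11 aADJ)
    (upd aAA (and (le (reg 5) (count 2 (read aADJ (var 0) (var 2))))
      (le (reg 5) (vec aU (var 0)))))))))))

/-- No core center is within two hops of the vertex in variable `3`. -/
def uncovered : Tm :=
  and (vec aAA (var 3)) (not (ex 4 (and (vec aCORE (var 4)) (read aH2 (var 3) (var 4)))))

/-- The selection of a core center. -/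
def coreStep : Cmd :=
  seq (setR 10 (least 2 3 (and uncovered
    (ex 4 (and (vec aCORE (var 4)) (read aH4 (var 3) (var 4)))))))
  (seq (setR 10 (cond (lt (reg 10) (reg 0)) (reg 10) (least 2 3 uncovered)))
  (seq (setR 11 (least 2 3 (and (vec aCORE (var 3)) (read aH4 (reg 10) (var 3)))))
  (seq (setR 12 (plus (reg 12) (const 1)))
  (seq (upd aPAR (cond (eq (var 0) (reg 10))
      (cond (lt (reg 11) (reg 0)) (plus (reg 11) (const 1)) (const 0)) (vec aPAR (var 0))))
    (upd aCORE (cond (eq (var 0) (reg 10)) (reg 12) (vec aCORE (var 0))))))))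

/-- The selection of all core centers. -/
def selectCores : Cmd :=
  seq (upd aCORE (const 0)) (seq (upd aPAR (const 0)) (seq (setR 12 (const 0)) (iter coreStep)))

/-- The core centers to which the clients are attached. -/
def attach : Cmd :=
  upd aOWN (cond
    (lt (least 2 3 (and (vec aCORE (var 3)) (read aADJ (var 0) (var 3)))) (reg 0))
    (plus (least 2 3 (and (vec aCORE (var 3)) (read aADJ (var 0) (var 3)))) (const 1))
    (cond
      (lt (least 2 3 (and (vec aCORE (var 3)) (ex 4 (and (vec aAA (var 4))
        (and (read aADJ (var 0) (var 4)) (read aH2 (var 4) (var 3))))))) (reg 0))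
      (plus (least 2 3 (and (vec aCORE (var 3)) (ex 4 (and (vec aAA (var 4))
        (and (read aADJ (var 0) (var 4)) (read aH2 (var 4) (var 3))))))) (const 1))
      (const 0)))

/-- The flow of the clients at the core center whose position is in register `12`. -/
def flowStep : Cmd :=
  seq (upd aTT (plus (count 2 (eq (vec aOWN (var 2)) (plus (var 0) (const 1))))
    (sum 2 (cond (and (vec aCORE (var 2)) (eq (vec aPAR (var 2)) (plus (var 0) (const 1))))
      (vec aREM (var 2)) (const 0)))))
  (seq (upd aQQ (count 2 (le (sum 3 (cond (lt (var 3) (plus (var 2) (const 1))) (reg 5) (const 0)))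
    (vec aTT (var 0)))))
  (seq (upd aREM (cond (eq (vec aCORE (var 0)) (reg 12))
    (minus (vec aTT (var 0)) (sum 2 (cond (lt (var 2) (vec aQQ (var 0))) (reg 5) (const 0))))
    (vec aREM (var 0))))
  (seq (upd aCAP (cond (eq (vec aCORE (var 0)) (reg 12)) (vec aQQ (var 0)) (vec aCAP (var 0))))
    (setR 12 (minus (reg 12) (const 1))))))

/-- The flow of the clients. -/
def flows : Cmd :=
  seq (upd aREM (const 0)) (seq (upd aCAP (const 0)) (seq (setR 12 (reg 0)) (iter flowStep)))

/-- The bipartite graph of possible centers and core centers. -/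
def reachGraph : Cmd :=
  upd aAG (and (vec aAA (var 0)) (and (vec aCORE (var 1)) (ex 2 (and (read aADJ (var 0) (var 2))
    (or (eq (vec aOWN (var 2)) (plus (var 1) (const 1)))
      (ex 3 (and (vec aCORE (var 3)) (and (read aADJ (var 2) (var 3))
        (eq (vec aPAR (var 3)) (plus (var 1) (const 1)))))))))))

variable {D : ℕ → ℕ → ℕ → ℕ → Prop} {s : Store} {n L : ℕ} {adj : ℕ → ℕ → Prop} {U : ℕ → ℕ}

theorem Clean.exists_iff (hs : Clean s) {a i : ℕ} {P : ℕ → Prop} :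
    (∃ j < s.reg 0, s.arr a i j ≠ 0 ∧ P j) ↔ ∃ j, s.arr a i j ≠ 0 ∧ P j :=
  exists_congr fun _ => ⟨fun h => h.2, fun h => ⟨(hs _ _ _ h.1).2, h⟩⟩

/-- Since updates are simultaneous, the target `a` may coincide with `b` or `c`. -/
theorem compose_spec (hs : Clean s) (a b c : ℕ) {p q : ℕ}
    (hb : ∀ i j, i < s.reg 0 → (s.mat b i j ↔ Hops adj p i j))
    (hc : ∀ i j, i < s.reg 0 → (s.mat c i j ↔ Hops adj q i j)) (i j : ℕ) (hi : i < s.reg 0) :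
    ((compose a b c).eval D s).mat a i j ↔ Hops adj (p + q) i j := by
  have key : (∃ w, s.mat b i w ∧ s.mat c w j) ↔ Hops adj (p + q) i j := by
    rw [hops_add]
    refine exists_congr fun w => ⟨fun h => ⟨(hb i w hi).1 h.1, (hc w j (hs _ _ _ h.1).2).1 h.2⟩,
      fun h => ?_⟩
    have h1 := (hb i w hi).2 h.1
    exact ⟨h1, (hc w j (hs _ _ _ h1).2).2 h.2⟩
  rw [← key, ← hs.exists_iff]
  show (compose a b c |>.eval D s).arr a i j ≠ 0 ↔ _
  rw [compose, eval_upd_arr hs]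
  by_cases hj : j < s.reg 0
  · rw [if_pos ⟨hi, hj⟩]
    show Tm.Holds _ _ _ _ ↔ _
    simp
  · rw [if_neg (fun h => hj h.2)]
    refine ⟨fun h => absurd rfl h, fun ⟨w, _, _, h⟩ => absurd (hs _ _ _ h).2 hj⟩

/-- The memory contains the threshold graph. -/
structure HasGraph (s : Store) (n L : ℕ) (adj : ℕ → ℕ → Prop) (U : ℕ → ℕ) : Prop where
  clean : Clean s
  size : s.reg 0 = n
  low : s.reg 5 = L
  graph : ∀ i j, s.mat aADJ i j ↔ adj i j
  hops2 : ∀ i j, i < n → (s.mat aH2 i j ↔ Hops adj 2 i j)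
  hops4 : ∀ i j, i < n → (s.mat aH4 i j ↔ Hops adj 4 i j)
  hops11 : ∀ i j, i < n → (s.mat aH11 i j ↔ Hops adj 11 i j)
  allowed : ∀ u, s.vec aAA u ≠ 0 ↔ Allowed n L adj U u

theorem HasGraph.congr {s' : Store} (h : HasGraph s n L adj U) (hc : Clean s')
    (h0 : s'.reg 0 = s.reg 0) (h5 : s'.reg 5 = s.reg 5)
    (ha : ∀ a ∈ [aADJ, aH2, aH4, aH11, aAA], s'.arr a = s.arr a) : HasGraph s' n L adj U := by
  have e4 := ha aADJ (by decide)
  have e5 := ha aH2 (by decide)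
  have e6 := ha aH4 (by decide)
  have e9 := ha aH11 (by decide)
  have e10 := ha aAA (by decide)
  refine ⟨hc, h0.trans h.size, h5.trans h.low, ?_, ?_, ?_, ?_, ?_⟩
  · simpa only [Store.mat, e4] using h.graph
  · simpa only [Store.mat, e5] using h.hops2
  · simpa only [Store.mat, e6] using h.hops4
  · simpa only [Store.mat, e9] using h.hops11
  · simpa only [Store.vec, e10] using h.allowed

theorem HasGraph.eval (P : Cmd) (h0 : 0 ∉ P.regs) (h5 : 5 ∉ P.regs)
    (ha : ∀ a ∈ [aADJ, aH2, aH4, aH11, aAA], a ∉ P.arrs) (h : HasGraph s n L adj U) :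
    HasGraph (P.eval D s) n L adj U :=
  h.congr (eval_clean P h0 s h.clean) (eval_reg_of_notMem P h0 s) (eval_reg_of_notMem P h5 s)
    fun a h => eval_arr_of_notMem P (ha a h) s

theorem initGraph_spec (hs : Clean s)
    (hD : ∀ i j, D i j (s.reg 3) (s.reg 4) → i < s.reg 0 ∧ j < s.reg 0) :
    HasGraph (initGraph.eval D s) (s.reg 0) (s.reg 1 + (1 - s.reg 1))
      (fun i j => D i j (s.reg 3) (s.reg 4)) (s.vec aU) := by
  set adj : ℕ → ℕ → Prop := fun i j => D i j (s.reg 3) (s.reg 4) with hadj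
  set s₁ := (setR 5 (plus (reg 1) (minus (const 1) (reg 1)))).eval D s with hs₁
  have c₁ : Clean s₁ := eval_clean _ (by decide) _ hs
  set s₂ := (upd aADJ (dle (var 0) (var 1) (reg 3) (reg 4))).eval D s₁ with hs₂
  have c₂ : Clean s₂ := eval_clean _ (by decide) _ c₁
  set s₃ := (compose aH2 aADJ aADJ).eval D s₂ with hs₃
  have c₃ : Clean s₃ := eval_clean _ (by decide) _ c₂
  set s₄ := (compose aH4 aH2 aH2).eval D s₃ with hs₄
  have c₄ : Clean s₄ := eval_clean _ (by decide) _ c₃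
  set s₅ := (compose aH11 aH4 aH4).eval D s₄ with hs₅
  have c₅ : Clean s₅ := eval_clean _ (by decide) _ c₄
  set s₆ := (compose aH11 aH11 aH2).eval D s₅ with hs₆
  have c₆ : Clean s₆ := eval_clean _ (by decide) _ c₅
  set s₇ := (compose aH11 aH11 aADJ).eval D s₆ with hs₇
  have c₇ : Clean s₇ := eval_clean _ (by decide) _ c₆
  have hreg : ∀ r, s₇.reg r = s₁.reg r := fun _ => rfl
  have h0 : s₁.reg 0 = s.reg 0 := rfl
  have g₂ : ∀ i j, s₂.mat aADJ i j ↔ adj i j := by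
    intro i j
    show s₂.arr aADJ i j ≠ 0 ↔ _
    rw [hs₂, eval_upd_arr c₁, h0]
    by_cases hij : i < s.reg 0 ∧ j < s.reg 0
    · rw [if_pos hij]
      show Tm.Holds _ _ _ _ ↔ _
      rw [holds_dle]
      exact Iff.rfl
    · rw [if_neg hij]
      exact ⟨fun h => absurd rfl h, fun h => absurd (hD i j h) hij⟩
  have ne : ∀ {a b c x : ℕ} (t : Store), x ≠ a → ((compose a b c).eval D t).arr x = t.arr x :=
    fun t h => eval_upd_arr_of_ne h _ _
  have g1₂ : ∀ i j, i < s.reg 0 → (s₂.mat aADJ i j ↔ Hops adj 1 i j) := fun i j _ => by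
    rw [g₂, hops_one]
  have g₃ : ∀ i j, i < s.reg 0 → (s₃.mat aH2 i j ↔ Hops adj 2 i j) :=
    fun i j hi => compose_spec c₂ _ _ _ g1₂ g1₂ i j hi
  have g₄ : ∀ i j, i < s.reg 0 → (s₄.mat aH4 i j ↔ Hops adj 4 i j) :=
    fun i j hi => compose_spec c₃ _ _ _ g₃ g₃ i j hi
  -- One array holds the walks of length `8 = 4 + 4`, then `10 = 8 + 2`, then `11 = 10 + 1`.
  have g₅ : ∀ i j, i < s.reg 0 → (s₅.mat aH11 i j ↔ Hops adj 8 i j) :=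
    fun i j hi => compose_spec c₄ _ _ _ g₄ g₄ i j hi
  have e2 : s₅.arr aH2 = s₃.arr aH2 := by
    rw [hs₅, ne _ (by decide), hs₄, ne _ (by decide)]
  have g₆ : ∀ i j, i < s.reg 0 → (s₆.mat aH11 i j ↔ Hops adj 10 i j) :=
    fun i j hi => compose_spec c₅ _ _ _ g₅
      (fun i j hi => by rw [Store.mat, e2]; exact g₃ i j hi) i j hi
  have e4 : s₆.arr aADJ = s₂.arr aADJ := by
    rw [hs₆, ne _ (by decide), hs₅, ne _ (by decide), hs₄, ne _ (by decide), hs₃,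
      ne _ (by decide)]
  have g₇ : ∀ i j, i < s.reg 0 → (s₇.mat aH11 i j ↔ Hops adj 11 i j) :=
    fun i j hi => compose_spec c₆ _ _ _ g₆
      (fun i j hi => by rw [Store.mat, e4]; exact g1₂ i j hi) i j hi
  have e4' : s₇.arr aADJ = s₂.arr aADJ := by rw [hs₇, ne _ (by decide), e4]
  have e5' : s₇.arr aH2 = s₃.arr aH2 := by rw [hs₇, ne _ (by decide), hs₆, ne _ (by decide), e2]
  have e6' : s₇.arr aH4 = s₄.arr aH4 := by
    rw [hs₇, ne _ (by decide), hs₆, ne _ (by decide), hs₅, ne _ (by decide)]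
  have e0' : s₇.arr aU = s.arr aU := by
    rw [hs₇, ne _ (by decide), hs₆, ne _ (by decide), hs₅, ne _ (by decide), hs₄, ne _ (by decide),
      hs₃, ne _ (by decide), hs₂, eval_upd_arr_of_ne (by decide)]
    rfl
  have hfin : initGraph.eval D s = (upd aAA (and (le (reg 5) (count 2 (read aADJ (var 0) (var 2))))
      (le (reg 5) (vec aU (var 0))))).eval D s₇ := rfl
  have h5 : s₇.reg 5 = s.reg 1 + (1 - s.reg 1) := by rw [hreg]; simp [hs₁]
  rw [hfin]
  refine ⟨eval_clean _ (by decide) _ c₇, rfl, h5, ?_, ?_, ?_, ?_, ?_⟩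
  · intro i j
    rw [Store.mat, eval_upd_arr_of_ne (by decide), e4']
    exact g₂ i j
  · intro i j hi
    rw [Store.mat, eval_upd_arr_of_ne (by decide), e5']
    exact g₃ i j hi
  · intro i j hi
    rw [Store.mat, eval_upd_arr_of_ne (by decide), e6']
    exact g₄ i j hi
  · intro i j hi
    rw [Store.mat, eval_upd_arr_of_ne (by decide)]
    exact g₇ i j hi
  · intro u
    rw [Store.vec, eval_upd_vec c₇]
    have h07 : s₇.reg 0 = s.reg 0 := rfl
    have hg : ∀ i j, ¬ s₂.arr aADJ i j = 0 ↔ adj i j := g₂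
    by_cases hu : u < s.reg 0
    · rw [if_pos (by rwa [h07])]
      show Tm.Holds _ _ _ _ ↔ _
      simp [h5, e4', e0', h07, Allowed, hu, hg]
    · rw [if_neg (by rwa [h07])]
      exact ⟨fun h => absurd rfl h, fun h => absurd h.1 hu⟩

theorem HasGraph.hops4_vec (hg : HasGraph s n L adj U) (hadj : IsReflGraph n adj)
    {i j : ℕ} :
    s.mat aH4 i j ↔ Hops adj 4 i j := by
  refine ⟨fun h => (hg.hops4 i j ?_).1 h, fun h => (hg.hops4 i j ?_).2 h⟩
  · have := (hg.clean _ _ _ h).1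
    rwa [hg.size] at this
  · obtain ⟨w, h1, -⟩ := h
    exact hadj.lt _ _ h1

/-- If nothing is uncovered, register `10` holds `n`, so both updates are void and only the counter
advances. If a vertex is chosen but no core center is within four hops, register `11` holds `n`, and
the vertex becomes a root. -/
theorem coreStep_spec {m : ℕ} (hg : HasGraph s n L adj U) (hadj : IsReflGraph n adj)
    (h : IsCoreStage n adj (Allowed n L adj U) (s.vec aCORE) (s.vec aPAR) m)
    (h12 : s.reg 12 = m) :
    IsCoreStage n adj (Allowed n L adj U) ((coreStep.eval D s).vec aCORE)
      ((coreStep.eval D s).vec aPAR) (m + 1) ∧ (coreStep.eval D s).reg 12 = m + 1 := by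
  have hs := hg.clean
  have hn := hg.size
  -- the vertices that are not covered, and those that are close to a core center
  set P : ℕ → Prop := fun x => Allowed n L adj U x ∧ ∀ c, s.vec aCORE c ≠ 0 → ¬ Hops adj 2 x c
    with hP
  set Q : ℕ → Prop := fun x => ∃ c, s.vec aCORE c ≠ 0 ∧ Hops adj 4 x c with hQ
  have hcore : ∀ c, s.vec aCORE c ≠ 0 → c < n := fun c hc => (h.allowed c hc).1
  have hPt : ∀ (t : Store) (ρ : ℕ → ℕ), t.arr = s.arr → t.reg 0 = s.reg 0 →
      (uncovered.Holds D t ρ ↔ P (ρ 3)) := by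
    intro t ρ ha h0
    simp only [uncovered, holds_and, holds_vec, eval_var, holds_not, holds_ex, holds_read, ha, h0]
    rw [show s.arr aAA (ρ 3) 0 ≠ 0 ↔ _ from hg.allowed (ρ 3)]
    refine and_congr_right fun hA => ?_
    push Not
    constructor
    · intro h' c hc h2
      have := h' c (by rw [hn]; exact hcore c hc) (by simpa using hc)
      simp at this
      exact (hg.hops2 _ _ hA.1).2 h2 this
    · intro h' c hcn hc
      simp at hc ⊢
      by_contra h2
      exact h' c hc ((hg.hops2 _ _ hA.1).1 h2)
  have hQt : ∀ x, (∃ c < s.reg 0, s.arr aCORE c 0 ≠ 0 ∧ s.arr aH4 x c ≠ 0) ↔ Q x := by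
    intro x
    constructor
    · rintro ⟨c, hcn, hc, h4⟩
      exact ⟨c, hc, (hg.hops4_vec hadj).1 h4⟩
    · rintro ⟨c, hc, h4⟩
      exact ⟨c, hn ▸ hcore c hc, hc, (hg.hops4_vec hadj).2 h4⟩
  obtain ⟨hx1, hx1'⟩ := eval_least (D := D) (s := s) (ρ := fun _ => s.reg 0) (x := 2) (y := 3)
    (t := and uncovered (ex 4 (and (vec aCORE (var 4)) (read aH4 (var 3) (var 4)))))
    (fun x => P x ∧ Q x) (by
      intro i j
      rw [holds_and, hPt s _ rfl rfl, Function.update_self, ← hQt]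
      simp) (by decide)
  set x₁ := (least 2 3 (and uncovered (ex 4 (and (vec aCORE (var 4))
    (read aH4 (var 3) (var 4)))))).eval D s (fun _ => s.reg 0) with hx₁
  set s₁ := (setR 10 (least 2 3 (and uncovered (ex 4 (and (vec aCORE (var 4))
    (read aH4 (var 3) (var 4))))))).eval D s with hs₁
  obtain ⟨hx2, hx2'⟩ := eval_least (D := D) (s := s₁) (ρ := fun _ => s₁.reg 0) (x := 2) (y := 3)
    (t := uncovered) P (by
      intro i j
      rw [hPt s₁ _ rfl rfl, Function.update_self]) (by decide)
  set x₂ := (least 2 3 uncovered).eval D s₁ (fun _ => s₁.reg 0) with hx₂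
  have h0₁ : s₁.reg 0 = n := hn
  rw [hn] at hx1 hx1'
  rw [h0₁] at hx2 hx2'
  set x := if x₁ < n then x₁ else x₂ with hx
  set s₂ := (setR 10 (cond (lt (reg 10) (reg 0)) (reg 10) (least 2 3 uncovered))).eval D s₁
    with hs₂
  have h10 : s₂.reg 10 = x := by
    rw [hs₂, eval_setR_reg, if_pos rfl, eval_cond, holds_lt, eval_reg, eval_reg, hx, hx₂, h0₁,
      show s₁.reg 10 = x₁ from rfl]
    congr
  have h0₂ : s₂.reg 0 = n := hn
  have ha₂ : s₂.arr = s.arr := rfl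
  have hxP : x < n → P x := by
    rw [hx]
    split_ifs with h1
    · exact fun _ => (hx1' h1).1
    · exact hx2'
  have hxQ : x < n → Q x ∨ ∀ x', P x' → ¬ Q x' := by
    intro _
    by_cases h1 : x₁ < n
    · left
      rw [hx, if_pos h1]
      exact (hx1' h1).2
    · right
      intro x' hp hq
      exact h1 (hx1 ⟨x', hp.1.1, hp, hq⟩)
  have hxn : ¬ x < n → ∀ x', ¬ P x' := by
    intro hlt x' hp
    apply hlt
    rw [hx]
    split_ifs with h1
    · exact h1
    · exact hx2 ⟨x', hp.1.1, hp⟩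
  obtain ⟨hy, hy'⟩ := eval_least (D := D) (s := s₂) (ρ := fun _ => s₂.reg 0) (x := 2) (y := 3)
    (t := and (vec aCORE (var 3)) (read aH4 (reg 10) (var 3)))
    (fun y => s.vec aCORE y ≠ 0 ∧ s.mat aH4 x y) (by
      intro i j
      simp [h10, ha₂]) (by decide)
  set y := (least 2 3 (and (vec aCORE (var 3)) (read aH4 (reg 10) (var 3)))).eval D s₂
    (fun _ => s₂.reg 0) with hyd
  rw [h0₂] at hy hy'
  set s₃ := (setR 12 (plus (reg 12) (const 1))).eval D
    ((setR 11 (least 2 3 (and (vec aCORE (var 3)) (read aH4 (reg 10) (var 3))))).eval D s₂) with hs₃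
  have h10₃ : s₃.reg 10 = x := h10
  have h11₃ : s₃.reg 11 = y := rfl
  have h12₃ : s₃.reg 12 = m + 1 := by rw [← h12]; rfl
  have h0₃ : s₃.reg 0 = n := hn
  have ha₃ : s₃.arr = s.arr := rfl
  have hc₃ : Clean s₃ := eval_clean _ (by decide) _ (eval_clean _ (by decide) _
    (eval_clean _ (by decide) _ (eval_clean _ (by decide) _ hs)))
  set s₄ := (upd aPAR (cond (eq (var 0) (reg 10))
      (cond (lt (reg 11) (reg 0)) (plus (reg 11) (const 1)) (const 0)) (vec aPAR (var 0)))).eval D s₃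
    with hs₄
  have hc₄ : Clean s₄ := eval_clean _ (by decide) _ hc₃
  have hfin : coreStep.eval D s = (upd aCORE (cond (eq (var 0) (reg 10)) (reg 12)
    (vec aCORE (var 0)))).eval D s₄ := rfl
  clear_value x y x₁ x₂
  have hpar : ∀ v, (coreStep.eval D s).vec aPAR v = if v < n then if v = x then
      if y < n then y + 1 else 0 else s.vec aPAR v else 0 := by
    intro v
    rw [hfin, Store.vec, eval_upd_arr_of_ne (by decide), hs₄, eval_upd_vec hc₃]
    simp [h10₃, h11₃, h0₃, ha₃]
  have hcor : ∀ v, (coreStep.eval D s).vec aCORE v = if v < n then if v = x then m + 1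
      else s.vec aCORE v else 0 := by
    intro v
    rw [hfin, Store.vec, eval_upd_vec hc₄]
    have e1 : s₄.reg 10 = x := h10₃
    have e2 : s₄.reg 12 = m + 1 := h12₃
    have e3 : s₄.reg 0 = n := h0₃
    have e4 : s₄.arr aCORE = s.arr aCORE := by rw [hs₄, eval_upd_arr_of_ne (by decide), ha₃]
    simp [e1, e2, e3, e4]
  refine ⟨?_, h12₃⟩
  have hz : ∀ a v, ¬ v < n → s.vec a v = 0 := fun a v hv => hs.eq_zero (by omega)
  by_cases hxlt : x < n
  · have hnew := h.add hadj hxlt (hxP hxlt).1 (hxP hxlt).2 (y := y)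
      ((hxQ hxlt).imp id fun h' x' hA h2 c hc h4 => h' x' ⟨hA, h2⟩ ⟨c, hc, h4⟩)
      (fun ⟨c, hc, h4⟩ => hy ⟨c, hcore c hc, hc, (hg.hops4 _ _ hxlt).2 h4⟩)
      (fun hyn => ⟨(hy' hyn).1, (hg.hops4 _ _ hxlt).1 (hy' hyn).2⟩)
    convert hnew using 1
    · funext v
      rw [hcor, Function.update_apply]
      by_cases hv : v < n
      · rw [if_pos hv]
      · rw [if_neg hv, if_neg (by omega), hz _ v hv]
    · funext v
      rw [hpar, Function.update_apply]
      by_cases hv : v < n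
      · rw [if_pos hv]
      · rw [if_neg hv, if_neg (by omega), hz _ v hv]
  · have hsys := h.succ_of_covered (fun u hu => by
      by_contra hcon
      push Not at hcon
      exact hxn hxlt u ⟨hu, hcon⟩)
    convert hsys using 1
    · funext v
      rw [hcor]
      by_cases hv : v < n
      · rw [if_pos hv, if_neg (by omega)]
      · rw [if_neg hv, hz _ v hv]
    · funext v
      rw [hpar]
      by_cases hv : v < n
      · rw [if_pos hv, if_neg (by omega)]
      · rw [if_neg hv, hz _ v hv]

theorem selectCores_spec (hg : HasGraph s n L adj U) (hadj : IsReflGraph n adj) :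
    HasGraph (selectCores.eval D s) n L adj U ∧
    IsCoreStage n adj (Allowed n L adj U) ((selectCores.eval D s).vec aCORE)
      ((selectCores.eval D s).vec aPAR) n := by
  set s₁ := (setR 12 (const 0)).eval D ((upd aPAR (const 0)).eval D ((upd aCORE (const 0)).eval D s))
    with hs₁
  have hg₁ : HasGraph s₁ n L adj U := HasGraph.eval _ (by decide) (by decide) (by decide)
    (HasGraph.eval _ (by decide) (by decide) (by decide)
      (HasGraph.eval _ (by decide) (by decide) (by decide) hg))
  have hfin : selectCores.eval D s = (coreStep.eval D)^[s₁.reg 0] s₁ := rfl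
  have key : ∀ m, HasGraph ((coreStep.eval D)^[m] s₁) n L adj U ∧
      IsCoreStage n adj (Allowed n L adj U) (((coreStep.eval D)^[m] s₁).vec aCORE)
        (((coreStep.eval D)^[m] s₁).vec aPAR) m ∧ ((coreStep.eval D)^[m] s₁).reg 12 = m := by
    intro m
    induction m with
    | zero =>
      refine ⟨hg₁, ?_, rfl⟩
      have e : s₁.vec aCORE = fun _ => 0 := by
        funext v
        rw [hs₁, Store.vec, eval_setR_arr, eval_upd_arr_of_ne (by decide), eval_upd_vec hg.clean]
        simp
      show IsCoreStage n adj _ (s₁.vec aCORE) _ 0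
      rw [e]
      exact isCoreStage_zero
    | succ m ih =>
      rw [Function.iterate_succ_apply']
      have := coreStep_spec (D := D) ih.1 hadj ih.2.1 ih.2.2
      exact ⟨HasGraph.eval _ (by decide) (by decide) (by decide) ih.1, this.1, this.2⟩
  rw [hfin, hg₁.size]
  exact ⟨(key n).1, (key n).2.1⟩

end CoreProgram

end CapCenter

namespace CapCenter

/-! ### Correctness of the attachment of clients, of the flow, and of the reachability graph. -/

section FlowProgram

open scoped Classical

local notation "aADJ" => 4
local notation "aH2" => 5
local notation "aAA" => 10
local notation "aCORE" => 11
local notation "aPAR" => 12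
local notation "aOWN" => 13
local notation "aREM" => 14
local notation "aTT" => 15
local notation "aAG" => 16
local notation "aCAP" => 17
local notation "aQQ" => 21

open Tm Cmd

variable {D : ℕ → ℕ → ℕ → ℕ → Prop} {s : Store} {n L : ℕ} {adj : ℕ → ℕ → Prop} {U : ℕ → ℕ}

theorem attach_spec (hg : HasGraph s n L adj U) (hadj : IsReflGraph n adj)
    (h : IsCoreStage n adj (Allowed n L adj U) (s.vec aCORE) (s.vec aPAR) n) :
    IsCoreBase n adj (Allowed n L adj U) (s.vec aCORE) (s.vec aPAR)
      ((attach.eval D s).vec aOWN) := by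
  have hs := hg.clean
  have hn := hg.size
  have hcore : ∀ c, s.vec aCORE c ≠ 0 → c < n := fun c hc => (h.allowed c hc).1
  set c₁ : ℕ → ℕ := fun v => (least 2 3 (and (vec aCORE (var 3)) (read aADJ (var 0) (var 3)))).eval
    D s (env2 (s.reg 0) v 0) with hc₁
  set c₂ : ℕ → ℕ := fun v => (least 2 3 (and (vec aCORE (var 3)) (ex 4 (and (vec aAA (var 4))
        (and (read aADJ (var 0) (var 4)) (read aH2 (var 4) (var 3))))))).eval D s
        (env2 (s.reg 0) v 0) with hc₂
  have h₁ : ∀ v, ((∃ c < s.reg 0, s.vec aCORE c ≠ 0 ∧ adj v c) → c₁ v < s.reg 0) ∧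
      (c₁ v < s.reg 0 → s.vec aCORE (c₁ v) ≠ 0 ∧ adj v (c₁ v)) := fun v => eval_least (D := D) (s := s) (ρ := env2 (s.reg 0) v 0)
    (x := 2) (y := 3) (t := and (vec aCORE (var 3)) (read aADJ (var 0) (var 3)))
    (fun c => s.vec aCORE c ≠ 0 ∧ adj v c) (by
      intro i j
      rw [← hg.graph]
      simp) (by decide)
  have h₂ : ∀ v, ((∃ c < s.reg 0, s.vec aCORE c ≠ 0 ∧ ∃ u, Allowed n L adj U u ∧ adj v u ∧
        Hops adj 2 u c) → c₂ v < s.reg 0) ∧ (c₂ v < s.reg 0 → s.vec aCORE (c₂ v) ≠ 0 ∧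
        ∃ u, Allowed n L adj U u ∧ adj v u ∧ Hops adj 2 u (c₂ v)) := fun v => eval_least (D := D) (s := s) (ρ := env2 (s.reg 0) v 0)
    (x := 2) (y := 3) (t := and (vec aCORE (var 3)) (ex 4 (and (vec aAA (var 4))
        (and (read aADJ (var 0) (var 4)) (read aH2 (var 4) (var 3))))))
    (fun c => s.vec aCORE c ≠ 0 ∧ ∃ u, Allowed n L adj U u ∧ adj v u ∧ Hops adj 2 u c) (by
      intro i j
      have : (∃ u, Allowed n L adj U u ∧ adj v u ∧ Hops adj 2 u j) ↔
          ∃ u < s.reg 0, s.vec aAA u ≠ 0 ∧ s.mat aADJ v u ∧ s.mat aH2 u j := by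
        refine exists_congr fun u => ?_
        rw [hg.allowed, hg.graph, hn]
        exact ⟨fun h => ⟨h.1.1, h.1, h.2.1, (hg.hops2 _ _ h.1.1).2 h.2.2⟩,
          fun h => ⟨h.2.1, h.2.2.1, (hg.hops2 _ _ h.1).1 h.2.2.2⟩⟩
      rw [this]
      simp) (by decide)
  have hown : ∀ v, (attach.eval D s).vec aOWN v = if v < n then
      if c₁ v < n then c₁ v + 1 else if c₂ v < n then c₂ v + 1 else 0 else 0 := by
    intro v
    rw [attach, Store.vec, eval_upd_vec hs]
    simp only [eval_cond, holds_lt, eval_reg, eval_plus, eval_const, hn]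
    simp only [hc₁, hc₂, hn]
  rw [hn] at h₁ h₂
  clear_value c₁ c₂
  refine ⟨h, ?_, ?_, ?_⟩
  · intro v c hv
    rw [hown] at hv
    split_ifs at hv with hvn h1 h2
    · obtain ⟨h3, h4⟩ := (h₁ v).2 h1
      have : c₁ v = c := by omega
      rw [this] at h3 h4
      have hc := hcore c h3
      -- A core center adjacent to `v` is itself the required allowed vertex, and two loops lead
      -- from it to itself.
      exact ⟨h3, c, h.allowed c h3, h4, c, hadj.refl c hc, c, hadj.refl c hc, rfl⟩
    · have := (h₂ v).2 h2
      have e : c₂ v = c := by omega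
      rwa [e] at this
  · intro v c hc hvc
    have h1 := (h₁ v).1 ⟨c, hcore c hc, hc, hvc⟩
    obtain ⟨h3, h4⟩ := (h₁ v).2 h1
    have : c₁ v = c := h.sep _ _ h3 hc ⟨v, hadj.symm _ _ h4, hops_one.2 hvc⟩
    rw [hown, if_pos (hadj.lt _ _ hvc), if_pos h1, this]
  · intro v u hu hvu
    obtain ⟨c, hc, h2⟩ := h.cover hadj (fun _ hu => hu.1) u hu
    have := (h₂ v).1 ⟨c, hcore c hc, hc, u, hu, hvu, h2⟩
    rw [hown, if_pos (hadj.lt _ _ hvu), if_pos this]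
    split_ifs <;> omega

theorem flowStep_spec {m : ℕ} (hg : HasGraph s n L adj U) (hadj : IsReflGraph n adj) (hL : 0 < L)
    (hb : IsCoreBase n adj (Allowed n L adj U) (s.vec aCORE) (s.vec aPAR) (s.vec aOWN))
    (h : IsFlowStage n L (s.vec aCORE) (s.vec aPAR) (s.vec aOWN) (s.vec aREM) (s.vec aCAP) (m + 1))
    (h12 : s.reg 12 = m + 1) :
    IsFlowStage n L (s.vec aCORE) (s.vec aPAR) (s.vec aOWN) ((flowStep.eval D s).vec aREM)
      ((flowStep.eval D s).vec aCAP) m ∧ (flowStep.eval D s).reg 12 = m := by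
  have hs := hg.clean
  have hn := hg.size
  have hcore : ∀ c, s.vec aCORE c ≠ 0 → c < n := fun c hc => (hb.stage.allowed c hc).1
  set av := avail n (s.vec aCORE) (s.vec aPAR) (s.vec aOWN) (s.vec aREM) with hav
  have hav_le : ∀ c, av c ≤ n := fun c => hb.avail_le hadj h.rem_lt c
  set s₁ := (upd aTT (plus (count 2 (eq (vec aOWN (var 2)) (plus (var 0) (const 1))))
    (sum 2 (cond (and (vec aCORE (var 2)) (eq (vec aPAR (var 2)) (plus (var 0) (const 1))))
      (vec aREM (var 2)) (const 0))))).eval D s with hs₁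
  have hc₁ : Clean s₁ := eval_clean _ (by decide) _ hs
  have hT : ∀ v, s₁.arr aTT v 0 = if v < n then av v else 0 := by
    intro v
    rw [hs₁, eval_upd_vec hs, hav]
    simp [avail, load, hn, Finset.sum_filter]
  have ha₁ : ∀ a, a ≠ aTT → s₁.arr a = s.arr a := fun a h => eval_upd_arr_of_ne h _ _
  set s₂ := (upd aQQ (count 2 (le (sum 3 (cond (lt (var 3) (plus (var 2) (const 1))) (reg 5)
    (const 0))) (vec aTT (var 0))))).eval D s₁ with hs₂
  have hc₂ : Clean s₂ := eval_clean _ (by decide) _ hc₁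
  have hQ : ∀ v, s₂.arr aQQ v 0 = if v < n then av v / L else 0 := by
    intro v
    rw [hs₂, eval_upd_vec hc₁]
    have h0 : s₁.reg 0 = n := hn
    have h5 : s₁.reg 5 = L := hg.low
    by_cases hv : v < n
    · rw [if_pos (by rwa [h0]), if_pos hv, ← card_mul_le hL (hav_le v)]
      simp only [eval_count, h0]
      refine congrArg Finset.card (Finset.filter_congr fun j hj => ?_)
      rw [Finset.mem_range] at hj
      rw [← sum_range_ite_lt n (j + 1) L hj]
      simp [hT, hv, h0, h5]
    · rw [if_neg (by rwa [h0]), if_neg hv]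
  have ha₂ : ∀ a, a ≠ aTT → a ≠ aQQ → s₂.arr a = s.arr a := fun a h h' =>
    (eval_upd_arr_of_ne h' _ _).trans (ha₁ a h)
  have hT₂ : s₂.arr aTT = s₁.arr aTT := eval_upd_arr_of_ne (by decide) _ _
  set s₃ := (upd aREM (cond (eq (vec aCORE (var 0)) (reg 12))
    (minus (vec aTT (var 0)) (sum 2 (cond (lt (var 2) (vec aQQ (var 0))) (reg 5) (const 0))))
    (vec aREM (var 0)))).eval D s₂ with hs₃
  have hc₃ : Clean s₃ := eval_clean _ (by decide) _ hc₂
  have h0₂ : s₂.reg 0 = n := hn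
  have h5₂ : s₂.reg 5 = L := hg.low
  have h12₂ : s₂.reg 12 = m + 1 := h12
  have hR : ∀ v, s₃.arr aREM v 0 = if s.vec aCORE v = m + 1 then av v % L else s.vec aREM v := by
    intro v
    rw [hs₃, eval_upd_vec hc₂, h0₂]
    by_cases hv : v < n
    · have e1 : (∑ j ∈ Finset.range n, if j < av v / L then L else 0) = av v / L * L :=
        sum_range_ite_lt n _ L ((Nat.div_le_self _ _).trans (hav_le v))
      have e2 : av v - av v / L * L = av v % L := by
        have := Nat.div_add_mod (av v) L
        rw [mul_comm] at this
        omega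
      have e3 := ha₂ aCORE (by decide) (by decide)
      have e4 := ha₂ aREM (by decide) (by decide)
      rw [if_pos hv]
      simp [h0₂, h5₂, h12₂, hQ, hT₂, hT, hv, e1, e2, e3, e4]
    · have e1 : s.vec aCORE v = 0 := hs.eq_zero (by omega)
      have e2 : s.vec aREM v = 0 := hs.eq_zero (by omega)
      rw [if_neg hv, if_neg (by omega), e2]
  set s₄ := (upd aCAP (cond (eq (vec aCORE (var 0)) (reg 12)) (vec aQQ (var 0))
    (vec aCAP (var 0)))).eval D s₃ with hs₄
  have h0₃ : s₃.reg 0 = n := hn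
  have h12₃ : s₃.reg 12 = m + 1 := h12
  have hC : ∀ v, s₄.arr aCAP v 0 = if s.vec aCORE v = m + 1 then av v / L else s.vec aCAP v := by
    intro v
    rw [hs₄, eval_upd_vec hc₃, h0₃]
    by_cases hv : v < n
    · have e3 : s₃.arr aCORE = s.arr aCORE :=
        (eval_upd_arr_of_ne (by decide) _ _).trans (ha₂ aCORE (by decide) (by decide))
      have e4 : s₃.arr aCAP = s.arr aCAP :=
        (eval_upd_arr_of_ne (by decide) _ _).trans (ha₂ aCAP (by decide) (by decide))
      have e5 : s₃.arr aQQ = s₂.arr aQQ := eval_upd_arr_of_ne (by decide) _ _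
      rw [if_pos hv]
      simp [h12₃, e3, e4, e5, hQ, hv]
    · have e1 : s.vec aCORE v = 0 := hs.eq_zero (by omega)
      have e2 : s.vec aCAP v = 0 := hs.eq_zero (by omega)
      rw [if_neg hv, if_neg (by omega), e2]
  have hfin : flowStep.eval D s = (setR 12 (minus (reg 12) (const 1))).eval D s₄ := rfl
  have hnext := h.next hL fun c q hc hp => (hb.stage.par_spec c q hc hp).2.1
  rw [hfin]
  refine ⟨?_, ?_⟩
  · convert hnext using 1
    · funext v
      rw [Store.vec, eval_setR_arr, hs₄, eval_upd_arr_of_ne (by decide)]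
      exact hR v
    · funext v
      exact hC v
  · rw [eval_setR_reg, if_pos rfl, eval_minus, eval_reg, eval_const,
      show s₄.reg 12 = m + 1 from h12]
    rfl

/-- Positions are treated downwards from `n`, so that the remainders of all children are final when
their parent is treated. Initially all remainders are zero, and no position exceeds `n`. -/
theorem flows_spec (hg : HasGraph s n L adj U) (hadj : IsReflGraph n adj) (hL : 0 < L)
    (hb : IsCoreBase n adj (Allowed n L adj U) (s.vec aCORE) (s.vec aPAR) (s.vec aOWN)) :
    CoreSystem n L adj (Allowed n L adj U) (s.vec aCORE) (s.vec aPAR) (s.vec aOWN)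
      ((flows.eval D s).vec aREM) ((flows.eval D s).vec aCAP) := by
  have hs := hg.clean
  set s₁ := (setR 12 (reg 0)).eval D ((upd aCAP (const 0)).eval D ((upd aREM (const 0)).eval D s))
    with hs₁
  have hg₁ : HasGraph s₁ n L adj U := HasGraph.eval _ (by decide) (by decide) (by decide)
    (HasGraph.eval _ (by decide) (by decide) (by decide)
      (HasGraph.eval _ (by decide) (by decide) (by decide) hg))
  have hfin : flows.eval D s = (flowStep.eval D)^[s₁.reg 0] s₁ := rfl
  have ha₁ : ∀ a, a ≠ aREM → a ≠ aCAP → s₁.arr a = s.arr a := fun a h h' =>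
    (eval_upd_arr_of_ne h' _ _).trans (eval_upd_arr_of_ne h _ _)
  have key : ∀ k m, m + k = n → HasGraph ((flowStep.eval D)^[k] s₁) n L adj U ∧
      (∀ a ∈ [aCORE, aPAR, aOWN], ((flowStep.eval D)^[k] s₁).arr a = s.arr a) ∧
      IsFlowStage n L (s.vec aCORE) (s.vec aPAR) (s.vec aOWN)
        (((flowStep.eval D)^[k] s₁).vec aREM) (((flowStep.eval D)^[k] s₁).vec aCAP) m ∧
      ((flowStep.eval D)^[k] s₁).reg 12 = m := by
    intro k
    induction k with
    | zero =>
      intro m hm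
      refine ⟨hg₁, ?_, ⟨fun c hc => ?_, fun c hc => ?_⟩, ?_⟩
      · intro a ha
        simp only [List.mem_cons, List.not_mem_nil, or_false] at ha
        exact ha₁ a (by omega) (by omega)
      · show s₁.arr aREM c 0 < L
        rw [hs₁, eval_setR_arr, eval_upd_arr_of_ne (by decide), eval_upd_vec hs]
        simpa using hL
      · have := hb.stage.le c
        omega
      · show s.reg 0 = m
        rw [hg.size]; omega
    | succ k ih =>
      intro m hm
      obtain ⟨hg', ha, hf, h12⟩ := ih (m + 1) (by omega)
      rw [Function.iterate_succ_apply']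
      set t := (flowStep.eval D)^[k] s₁ with ht
      have e1 : t.vec aCORE = s.vec aCORE := by funext v; rw [Store.vec, ha aCORE (by decide)]
      have e2 : t.vec aPAR = s.vec aPAR := by funext v; rw [Store.vec, ha aPAR (by decide)]
      have e3 : t.vec aOWN = s.vec aOWN := by funext v; rw [Store.vec, ha aOWN (by decide)]
      have := flowStep_spec (D := D) hg' hadj hL (by rw [e1, e2, e3]; exact hb)
        (by rw [e1, e2, e3]; exact hf) h12
      rw [e1, e2, e3] at this
      refine ⟨hg'.eval _ (by decide) (by decide) (by decide), fun a h => ?_, this⟩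
      rw [eval_arr_of_notMem flowStep, ha a h]
      simp only [List.mem_cons, List.not_mem_nil, or_false] at h
      rcases h with rfl | rfl | rfl <;> decide
  rw [hfin, hg₁.size]
  exact hb.coreSystem hadj (key n 0 (by omega)).2.2.1

theorem reachGraph_spec (hg : HasGraph s n L adj U) (hadj : IsReflGraph n adj)
    (hcore : ∀ c, s.vec aCORE c ≠ 0 → c < n) (u c : ℕ) :
    (reachGraph.eval D s).mat aAG u c ↔
      Reach adj (Allowed n L adj U) (s.vec aCORE) (s.vec aPAR) (s.vec aOWN) u c := by
  have hs := hg.clean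
  have hltr : ∀ {i j}, adj i j → j < n := fun h => hadj.lt _ _ (hadj.symm _ _ h)
  have h1 : Reach adj (Allowed n L adj U) (s.vec aCORE) (s.vec aPAR) (s.vec aOWN) u c ↔
      s.vec aAA u ≠ 0 ∧ s.vec aCORE c ≠ 0 ∧ ∃ v < s.reg 0, s.mat aADJ u v ∧
        (s.vec aOWN v = c + 1 ∨ ∃ c' < s.reg 0, s.vec aCORE c' ≠ 0 ∧ s.mat aADJ v c' ∧
          s.vec aPAR c' = c + 1) := by
    unfold Reach
    rw [hg.allowed]
    simp only [hg.graph, hg.size]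
    refine and_congr_right fun _ => and_congr_right fun _ => exists_congr fun v => ?_
    have : (∃ c', s.vec aCORE c' ≠ 0 ∧ adj v c' ∧ s.vec aPAR c' = c + 1) ↔
        ∃ c' < n, s.vec aCORE c' ≠ 0 ∧ adj v c' ∧ s.vec aPAR c' = c + 1 :=
      exists_congr fun c' => ⟨fun h => ⟨hcore c' h.1, h⟩, fun h => h.2⟩
    rw [this]
    exact ⟨fun h => ⟨hltr h.1, h⟩, fun h => h.2⟩
  rw [h1, Store.mat, reachGraph, eval_upd_arr hs]
  by_cases h : u < s.reg 0 ∧ c < s.reg 0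
  · rw [if_pos h]
    show Tm.Holds _ _ _ _ ↔ _
    simp
  · rw [if_neg h]
    exact ⟨fun h' => absurd rfl h', fun h' => absurd ⟨(hs _ _ _ h'.1).1, (hs _ _ _ h'.2.1).1⟩ h⟩

end FlowProgram

end CapCenter

namespace CapCenter

/-! ### The algorithm for one threshold. -/

section Pair

open scoped Classical

local notation "aU" => 0
local notation "aH11" => 9
local notation "aCORE" => 11
local notation "aPAR" => 12
local notation "aOWN" => 13
local notation "aREM" => 14
local notation "aAG" => 16
local notation "aCAP" => 17
local notation "aMA" => 18
local notation "aFF" => 20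

variable {n L : ℕ} {adj : ℕ → ℕ → Prop} {U core par own rem cap F M : ℕ → ℕ}

/-- The assignment of clients to opened vertices within `11` hops. -/
def Near (adj : ℕ → ℕ → Prop) (F : ℕ → ℕ) (v u : ℕ) : Prop := F u ≠ 0 ∧ Hops adj 11 v u

theorem card_matched_eq_sum_load (hM : IsAssignment n (Near adj F) M) (hF : ∀ u, F u ≠ 0 → u < n) :
    ((Finset.range n).filter fun i => M i ≠ 0).card =
      ∑ u ∈ (Finset.range n).filter (fun u => F u ≠ 0), load n M u := by
  rw [sum_load]
  refine congrArg Finset.card (Finset.filter_congr fun i hi => ?_)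
  rw [Finset.mem_range] at hi
  constructor
  · intro h
    obtain ⟨j, hj⟩ := Nat.exists_eq_succ_of_ne_zero h
    have := (hM i hi j hj).1
    exact ⟨j, Finset.mem_filter.2 ⟨Finset.mem_range.2 (hF j this), this⟩, hj⟩
  · rintro ⟨j, -, hj⟩
    omega

/-- A maximum assignment with the uniform capacity `L` saturates all opened vertices. -/
theorem load_eq_of_maximal
    (H : CoreSystem n L adj (Allowed n L adj U) core par own rem cap) (hadj : IsReflGraph n adj)
    (hF : IsGreedy n (Reach adj (Allowed n L adj U) core par own) U cap F)
    (hFn : ∀ u, F u ≠ 0 → u < n) (hM : IsAssignment n (Near adj F) M)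
    (hload : ∀ j, load n M j ≤ L)
    (hmax : ∀ i < n, M i = 0 →
      ∃ T, IsTight n (Near adj F) (fun _ => L) M T ∧ ∀ j, Near adj F i j → j ∈ T)
    {u : ℕ} (hu : F u ≠ 0) : load n M u = L := by
  -- The total load equals a cut, which is at least `L` times the number of opened vertices; as no
  -- load exceeds `L`, all loads are `L`.
  obtain ⟨Z, -, hZ⟩ := exists_cut hM (fun i j h => hFn j h.1) hmax
  have h1 := mul_card_le_cut H hadj hF Z
  have h2 : (Finset.range n).filter (fun j => ∃ z ∈ Z, Near adj F z j) =
      (Finset.range n).filter fun u => F u ≠ 0 ∧ ∃ z ∈ Z, Hops adj 11 z u := by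
    refine Finset.filter_congr fun j _ => ?_
    constructor
    · rintro ⟨z, hz, h, h'⟩; exact ⟨h, z, hz, h'⟩
    · rintro ⟨h, z, hz, h'⟩; exact ⟨z, hz, h, h'⟩
  rw [h2, Finset.sum_const, smul_eq_mul, mul_comm _ L, card_matched_eq_sum_load hM hFn] at hZ
  have h3 : ∑ u ∈ (Finset.range n).filter (fun u => F u ≠ 0), load n M u ≤
      ∑ u ∈ (Finset.range n).filter (fun u => F u ≠ 0), L :=
    Finset.sum_le_sum fun j _ => hload j
  have h4 : ∑ u ∈ (Finset.range n).filter (fun u => F u ≠ 0), L =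
      L * ((Finset.range n).filter fun u => F u ≠ 0).card := by
    rw [Finset.sum_const, smul_eq_mul, mul_comm]
  have h5 := (Finset.sum_eq_sum_iff_of_le (fun j _ => hload j)).1
    (le_antisymm h3 (by rw [h4, hZ]; exact h1))
  exact h5 u (Finset.mem_filter.2 ⟨Finset.mem_range.2 (hFn u hu), hu⟩)

/-- A maximum assignment serves at least as many vertices as any service. -/
theorem card_le_of_maximal {C : Finset ℕ} {φ : ℕ → ℕ}
    (H : CoreSystem n L adj (Allowed n L adj U) core par own rem cap) (hadj : IsReflGraph n adj)
    (hL : 1 ≤ L)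
    (hF : IsGreedy n (Reach adj (Allowed n L adj U) core par own) U cap F)
    (hFn : ∀ u, F u ≠ 0 → u < n) (hM : IsAssignment n (Near adj F) M)
    (hmax : ∀ i < n, M i = 0 →
      ∃ T, IsTight n (Near adj F) U M T ∧ ∀ j, Near adj F i j → j ∈ T)
    (hC : IsService n L adj U C φ) :
    C.card ≤ ((Finset.range n).filter fun i => M i ≠ 0).card := by
  obtain ⟨Z, -, hZ⟩ := exists_cut hM (fun i j h => hFn j h.1) hmax
  rw [hZ]
  refine (card_le_cut hC H hadj hL hF Z).trans_eq ?_
  congr 1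
  refine Finset.sum_congr (Finset.filter_congr fun j _ => ?_) fun _ _ => rfl
  constructor
  · rintro ⟨h, z, hz, h'⟩; exact ⟨z, hz, h, h'⟩
  · rintro ⟨z, hz, h, h'⟩; exact ⟨h, z, hz, h'⟩

open Tm Cmd

/-- The system of core centers and its bipartite graph. -/
def buildCores : Cmd :=
  seq initGraph (seq selectCores (seq attach (seq flows reachGraph)))

/-- The choice of the opened vertices. -/
def openCenters : Cmd :=
  seq (upd aMA (const 0)) (seq matchAll (upd aFF (vec aMA (var 0))))

/-- The assignment of the clients to the opened vertices. -/
def serve : Cmd :=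
  seq (upd aAG (and (vec aFF (var 1)) (read aH11 (var 0) (var 1))))
  (seq (upd aCAP (reg 5))
  (seq (upd aMA (const 0))
  (seq matchAll
  (seq (upd aCAP (vec aU (var 0))) matchAll))))

/-- The algorithm for a fixed pair of vertices. -/
def solvePair : Cmd := seq buildCores (seq openCenters serve)

variable {D : ℕ → ℕ → ℕ → ℕ → Prop} {s : Store}

/-- The memory contains a system of core centers and its bipartite graph. -/
structure HasCores (s : Store) (n L : ℕ) (adj : ℕ → ℕ → Prop) (U : ℕ → ℕ)
    (core par own rem cap : ℕ → ℕ) : Prop where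
  graph : HasGraph s n L adj U
  capacity : s.vec aU = U
  system : CoreSystem n L adj (Allowed n L adj U) core par own rem cap

theorem buildCores_spec (hs : Clean s)
    (hD : ∀ i j, D i j (s.reg 3) (s.reg 4) → i < s.reg 0 ∧ j < s.reg 0)
    (hadj : IsReflGraph (s.reg 0) fun i j => D i j (s.reg 3) (s.reg 4)) :
    ∃ core par own rem, HasCores (buildCores.eval D s) (s.reg 0) (s.reg 1 + (1 - s.reg 1))
      (fun i j => D i j (s.reg 3) (s.reg 4)) (s.vec aU) core par own rem
      ((buildCores.eval D s).vec aCAP) ∧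
      (buildCores.eval D s).mat aAG = Reach (fun i j => D i j (s.reg 3) (s.reg 4))
        (Allowed (s.reg 0) (s.reg 1 + (1 - s.reg 1)) (fun i j => D i j (s.reg 3) (s.reg 4))
          (s.vec aU)) core par own := by
  have g₁ := initGraph_spec hs hD
  set s₁ := initGraph.eval D s with hs₁
  obtain ⟨g₂, h₂⟩ := selectCores_spec (D := D) g₁ hadj
  set s₂ := selectCores.eval D s₁ with hs₂
  have h₃ := attach_spec (D := D) g₂ hadj h₂
  have g₃ : HasGraph (attach.eval D s₂) _ _ _ _ :=
    g₂.eval attach (by decide) (by decide) (by decide)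
  set s₃ := attach.eval D s₂ with hs₃
  have e1 : s₃.vec aCORE = s₂.vec aCORE := by
    funext v; rw [Store.vec, hs₃, eval_arr_of_notMem _ (by decide)]
  have e2 : s₃.vec aPAR = s₂.vec aPAR := by
    funext v; rw [Store.vec, hs₃, eval_arr_of_notMem _ (by decide)]
  rw [← e1, ← e2] at h₃
  have h₄ := flows_spec (D := D) g₃ hadj (by omega) h₃
  have g₄ : HasGraph (flows.eval D s₃) _ _ _ _ :=
    g₃.eval flows (by decide) (by decide) (by decide)
  set s₄ := flows.eval D s₃ with hs₄
  have e3 : s₄.vec aCORE = s₃.vec aCORE := by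
    funext v; rw [Store.vec, hs₄, eval_arr_of_notMem _ (by decide)]
  have e4 : s₄.vec aPAR = s₃.vec aPAR := by
    funext v; rw [Store.vec, hs₄, eval_arr_of_notMem _ (by decide)]
  have e5 : s₄.vec aOWN = s₃.vec aOWN := by
    funext v; rw [Store.vec, hs₄, eval_arr_of_notMem _ (by decide)]
  rw [← e3, ← e4, ← e5] at h₄
  have hfin : buildCores.eval D s = reachGraph.eval D s₄ := rfl
  have e6 : (reachGraph.eval D s₄).vec aCAP = s₄.vec aCAP := by
    funext v; rw [Store.vec, eval_arr_of_notMem _ (by decide)]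
  have e7 : (buildCores.eval D s).vec aU = s.vec aU := by
    funext v; rw [Store.vec, eval_arr_of_notMem _ (by decide)]
  rw [hfin, e6]
  refine ⟨s₄.vec aCORE, s₄.vec aPAR, s₄.vec aOWN, s₄.vec aREM,
    ⟨g₄.eval reachGraph (by decide) (by decide) (by decide), e7, h₄⟩, ?_⟩
  funext u c
  exact propext (reachGraph_spec g₄ hadj (fun c hc => (h₄.allowed c hc).1) u c)

theorem load_zero (n j : ℕ) : load n (fun _ => 0) j = 0 := by
  simp [load]

theorem upd_zero (hs : Clean s) (a : ℕ) : ((upd a (const 0)).eval D s).vec a = fun _ => 0 := by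
  funext v
  rw [Store.vec, eval_upd_vec hs]
  simp

theorem openCenters_spec (h : HasCores s n L adj U core par own rem (s.vec aCAP))
    (hAG : s.mat aAG = Reach adj (Allowed n L adj U) core par own) :
    IsGreedy n (Reach adj (Allowed n L adj U) core par own) U (s.vec aCAP)
      ((openCenters.eval D s).vec aFF) := by
  have hs := h.graph.clean
  set s₁ := (upd aMA (const 0)).eval D s with hs₁
  have hc₁ : Clean s₁ := eval_clean _ (by decide) _ hs
  have e0 : s₁.reg 0 = n := h.graph.size
  have e1 : s₁.vec aMA = fun _ => 0 := upd_zero hs _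
  have e2 : s₁.mat aAG = Reach adj (Allowed n L adj U) core par own := by
    rw [← hAG]; funext i j; rw [Store.mat, hs₁, eval_upd_arr_of_ne (by decide)]
  have e3 : s₁.vec aCAP = s.vec aCAP := by
    funext j; rw [Store.vec, hs₁, eval_upd_arr_of_ne (by decide)]
  have e4 : s₁.vec aU = U := by
    rw [← h.capacity]; funext j; rw [Store.vec, hs₁, eval_upd_arr_of_ne (by decide)]
  obtain ⟨hext, hrej⟩ := matchAll_spec (D := D) hc₁ (by rw [e1]; exact fun i _ j h => absurd h.symm (Nat.succ_ne_zero j))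
    (by rw [e0, e1]; intro j; rw [load_zero]; exact Nat.zero_le _)
  have hc₂ : Clean (matchAll.eval D s₁) := eval_clean _ (by decide) _ hc₁
  have hF : (openCenters.eval D s).vec aFF = (matchAll.eval D s₁).vec aMA := by
    funext v
    show ((upd aFF (vec aMA (var 0))).eval D (matchAll.eval D s₁)).arr aFF v 0 = _
    rw [eval_upd_vec hc₂]
    by_cases hv : v < (matchAll.eval D s₁).reg 0
    · simp [hv]
    · rw [if_neg hv, Store.vec, hc₂.eq_zero (not_lt.1 hv)]
  rw [e0, e2, e3, e1] at hext
  rw [e0, e1, e2, e3, e4] at hrej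
  rw [hF]
  refine ⟨hext.assign, fun u hu hu0 => ?_, hext.load_le⟩
  obtain ⟨T, hT, hGT, hUT⟩ := hrej u hu hu0
  exact ⟨T, hT, hGT, fun x hx c hc hxc => (hUT x hx c hc hxc).resolve_left fun h => h rfl⟩

/-- The first run, with capacity `L`, fills every opened vertex to `L`. The second starts from its
result with capacity `U u`: loads never decrease, so the lower bounds survive, and at the end no
further augmentation is possible. -/
theorem serve_spec (hg : HasGraph s n L adj U) (hU : s.vec aU = U) (hadj : IsReflGraph n adj)
    (hL : 1 ≤ L)
    (H : CoreSystem n L adj (Allowed n L adj U) core par own rem cap)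
    (hF : IsGreedy n (Reach adj (Allowed n L adj U) core par own) U cap (s.vec aFF)) :
    IsAssignment n (Near adj (s.vec aFF)) ((serve.eval D s).vec aMA) ∧
    (∀ u, s.vec aFF u ≠ 0 → L ≤ load n ((serve.eval D s).vec aMA) u ∧
      load n ((serve.eval D s).vec aMA) u ≤ U u) ∧
    ∀ C φ, IsService n L adj U C φ →
      C.card ≤ ((Finset.range n).filter fun i => (serve.eval D s).vec aMA i ≠ 0).card := by
  have hs := hg.clean
  have hn := hg.size
  have hFn : ∀ u, s.vec aFF u ≠ 0 → u < n := fun u hu => hn ▸ (hs _ _ _ hu).1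
  set s₁ := (upd aAG (and (vec aFF (var 1)) (read aH11 (var 0) (var 1)))).eval D s with hs₁
  have c₁ : Clean s₁ := eval_clean _ (by decide) _ hs
  have hG : s₁.mat aAG = Near adj (s.vec aFF) := by
    funext i j
    apply propext
    show s₁.arr aAG i j ≠ 0 ↔ _
    rw [hs₁, eval_upd_arr hs, hn]
    by_cases hij : i < n ∧ j < n
    · rw [if_pos hij]
      show Tm.Holds _ _ _ _ ↔ _
      rw [Near, ← hg.hops11 i j hij.1]
      simp
    · rw [if_neg hij]
      refine ⟨fun h => absurd rfl h, fun h => absurd ⟨?_, hFn j h.1⟩ hij⟩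
      obtain ⟨-, w, hw, -⟩ := h
      exact hadj.lt _ _ hw
  set s₂ := (upd aMA (const 0)).eval D ((upd aCAP (reg 5)).eval D s₁) with hs₂
  have c₂' : Clean ((upd aCAP (reg 5)).eval D s₁) := eval_clean _ (by decide) _ c₁
  have c₂ : Clean s₂ := eval_clean _ (by decide) _ c₂'
  have n₂ : s₂.reg 0 = n := hn
  have G₂ : s₂.mat aAG = Near adj (s.vec aFF) := by
    rw [← hG]
    funext i j
    rw [Store.mat, hs₂, eval_upd_arr_of_ne (by decide), eval_upd_arr_of_ne (by decide)]
  have M₂ : s₂.vec aMA = fun _ => 0 := upd_zero c₂' _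
  have C₂ : ∀ j < n, s₂.vec aCAP j = L := by
    intro j hj
    rw [Store.vec, hs₂, eval_upd_arr_of_ne (by decide), eval_upd_vec c₁, if_pos (by rwa [← hn] at hj),
      eval_reg]
    exact hg.low
  have C₂' : ∀ j, ¬ j < n → s₂.vec aCAP j = 0 := fun j hj => c₂.eq_zero (by omega)
  have U₂ : s₂.vec aU = U := by
    rw [← hU]
    funext j
    rw [Store.vec, hs₂, eval_upd_arr_of_ne (by decide), eval_upd_arr_of_ne (by decide), hs₁,
      eval_upd_arr_of_ne (by decide)]
  obtain ⟨ext₃, rej₃⟩ := matchAll_spec (D := D) c₂ (by rw [M₂]; exact fun i _ j h => absurd h.symm (Nat.succ_ne_zero j))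
    (by rw [n₂, M₂]; intro j; rw [load_zero]; exact Nat.zero_le _)
  rw [n₂, G₂] at ext₃ rej₃
  set s₃ := matchAll.eval D s₂ with hs₃
  have c₃ : Clean s₃ := eval_clean _ (by decide) _ c₂
  have load₃ : ∀ j, load n (s₃.vec aMA) j ≤ L := by
    intro j
    refine (ext₃.load_le j).trans ?_
    by_cases hj : j < n
    · exact (C₂ j hj).le
    · rw [C₂' j hj]; exact Nat.zero_le _
  have sat : ∀ u, s.vec aFF u ≠ 0 → load n (s₃.vec aMA) u = L := fun u hu =>
    load_eq_of_maximal H hadj hF hFn ext₃.assign load₃ (fun i hi h0 => by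
      obtain ⟨T, hT, hGT, -⟩ := rej₃ i hi h0
      -- Outside the vertex range the stored capacity is `0` instead of `L`, so `T` is restricted to
      -- vertices.
      refine ⟨T.filter fun j => j < n, ⟨fun j hj => ?_, fun i hi j hj hij j' hG' => ?_⟩,
        fun j hj => ?_⟩
      · rw [Finset.mem_filter] at hj
        rw [hT.1 j hj.1, C₂ j hj.2]
      · rw [Finset.mem_filter] at hj ⊢
        exact ⟨hT.2 i hi j hj.1 hij j' hG', hFn j' hG'.1⟩
      · exact Finset.mem_filter.2 ⟨hGT j hj, hFn j hj.1⟩) hu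
  set s₄ := (upd aCAP (vec aU (var 0))).eval D s₃ with hs₄
  have c₄ : Clean s₄ := eval_clean _ (by decide) _ c₃
  have n₃ : s₃.reg 0 = n := by rw [hs₃, eval_reg_of_notMem _ (by decide), n₂]
  have n₄ : s₄.reg 0 = n := n₃
  have M₄ : s₄.vec aMA = s₃.vec aMA := by
    funext j; rw [Store.vec, hs₄, eval_upd_arr_of_ne (by decide)]
  have G₄ : s₄.mat aAG = Near adj (s.vec aFF) := by
    rw [← G₂]
    funext i j
    rw [Store.mat, hs₄, eval_upd_arr_of_ne (by decide), hs₃, eval_arr_of_notMem _ (by decide)]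
  have U₃ : s₃.vec aU = U := by
    rw [← U₂]; funext j; rw [Store.vec, hs₃, eval_arr_of_notMem _ (by decide)]
  have C₄ : s₄.vec aCAP = U := by
    rw [← U₃]
    funext j
    rw [Store.vec, hs₄, eval_upd_vec c₃]
    by_cases hj : j < s₃.reg 0
    · rw [if_pos hj, eval_vec, eval_var, env2_zero]
    · rw [if_neg hj, Store.vec, c₃.eq_zero (not_lt.1 hj)]
  have FU : ∀ u, s.vec aFF u ≠ 0 → L ≤ U u := by
    intro u hu
    obtain ⟨c, hc⟩ := Nat.exists_eq_succ_of_ne_zero hu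
    exact (hF.assign u (hFn u hu) c hc).1.2.2
  obtain ⟨ext₅, rej₅⟩ := matchAll_spec (D := D) c₄ (by rw [n₄, G₄, M₄]; exact ext₃.assign) (by
    intro j
    rw [n₄, M₄, C₄]
    by_cases hj : s.vec aFF j ≠ 0
    · exact (load₃ j).trans (FU j hj)
    · have : load n (s₃.vec aMA) j = 0 := by
        rw [load, Finset.card_eq_zero, Finset.filter_eq_empty_iff]
        intro i hi hij
        exact hj (ext₃.assign i (Finset.mem_range.1 hi) j hij).1
      rw [this]; exact Nat.zero_le _)
  have hfin : serve.eval D s = matchAll.eval D s₄ := rfl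
  rw [n₄, G₄, M₄, C₄] at ext₅
  rw [n₄, G₄, C₄] at rej₅
  rw [hfin]
  refine ⟨ext₅.assign, fun u hu => ⟨?_, ext₅.load_le u⟩, fun C φ hC => ?_⟩
  · rw [← sat u hu]; exact ext₅.load_ge u
  · exact card_le_of_maximal H hadj hL hF hFn ext₅.assign (fun i hi h0 => by
      obtain ⟨T, hT, hGT, -⟩ := rej₅ i hi h0
      exact ⟨T, hT, hGT⟩) hC

/-- The result for a fixed pair: every opened vertex serves between `L` and `U u` vertices within
`11` hops, and at least as many vertices are served as by any service within one hop. -/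
theorem solvePair_spec (hs : Clean s)
    (hD : ∀ i j, D i j (s.reg 3) (s.reg 4) → i < s.reg 0 ∧ j < s.reg 0)
    (hadj : IsReflGraph (s.reg 0) fun i j => D i j (s.reg 3) (s.reg 4)) :
    IsAssignment (s.reg 0)
      (Near (fun i j => D i j (s.reg 3) (s.reg 4)) ((solvePair.eval D s).vec aFF))
      ((solvePair.eval D s).vec aMA) ∧
    (∀ u, (solvePair.eval D s).vec aFF u ≠ 0 →
      s.reg 1 + (1 - s.reg 1) ≤ load (s.reg 0) ((solvePair.eval D s).vec aMA) u ∧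
      load (s.reg 0) ((solvePair.eval D s).vec aMA) u ≤ s.vec aU u) ∧
    ∀ C φ, IsService (s.reg 0) (s.reg 1 + (1 - s.reg 1)) (fun i j => D i j (s.reg 3) (s.reg 4))
      (s.vec aU) C φ →
      C.card ≤ ((Finset.range (s.reg 0)).filter fun i =>
        (solvePair.eval D s).vec aMA i ≠ 0).card := by
  obtain ⟨core, par, own, rem, h, hAG⟩ := buildCores_spec hs hD hadj
  set s₁ := buildCores.eval D s with hs₁
  have hF := openCenters_spec (D := D) h hAG
  set s₂ := openCenters.eval D s₁ with hs₂
  have g₂ : HasGraph s₂ _ _ _ _ := h.graph.eval openCenters (by decide) (by decide) (by decide)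
  have U₂ : s₂.vec aU = s.vec aU := by
    rw [← h.capacity]
    funext v; rw [Store.vec, hs₂, eval_arr_of_notMem _ (by decide)]
  have hfin : solvePair.eval D s = serve.eval D s₂ := rfl
  have hFF : (serve.eval D s₂).vec aFF = s₂.vec aFF := by
    funext v; rw [Store.vec, eval_arr_of_notMem _ (by decide)]
  rw [hfin, hFF]
  exact serve_spec g₂ U₂ hadj (by omega) h.system hF

end Pair

end CapCenter

namespace CapCenter

/-! ### The search over all thresholds, and the theorem. -/

section Main

open scoped Classical

local notation "aU" => 0
local notation "aMA" => 18
local notation "aFF" => 20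

open Tm Cmd

/-- The current solution becomes the output, and the current pair is stored in the registers `7`
and `8`. -/
def record : Cmd :=
  seq (upd 1 (vec aMA (var 0)))
    (seq (upd 2 (vec aFF (var 0)))
    (seq (upd 3 (minus (vec aMA (var 0)) (const 1)))
    (seq (setR 6 (const 1))
    (seq (setR 7 (reg 3))
      (setR 8 (reg 4))))))

/-- The algorithm for the pair in the registers `3` and `4`. If enough vertices are served, and if
register `6` is zero or the pair is at least as good as the one in the registers `7` and `8`, then
the solution becomes the output. -/
def tryPair : Cmd :=
  seq solvePair
    (ite (and (le (reg 2) (count 2 (vec aMA (var 2))))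
        (or (not (reg 6)) (dle (reg 3) (reg 4) (reg 7) (reg 8))))
      record
      (setR 6 (reg 6)))

/-- The algorithm for all pairs whose first vertex is in register `3`. -/
def tryRow : Cmd :=
  seq (setR 4 (const 0))
    (seq (iter (seq tryPair (setR 4 (plus (reg 4) (const 1)))))
      (setR 3 (plus (reg 3) (const 1))))

/-- The algorithm for all pairs. -/
def tryAll : Cmd := iter tryRow

variable {n : ℕ} {I : Instance (Fin n)} {s : Store}

theorem card_filter_range_eq (P : ℕ → Prop) [DecidablePred P] :
    ((Finset.range n).filter P).card = (Finset.univ.filter fun v : Fin n => P v).card := by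
  rw [Finset.card_filter, Finset.card_filter, Finset.sum_range]

theorem Instance.distLe_iff (i j k l : Fin n) : I.distLe i j k l ↔ I.d i j ≤ I.d k l :=
  ⟨fun ⟨_, _, _, _, h⟩ => h, fun h => ⟨i.2, j.2, k.2, l.2, h⟩⟩

theorem Instance.isReflGraph (k l : Fin n) : IsReflGraph n fun i j => I.distLe i j k l := by
  refine ⟨fun i j ⟨hi, _⟩ => hi, fun i hi => ?_, fun i j ⟨hi, hj, hk, hl, h⟩ => ?_⟩
  · exact ⟨hi, hi, k.2, l.2, by rw [I.d_self]; exact zero_le⟩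
  · exact ⟨hj, hi, hk, hl, by rwa [I.d_comm]⟩

theorem Instance.le_of_hops (k l : Fin n) {m : ℕ} : ∀ {i j : Fin n},
    Hops (fun i j => I.distLe i j k l) m i j → I.d i j ≤ m * I.d k l := by
  induction m with
  | zero =>
    intro i j h
    rw [Fin.ext (show (i : ℕ) = j from h), I.d_self]
    exact zero_le
  | succ m ih =>
    rintro i j ⟨w, ⟨hi, hw, hk, hl, h1⟩, h2⟩
    have h3 := ih (i := ⟨w, hw⟩) h2
    refine (I.d_triangle i ⟨w, hw⟩ j).trans ((add_le_add h1 h3).trans_eq ?_)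
    push_cast
    ring

/-- Some feasible solution has no larger cluster radius than the distance of `k` and `l`. -/
def Instance.Solvable (I : Instance (Fin n)) (k l : Fin n) : Prop :=
  ∃ S, I.IsFeasible S ∧ ∀ v ∈ S.C, I.d v (S.φ v) ≤ I.d k l

/-- The maximum defining the radius is attained at a client and its center. If nobody is served the
radius is `0`, the distance of a vertex to itself; this needs a vertex to exist. -/
theorem Instance.exists_solvable (hn : 0 < n) {S : Solution (Fin n)} (hS : I.IsFeasible S) :
    ∃ k l, I.Solvable k l ∧ I.d k l = I.radius S := by
  have hle : ∀ v ∈ S.C, I.d v (S.φ v) ≤ I.radius S := fun v hv =>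
    Finset.le_sup (f := fun v => I.d v (S.φ v)) hv
  rcases S.C.eq_empty_or_nonempty with h | h
  · have h0 : I.radius S = 0 := by rw [Instance.radius, h, Finset.sup_empty]; rfl
    exact ⟨⟨0, hn⟩, ⟨0, hn⟩, ⟨S, hS, fun v hv => by rw [h] at hv; simp at hv⟩,
      by rw [I.d_self, h0]⟩
  · obtain ⟨v, hv, he⟩ := Finset.exists_mem_eq_sup S.C h fun v => I.d v (S.φ v)
    exact ⟨v, S.φ v, ⟨S, hS, fun w hw => (hle w hw).trans_eq he⟩, he.symm⟩

/-- A feasible solution of the problem as an assignment in the threshold graph. -/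
theorem Instance.IsFeasible.exists_service {S : Solution (Fin n)} (hS : I.IsFeasible S)
    {k l : Fin n} (hd : ∀ v ∈ S.C, I.d v (S.φ v) ≤ I.d k l) :
    ∃ C φ, IsService n (I.L + (1 - I.L)) (fun i j => I.distLe i j k l) (I.input.vec aU) C φ ∧
      C.card = S.C.card := by
  set φ : ℕ → ℕ := fun i => if h : i < n then S.φ ⟨i, h⟩ else 0 with hφ
  have hφv : ∀ v : Fin n, φ v = S.φ v := fun v => by simp [hφ]
  have hU : ∀ v : Fin n, I.input.vec aU v = I.U v := fun v => by
    simp [Store.vec, Instance.input]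
  set C := S.C.map Fin.valEmbedding with hC
  have hmem : ∀ i, i ∈ C ↔ ∃ v ∈ S.C, (v : ℕ) = i := fun i => by
    rw [hC, Finset.mem_map]; rfl
  have hcnt : ∀ u : Fin n, (C.filter fun w => φ w = u).card =
      (S.C.filter fun w => S.φ w = u).card := by
    intro u
    rw [hC, Finset.filter_map, Finset.card_map]
    refine congrArg Finset.card (Finset.filter_congr fun w _ => ?_)
    show φ w = u ↔ _
    rw [hφv, Fin.val_inj]
  -- A center used by `v` serves at least `v`. This allows the lower bound `max L 1`; centers
  -- without clients are ignored.
  have hlow : ∀ v ∈ S.C, I.L + (1 - I.L) ≤ (S.C.filter fun w => S.φ w = S.φ v).card := by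
    intro v hv
    have h1 := hS.lower _ (hS.mapsTo v hv)
    have h2 : 0 < (S.C.filter fun w => S.φ w = S.φ v).card :=
      Finset.card_pos.2 ⟨v, Finset.mem_filter.2 ⟨hv, rfl⟩⟩
    omega
  refine ⟨C, φ, ⟨?_, ?_, ?_, ?_, ?_⟩, Finset.card_map _⟩
  · intro i hi
    obtain ⟨v, hv, rfl⟩ := (hmem i).1 hi
    exact v.2
  · intro i hi
    obtain ⟨v, hv, rfl⟩ := (hmem i).1 hi
    rw [hφv]
    refine ⟨(S.φ v).2, (hlow v hv).trans ?_, ?_⟩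
    · rw [← hcnt]
      refine Finset.card_le_card fun i hi => ?_
      rw [Finset.mem_filter] at hi ⊢
      obtain ⟨w, hw, rfl⟩ := (hmem i).1 hi.1
      have hwv : S.φ w = S.φ v := Fin.ext (by rw [← hφv]; exact hi.2)
      exact ⟨Finset.mem_range.2 w.2, (Instance.distLe_iff _ _ _ _).2
        (by rw [I.d_comm, ← hwv]; exact hd w hw)⟩
    · rw [hU]
      exact (hlow v hv).trans (hS.upper _ (hS.mapsTo v hv))
  · intro i hi
    obtain ⟨v, hv, rfl⟩ := (hmem i).1 hi
    rw [hφv]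
    exact (Instance.distLe_iff _ _ _ _).2 (hd v hv)
  · intro i hi
    obtain ⟨v, hv, rfl⟩ := (hmem i).1 hi
    rw [hφv, hcnt]
    exact hlow v hv
  · intro i hi
    obtain ⟨v, hv, rfl⟩ := (hmem i).1 hi
    rw [hφv, hcnt, hU]
    exact hS.upper _ (hS.mapsTo v hv)

/-- An assignment to vertices within `11` hops as a solution of the problem. -/
theorem Instance.exists_solution {M F : ℕ → ℕ} {k l : Fin n}
    (hM : IsAssignment n (Near (fun i j => I.distLe i j k l) F) M) (hFn : ∀ u, F u ≠ 0 → u < n)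
    (hload : ∀ u, F u ≠ 0 → I.L + (1 - I.L) ≤ load n M u ∧ load n M u ≤ I.input.vec aU u)
    (hp : I.p ≤ ((Finset.range n).filter fun i => M i ≠ 0).card) :
    ∃ S, I.IsFeasible S ∧ I.radius S ≤ 11 * I.d k l ∧ (∀ v : Fin n, v ∈ S.C ↔ M v ≠ 0) ∧
      (∀ v : Fin n, v ∈ S.F ↔ F v ≠ 0) ∧ ∀ v ∈ S.C, M v - 1 = (S.φ v : ℕ) := by
  have hMF : ∀ v : Fin n, M v ≠ 0 → ∃ u : Fin n, M v = u + 1 ∧ F u ≠ 0 ∧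
      Hops (fun i j => I.distLe i j k l) 11 v u := by
    intro v hv
    obtain ⟨u, hu⟩ := Nat.exists_eq_succ_of_ne_zero hv
    obtain ⟨h1, h2⟩ := hM v v.2 u hu
    exact ⟨⟨u, hFn u h1⟩, hu, h1, h2⟩
  have hU : ∀ v : Fin n, I.input.vec aU v = I.U v := fun v => by
    simp [Store.vec, Instance.input]
  -- `M v = u + 1` encodes the center `u`. The default `v` in the assignment occurs for no served
  -- vertex.
  set S : Solution (Fin n) :=
    ⟨Finset.univ.filter fun v => M v ≠ 0, Finset.univ.filter fun u => F u ≠ 0,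
      fun v => if h : M v - 1 < n then ⟨M v - 1, h⟩ else v⟩ with hS
  have hC : ∀ v : Fin n, v ∈ S.C ↔ M v ≠ 0 := fun v => by simp [hS]
  have hF : ∀ v : Fin n, v ∈ S.F ↔ F v ≠ 0 := fun v => by simp [hS]
  have hφ : ∀ v u : Fin n, M v = u + 1 → S.φ v = u := by
    intro v u h
    have : M v - 1 = u := by omega
    simp [hS, this]
  have hcnt : ∀ u : Fin n, (S.C.filter fun v => S.φ v = u).card = load n M u := by
    intro u
    rw [load, card_filter_range_eq]
    refine congrArg Finset.card (Finset.ext fun v => ?_)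
    simp only [Finset.mem_filter, Finset.mem_univ, true_and, hC]
    constructor
    · rintro ⟨h1, h2⟩
      obtain ⟨u', hu', -⟩ := hMF v h1
      rw [hφ v u' hu'] at h2
      rw [hu', h2]
    · intro h
      exact ⟨by omega, hφ v u h⟩
  refine ⟨S, ⟨?_, ?_, ?_, ?_⟩, ?_, hC, hF, ?_⟩
  · rw [card_filter_range_eq] at hp
    refine hp.trans_eq (congrArg Finset.card (Finset.ext fun v => ?_))
    simp [hC]
  · intro v hv
    obtain ⟨u, hu, hFu, -⟩ := hMF v ((hC v).1 hv)
    rw [hφ v u hu, hF]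
    exact hFu
  · intro u hu
    rw [hcnt]
    have := (hload u ((hF u).1 hu)).1
    omega
  · intro u hu
    rw [hcnt, ← hU]
    exact (hload u ((hF u).1 hu)).2
  · refine Finset.sup_le fun v hv => ?_
    obtain ⟨u, hu, -, h⟩ := hMF v ((hC v).1 hv)
    rw [hφ v u hu]
    exact Instance.le_of_hops k l h
  · intro v hv
    obtain ⟨u, hu, -⟩ := hMF v ((hC v).1 hv)
    rw [hφ v u hu, hu, Nat.add_sub_cancel]

/-- The invariant of the algorithm: the output is a good solution for the best pair so far, and all
solvable pairs that satisfy `Done` are no better. -/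
structure IsProgress (I : Instance (Fin n)) (s : Store) (Done : ℕ → ℕ → Prop) : Prop where
  clean : Clean s
  size : s.reg 0 = n
  low : s.reg 1 = I.L
  served : s.reg 2 = I.p
  capacity : s.arr aU = I.input.arr aU
  output : s.reg 6 ≠ 0 → ∃ k l : Fin n, s.reg 7 = k ∧ s.reg 8 = l ∧
    ∃ S, s.Outputs S ∧ I.IsFeasible S ∧ I.radius S ≤ 11 * I.d k l
  best : ∀ k l : Fin n, Done k l → I.Solvable k l →
    s.reg 6 ≠ 0 ∧ I.distLe (s.reg 7) (s.reg 8) k l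

theorem IsProgress.congr {Done Done' : ℕ → ℕ → Prop} {s' : Store} (h : IsProgress I s Done)
    (hc : Clean s') (hr : ∀ r ∈ [0, 1, 2, 6, 7, 8], s'.reg r = s.reg r)
    (ha : ∀ a ∈ [aU, 1, 2, 3], s'.arr a = s.arr a)
    (hD : ∀ k l : Fin n, Done' k l → Done k l) : IsProgress I s' Done' := by
  have r0 := hr 0 (by decide)
  have r1 := hr 1 (by decide)
  have r2 := hr 2 (by decide)
  have r6 := hr 6 (by decide)
  have r7 := hr 7 (by decide)
  have r8 := hr 8 (by decide)
  refine ⟨hc, r0.trans h.size, r1.trans h.low, r2.trans h.served,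
    (ha aU (by decide)).trans h.capacity, ?_, fun k l hkl hS => ?_⟩
  · rw [r6, r7, r8]
    intro h6
    obtain ⟨k, l, h1, h2, S, h3, h4⟩ := h.output h6
    refine ⟨k, l, h1, h2, S, ?_, h4⟩
    unfold Store.Outputs at h3 ⊢
    rw [ha 1 (by decide), ha 2 (by decide), ha 3 (by decide)]
    exact h3
  · rw [r6, r7, r8]
    exact h.best k l (hD k l hkl) hS

theorem record_spec {D : ℕ → ℕ → ℕ → ℕ → Prop} (hs : Clean s) :
    (∀ v < s.reg 0, (record.eval D s).arr 1 v 0 = s.vec aMA v ∧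
      (record.eval D s).arr 2 v 0 = s.vec aFF v ∧
      (record.eval D s).arr 3 v 0 = s.vec aMA v - 1) ∧
    (record.eval D s).reg 6 = 1 ∧ (record.eval D s).reg 7 = s.reg 3 ∧
      (record.eval D s).reg 8 = s.reg 4 := by
  set s₁ := (upd 1 (vec aMA (var 0))).eval D s with hs₁
  have hc₁ : Clean s₁ := eval_clean _ (by decide) _ hs
  have r₁ : s₁.reg = s.reg := rfl
  set s₂ := (upd 2 (vec aFF (var 0))).eval D s₁ with hs₂
  have hc₂ : Clean s₂ := eval_clean _ (by decide) _ hc₁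
  have r₂ : s₂.reg = s.reg := rfl
  set s₃ := (upd 3 (minus (vec aMA (var 0)) (const 1))).eval D s₂ with hs₃
  have r₃ : s₃.reg = s.reg := rfl
  have hfin : record.eval D s = (setR 8 (reg 4)).eval D ((setR 7 (reg 3)).eval D
      ((setR 6 (const 1)).eval D s₃)) := rfl
  have harr : (record.eval D s).arr = s₃.arr := rfl
  refine ⟨fun v hv => ?_, rfl, ?_, ?_⟩
  · rw [harr]
    refine ⟨?_, ?_, ?_⟩
    · rw [hs₃, eval_upd_arr_of_ne (by decide), hs₂, eval_upd_arr_of_ne (by decide), hs₁,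
        eval_upd_vec hs, if_pos hv]
      rfl
    · rw [hs₃, eval_upd_arr_of_ne (by decide), hs₂, eval_upd_vec hc₁, r₁, if_pos hv, eval_vec,
        eval_var, env2_zero, hs₁, eval_upd_arr_of_ne (by decide)]
    · rw [hs₃, eval_upd_vec hc₂, r₂, if_pos hv, eval_minus, eval_vec, eval_var, env2_zero,
        eval_const, hs₂, eval_upd_arr_of_ne (by decide), hs₁, eval_upd_arr_of_ne (by decide)]
  · rw [hfin]; simp [eval_setR_reg, r₃]
  · rw [hfin]; simp [eval_setR_reg, r₃]

/-- A pair may be recorded without being solvable: serving `p` clients within `11` hops is all that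
the output needs. A solvable pair always passes this test, so if it is not recorded, then an earlier
recorded pair has a strictly smaller distance. -/
theorem tryPair_spec {Done : ℕ → ℕ → Prop} (h : IsProgress I s Done) {k l : Fin n}
    (hk : s.reg 3 = k) (hl : s.reg 4 = l) :
    IsProgress I (tryPair.eval I.distLe s) fun k' l' => Done k' l' ∨ k' = k ∧ l' = l := by
  have hgraph : (fun i j => I.distLe i j (s.reg 3) (s.reg 4)) = fun i j => I.distLe i j k l := by
    rw [hk, hl]
  have hD : ∀ i j, I.distLe i j (s.reg 3) (s.reg 4) → i < s.reg 0 ∧ j < s.reg 0 := by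
    rintro i j ⟨hi, hj, -⟩
    rw [h.size]
    exact ⟨hi, hj⟩
  have hadj : IsReflGraph (s.reg 0) fun i j => I.distLe i j (s.reg 3) (s.reg 4) := by
    rw [hgraph, h.size]
    exact Instance.isReflGraph k l
  have hU : s.vec aU = I.input.vec aU := by
    funext v; rw [Store.vec, h.capacity]
  obtain ⟨hM, hload, hmax⟩ := solvePair_spec h.clean hD hadj
  rw [hgraph, h.size] at hM
  rw [h.size, h.low, hU] at hload
  rw [hgraph, h.size, h.low, hU] at hmax
  have hc₁ : Clean (solvePair.eval I.distLe s) := eval_clean _ (by decide) _ h.clean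
  have h₁ : IsProgress I (solvePair.eval I.distLe s) Done :=
    h.congr hc₁ (fun r hr => eval_reg_of_notMem _ (by revert r; decide) s)
      (fun a ha => eval_arr_of_notMem _ (by revert a; decide) s) fun _ _ hd => hd
  have k₁ : (solvePair.eval I.distLe s).reg 3 = k := by
    rw [eval_reg_of_notMem _ (by decide), hk]
  have l₁ : (solvePair.eval I.distLe s).reg 4 = l := by
    rw [eval_reg_of_notMem _ (by decide), hl]
  rw [tryPair, eval_seq]
  set s₁ := solvePair.eval I.distLe s with hs₁
  have hsolv : I.Solvable k l →
      I.p ≤ ((Finset.range n).filter fun i => s₁.vec aMA i ≠ 0).card := by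
    rintro ⟨S, hS, hd⟩
    obtain ⟨C, φ, hC, hcard⟩ := hS.exists_service hd
    exact hS.p_le_card.trans (hcard ▸ hmax C φ hC)
  have hcond : (and (le (reg 2) (count 2 (vec aMA (var 2))))
        (or (not (reg 6)) (dle (reg 3) (reg 4) (reg 7) (reg 8)))).Holds I.distLe s₁
        (fun _ => s₁.reg 0) ↔
      I.p ≤ ((Finset.range n).filter fun i => s₁.vec aMA i ≠ 0).card ∧
        (s₁.reg 6 = 0 ∨ I.distLe k l (s₁.reg 7) (s₁.reg 8)) := by
    simp [h₁.size, h₁.served, k₁, l₁]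
  rw [eval_ite]
  by_cases hc : I.p ≤ ((Finset.range n).filter fun i => s₁.vec aMA i ≠ 0).card ∧
        (s₁.reg 6 = 0 ∨ I.distLe k l (s₁.reg 7) (s₁.reg 8))
  · rw [if_pos (hcond.2 hc)]
    obtain ⟨S, hS, hrad, hSC, hSF, hSφ⟩ := Instance.exists_solution hM
      (fun u hu => by have := (hc₁ _ _ _ hu).1; rwa [h₁.size] at this) hload hc.1
    obtain ⟨ho, r6, r7, r8⟩ := record_spec (D := I.distLe) hc₁
    have hr : ∀ r ∈ [0, 1, 2], (record.eval I.distLe s₁).reg r = s₁.reg r := fun r hr =>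
      eval_reg_of_notMem _ (by revert r; decide) _
    have e0 : (record.eval I.distLe s₁).arr aU = s₁.arr aU :=
      funext fun i => funext fun j => by rw [eval_arr_of_notMem _ (by decide)]
    refine ⟨eval_clean _ (by decide) _ hc₁, (hr 0 (by decide)).trans h₁.size,
      (hr 1 (by decide)).trans h₁.low, (hr 2 (by decide)).trans h₁.served,
      e0.trans h₁.capacity, fun _ => ⟨k, l, r7.trans k₁, r8.trans l₁, S, ⟨?_, ?_, ?_⟩,
      hS, hrad⟩, ?_⟩
    · intro v
      rw [(ho v (by rw [h₁.size]; exact v.2)).1]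
      exact hSC v
    · intro v
      rw [(ho v (by rw [h₁.size]; exact v.2)).2.1]
      exact hSF v
    · intro v hv
      exact (ho v (by rw [h₁.size]; exact v.2)).2.2.trans (hSφ v hv)
    · intro k' l' hd hsol
      rw [r6, r7, r8, k₁, l₁]
      refine ⟨Nat.one_ne_zero, ?_⟩
      rcases hd with hd | ⟨h1, h2⟩
      · obtain ⟨h6, hb1, hb2, hb3, hb4, hb⟩ := h₁.best k' l' hd hsol
        obtain ⟨ha1, ha2, ha3, ha4, ha⟩ := hc.2.resolve_left h6
        exact ⟨ha1, ha2, hb3, hb4, ha.trans hb⟩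
      · exact ⟨k.2, l.2, k'.2, l'.2, by rw [Fin.ext h1, Fin.ext h2]⟩
  · rw [if_neg fun h => hc (hcond.1 h)]
    have h₂ : IsProgress I ((setR 6 (reg 6)).eval I.distLe s₁) Done := by
      refine h₁.congr (eval_clean _ (by decide) _ hc₁) (fun r _ => ?_) (fun _ _ => rfl)
        fun _ _ hd => hd
      rw [eval_setR_reg, eval_reg]
      split_ifs with h6
      · rw [h6]
      · rfl
    refine ⟨h₂.clean, h₂.size, h₂.low, h₂.served, h₂.capacity, h₂.output, fun k' l' hd hsol => ?_⟩
    rcases hd with hd | ⟨h1, h2⟩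
    · exact h₂.best k' l' hd hsol
    · have hk' : k' = k := Fin.ext h1
      have hl' : l' = l := Fin.ext h2
      subst hk' hl'
      have hc' : ¬ (s₁.reg 6 = 0 ∨ I.distLe k' l' (s₁.reg 7) (s₁.reg 8)) :=
        fun h => hc ⟨hsolv hsol, h⟩
      push Not at hc'
      refine ⟨hc'.1, ?_⟩
      show I.distLe (s₁.reg 7) (s₁.reg 8) k' l'
      obtain ⟨b, b', hb, hb', -⟩ := h₁.output hc'.1
      rw [hb, hb'] at hc' ⊢
      rw [Instance.distLe_iff] at hc' ⊢
      exact (not_le.1 hc'.2).le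

theorem tryRow_spec {m : ℕ} (hm : m < n) (h : IsProgress I s fun k _ => k < m)
    (h3 : s.reg 3 = m) :
    IsProgress I (tryRow.eval I.distLe s) (fun k _ => k < m + 1) ∧
      (tryRow.eval I.distLe s).reg 3 = m + 1 := by
  set body : Cmd := seq tryPair (setR 4 (plus (reg 4) (const 1))) with hbody
  set s₁ := (setR 4 (const 0)).eval I.distLe s with hs₁
  have hset : ∀ (t : Store) (x : ℕ) (e : Tm) (Done Done' : ℕ → ℕ → Prop),
      x ∉ [0, 1, 2, 6, 7, 8] → (∀ k l : Fin n, Done' k l → Done k l) → IsProgress I t Done →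
      IsProgress I ((setR x e).eval I.distLe t) Done' := by
    intro t x e Done Done' hx hD ht
    refine ht.congr (eval_clean _ (fun h0 => hx ?_) _ ht.clean) (fun r hr => ?_) (fun _ _ => rfl) hD
    · rw [regs, List.mem_singleton] at h0
      rw [← h0]; decide
    · rw [eval_setR_reg, if_neg]
      rintro rfl
      exact hx hr
  have key : ∀ j ≤ n, IsProgress I ((body.eval I.distLe)^[j] s₁)
      (fun k l => k < m ∨ k = m ∧ l < j) ∧ ((body.eval I.distLe)^[j] s₁).reg 3 = m ∧
      ((body.eval I.distLe)^[j] s₁).reg 4 = j := by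
    intro j
    induction j with
    | zero =>
      intro _
      exact ⟨hset _ _ _ _ _ (by decide) (fun k l h => by omega) h, h3, rfl⟩
    | succ j ih =>
      intro hj
      obtain ⟨hp, hr3, hr4⟩ := ih (by omega)
      rw [Function.iterate_succ_apply']
      set t := (body.eval I.distLe)^[j] s₁ with ht
      have hstep := tryPair_spec hp (k := ⟨m, hm⟩) (l := ⟨j, by omega⟩) hr3 hr4
      refine ⟨hset _ _ _ _ _ (by decide) (fun k l h => ?_) hstep, ?_, ?_⟩
      · show (_ ∨ _) ∨ (_ = m ∧ _ = j)
        omega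
      · rw [eval_reg_of_notMem body (by decide), hr3]
      · rw [hbody, eval_seq, eval_setR_reg, if_pos rfl, eval_plus, eval_reg, eval_const,
          eval_reg_of_notMem tryPair (by decide), hr4]
  obtain ⟨hp, hr3, -⟩ := key n le_rfl
  have hfin : tryRow.eval I.distLe s = (setR 3 (plus (reg 3) (const 1))).eval I.distLe
      ((body.eval I.distLe)^[s.reg 0] s₁) := rfl
  rw [hfin, h.size]
  refine ⟨hset _ _ _ _ _ (by decide) (fun k l h => ?_) hp, ?_⟩
  · have := l.2
    omega
  · rw [eval_setR_reg, if_pos rfl, eval_plus, eval_reg, eval_const, hr3]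

theorem clean_input : Clean I.input := by
  intro a i j h
  simp only [Instance.input] at h
  split_ifs at h with h1 h2
  · show i < n ∧ j < n
    omega
  all_goals exact absurd rfl h

theorem tryAll_spec : IsProgress I (tryAll.eval I.distLe I.input) fun k _ => k < n := by
  have key : ∀ m ≤ n, IsProgress I ((tryRow.eval I.distLe)^[m] I.input) (fun k _ => k < m) ∧
      ((tryRow.eval I.distLe)^[m] I.input).reg 3 = m := by
    intro m
    induction m with
    | zero =>
      intro _
      exact ⟨⟨clean_input, rfl, rfl, rfl, rfl, fun h => absurd rfl h,
        fun _ _ h => absurd h (Nat.not_lt_zero _)⟩, rfl⟩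
    | succ m ih =>
      intro hm
      obtain ⟨h1, h2⟩ := ih (by omega)
      rw [Function.iterate_succ_apply']
      exact tryRow_spec (by omega) h1 h2
  exact (key n le_rfl).1

theorem IsProgress.exists_approx (h : IsProgress I s fun k _ => k < n)
    (hS : ∃ S, I.IsFeasible S) : ∃ S, s.Outputs S ∧ I.IsApprox 11 S := by
  obtain ⟨S₀, hS₀⟩ := hS
  rcases Nat.eq_zero_or_pos n with rfl | hn
  -- Without vertices no pair is tried, and any memory represents the given feasible solution.
  · refine ⟨S₀, ⟨fun v => v.elim0, fun v => v.elim0, fun v => v.elim0⟩, hS₀, fun S' _ => ?_⟩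
    exact Finset.sup_le fun v => v.elim0
  · obtain ⟨k₀, l₀, hsol₀, -⟩ := Instance.exists_solvable hn hS₀
    obtain ⟨k, l, hk, hl, S, hout, hfeas, hrad⟩ := h.output (h.best k₀ l₀ k₀.2 hsol₀).1
    refine ⟨S, hout, hfeas, fun S' hS' => hrad.trans ?_⟩
    obtain ⟨k', l', hsol, heq⟩ := Instance.exists_solvable hn hS'
    have := (h.best k' l' k'.2 hsol).2
    rw [hk, hl, Instance.distLe_iff, heq] at this
    exact mul_le_mul_right this 11

theorem tryAll_wf : tryAll.wf = true := by decide

theorem exists_polyTimeApprox : ∃ P : Program, P.IsPolyTimeApprox 11 := by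
  obtain ⟨q, hq⟩ := tryAll.comp_correct tryAll_wf
  refine ⟨tryAll.comp tempReg, q, fun n I => ?_⟩
  obtain ⟨s, t, hE, ht, hag, -⟩ := hq I.distLe tempReg I.input I.input le_rfl (Agree.refl _)
  refine ⟨s, t, hE, ht, fun hS => ?_⟩
  obtain ⟨S, hout, hS⟩ := tryAll_spec.exists_approx hS
  refine ⟨S, ?_, hS⟩
  unfold Store.Outputs at hout ⊢
  rwa [hag.2 1 (by decide), hag.2 2 (by decide), hag.2 3 (by decide)]

end Main

end CapCenter

theorem mainTheorem3 : ∃ P : CapCenter.Program, P.IsPolyTimeApprox 11 :=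
  CapCenter.exists_polyTimeApprox
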